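/- **Setting.** Let $\Bbbk$ be a field of characteristic zero and $\mathfrak g=\bigoplus_{i\in\mathbb Z}\mathfrak g^i$ a dg Lie algebra over $\Bbbk$. Write $\Omega^*=\Omega^0\oplus\Omega^1$ for the commutative dg algebra of differential forms on $[0,1]$, either polynomial ($\Omega^0=\Bbbk[t]$) or smooth ($\Bbbk=\mathbb R$, $\Omega^0=C^\infty([0,1])$, $\dim\mathfrak g<\infty$), $C^*=\{at+b(1-t)\}\oplus\{c\,dt\}$ for the Whitney forms, $\mathbf s$ for the suspension, and $\Omega^0([0,1];\mathfrak g)=\Omega^0\otimes\mathfrak g$, $\Omega^*([0,1];\mathfrak g)=\Omega^*\otimes\mathfrak g$. Integrals of polynomials are formal. Let $B_k$ be the Bernoulli numbers ($B_1=-\tfrac12$) and $B_n(t)$ the Bernoulli polynomials. Consider the morphisms of $A_\infty$ algebras given by the following Taylor coefficients. * $\lambda:\Omega^*\to C^*_\cup$: $\lambda_1(f+a\,dt)=f(1)t+f(0)(1-t)+(\int_0^1a)\,dt$; for $n\ge 2$, $\lambda_n$ vanishes if an argument is a zero-form, and $\lambda_n(\mathbf s a_1dt\otimes\cdots\otimes\mathbf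 s a_ndt)=\big(\int_{0\le t_1\le\cdots\le t_n\le1}a_1(t_1)\cdots a_n(t_n)\,dt_1\cdots dt_n\big)\mathbf s dt$. * $\mu:C^*_\infty\to\Omega^*$, unital: $\mu_1$ is the inclusion; for $n\geq1$, $\mu_{n+1}$ vanishes unless exactly one argument is a function, and $\mu_{n+1}((\mathbf sdt)^{\otimes i}\otimes\mathbf st\otimes(\mathbf sdt)^{\otimes n-i})=\mathbf s\,(-1)^i\binom ni\frac{B_{n+1}(t)-B_{n+1}}{(n+1)!}$. * $\exp=\lambda\circ\mu$, $\log=\exp^{-1}$, $\varphi=\log\circ\lambda:\Omega^*\to C^*_\infty$, and $\varphi_s=\varphi\circ\beta_s^*$, where $\beta_s(t)=st$ ($s\in\Bbbk$, resp. $s\in[0,1]$ in the smooth case). The extension of scalars of $\varphi_s$ by $\mathfrak g$ is the $L_\infty$ morphism $\varphi_s:\Omega^*([0,1];\mathfrak g)\to C^*_\infty([0,1];\mathfrak g)$ whose Taylor coefficients, after composition with $\mathfrak g\to\mathcal U(\mathfrak g)$, are the symmetrizations of the Taylor coefficients of the extension of scalars of $\varphi_s$ by the universal enveloping algebra $\mathcal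 U(\mathfrak g)$. Define $\mathcal M_n$, $n\ge1$, on $\Omega^0([0,1];\mathfrak g)$ with values in $\Omega^0([0,1];\mathfrak g)$ by $$\mathcal M_n(l_1\odot\cdots\odot l_n)(s)\,\mathbf sdt=\varphi_{s,n}(\mathbf sl_1dt\odot\cdots\odot\mathbf sl_ndt).$$ **Theorem.** The Taylor coefficients of this extension exist and are unique, the maps $\mathcal M_n$ are well defined, and the following holds, where $l_1,\dots,l_n$ are homogeneous and $\varepsilon(\tau)$ is the Koszul sign, $l_1\odot\cdots\odot l_n=\varepsilon(\tau)\,l_{\tau(1)}\odot\cdots\odot l_{\tau(n)}$. 1. For $n\ge1$, with $d_\sigma$ the number of descents of $\sigma$, $$\mathcal M_n(l_1\odot\cdots\odot l_n)(s)=\int_{0\le t_1\le\cdots\le t_n\le s}\frac1{n^2}\sum_{\sigma,\tau\in S_n}\varepsilon(\tau)\frac{(-1)^{d_\sigma}}{\binom{n-1}{d_\sigma}}\big[l_{\tau(1)}(t_{\sigma(1)}),\cdots[l_{\tau(n-1)}(t_{\sigma(n-1)}),l_{\tau(n)}(t_{\sigma(n)})]\cdots\big]\,dt_1\cdots dt_n.$$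 2. Equivalently, the $\mathcal M_n$ satisfy, and are determined on homogeneous arguments by, the recursion $\mathcal M_1(l_1)(s)=\int_0^sl_1(t_1)\,dt_1$ and, for $n\ge2$, $$\mathcal M_n(l_1\odot\cdots\odot l_n)(s)=\sum_{k=1}^{n-1}(-1)^k\frac{B_k}{k!}\sum_{i_1+\cdots+i_k=n-1}\frac1{i_1!\cdots i_k!}\sum_{\sigma\in S_n}\varepsilon(\sigma)\int_0^s\big[\mathcal M_{i_1}(\cdots)(t_n),\cdots[\mathcal M_{i_k}(\cdots)(t_n),l_{\sigma(n)}(t_n)]\cdots\big]\,dt_n,$$ where all $i_j\geq1$ and the dots inside $\mathcal M_{i_1}(\cdots),\dots,\mathcal M_{i_k}(\cdots)$ are filled with $l_{\sigma(1)},\dots,l_{\sigma(n-1)}$ in this order. 3. In particular, let $l\in\Omega^0([0,1];\mathfrak g^0)$ and $P_n=\frac1{n!}\mathcal M_n(l\odot\cdots\odot l)$, the $n$-th term of the pushforward of $l\,dt$ along $\varphi_s$. Then the $P_n$ are given by the formula of Mielnik and Plebański, $$P_n(s)=\int_{0\le t_1\le\cdots\le t_n\le s}\frac1{n^2}\sum_{\sigma\in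 S_n}\frac{(-1)^{d_\sigma}}{\binom{n-1}{d_\sigma}}\big[l(t_{\sigma(1)}),\cdots[l(t_{\sigma(n-1)}),l(t_{\sigma(n)})]\cdots\big]\,dt_1\cdots dt_n,$$ and by the recursion of Magnus, $P_1(s)=\int_0^sl(t_1)\,dt_1$ and, for $n\ge2$, $$P_n(s)=\sum_{k=1}^{n-1}(-1)^k\frac{B_k}{k!}\sum_{i_1+\cdots+i_k=n-1}\int_0^s\big[P_{i_1}(t_n),\cdots[P_{i_k}(t_n),l(t_n)]\cdots\big]\,dt_n.$$ -/

import Mathlib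

open scoped TensorProduct ContDiff
open MeasureTheory

noncomputable section

namespace Magnus

/-! ## Combinatorial signs and numbers -/

/-- The Koszul sign `ε(τ)` for variables of degrees `q i`:
`x_1 ⊙ ⋯ ⊙ x_n = ε(τ) x_{τ(1)} ⊙ ⋯ ⊙ x_{τ(n)}`. -/
def koszulSign {n : ℕ} (q : Fin n → ℤ) (τ : Equiv.Perm (Fin n)) : ℤˣ :=
  ∏ p ∈ (Finset.univ : Finset (Fin n × Fin n)).filter (fun p => p.1 < p.2 ∧ τ p.2 < τ p.1),
    (q (τ p.1) * q (τ p.2)).negOnePow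

/-- The descent number of a permutation of `n + 1` letters. -/
def descents {n : ℕ} (σ : Equiv.Perm (Fin (n + 1))) : ℕ :=
  ((Finset.univ : Finset (Fin n)).filter (fun i => σ i.succ < σ i.castSucc)).card

/-- `[u_1, [u_2, ⋯ [u_k, z] ⋯ ]]`. -/
def nest {V : Type*} (b : V → V → V) {k : ℕ} (u : Fin k → V) (z : V) : V :=
  (List.ofFn u).foldr (fun x y => b x y) z

/-- `[x_1, [x_2, ⋯ [x_n, x_{n+1}] ⋯ ]]`. -/
def nestedBracket {V : Type*} (b : V → V → V) {n : ℕ} (x : Fin (n + 1) → V) : V :=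
  nest b (fun i : Fin n => x i.castSucc) (x (Fin.last n))

/-- For an ordered partition `i_1 + ⋯ + i_k` (a `Composition`), the number
`(-1)^k (B_k / k!) / (i_1! ⋯ i_k!)`. -/
def recursionCoeff {n : ℕ} (c : Composition n) : ℚ :=
  (-1) ^ c.length * bernoulli c.length / (c.length.factorial : ℚ)
    / ∏ j : Fin c.length, ((c.blocksFun j).factorial : ℚ)

/-- The number `(1 / n²) (-1)^{d_σ} / binom(n-1, d_σ)` for a permutation `σ` of `n = m + 1`
letters. -/
def eulerianCoeff {m : ℕ} (σ : Equiv.Perm (Fin (m + 1))) : ℚ :=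
  1 / ((m : ℚ) + 1) ^ 2 * ((-1) ^ descents σ / (m.choose (descents σ) : ℚ))

/-! ## Morphisms given by Taylor coefficients

An `A_∞` morphism from `V` to `W` is recorded by its Taylor coefficients
`F n : (sV)^{⊗ n} → sW`, written as functions of `n` vectors. They have degree zero on the
suspensions, so no signs occur in compositions. The entry `F 0` is `0`. -/

/-- Taylor coefficients of the composition `G ∘ F`:
`(G ∘ F)_n = ∑_{i_1 + ⋯ + i_k = n} G_k (F_{i_1} ⊗ ⋯ ⊗ F_{i_k})`. -/
def compTaylor {U V W : Type*} [AddCommMonoid W]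
    (G : ∀ n, (Fin n → V) → W) (F : ∀ n, (Fin n → U) → V) (n : ℕ) (v : Fin n → U) : W :=
  ∑ c : Composition n, G c.length (fun j => F (c.blocksFun j) (v ∘ c.embedding j))

/-- Taylor coefficients of the identity. -/
def idTaylor {V : Type*} [AddCommMonoid V] : ∀ n, (Fin n → V) → V
  | 1, v => v 0
  | _, _ => 0

/-- Taylor coefficients of the inverse `G` of an isomorphism `F` whose linear part is the identity,
obtained by solving `F ∘ G = id`:
`G_1 = id` and `G_n = - ∑ F_k (G_{i_1} ⊗ ⋯ ⊗ G_{i_k})` for `n ≥ 2`, the sum running over the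
ordered partitions of `n` with at least two parts, i.e. with all parts smaller than `n`. -/
def invTaylor {V : Type*} [AddCommGroup V] (F : ∀ n, (Fin n → V) → V) : ∀ n, (Fin n → V) → V
  | 0, _ => 0
  | 1, v => v 0
  | n + 2, v => - ∑ c : Composition (n + 2),
      if h : ∀ j, c.blocksFun j < n + 2 then
        F c.length (fun j =>
          have := h j
          invTaylor F (c.blocksFun j) (v ∘ c.embedding j))
      else 0
termination_by n => n

/-- `invTaylor F` is indeed inverse to `F`. -/
theorem compTaylor_invTaylor {V : Type*} [AddCommGroup V] (F : ∀ n, (Fin n → V) → V)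
    (h0 : ∀ v, F 0 v = 0) (h1 : ∀ v, F 1 v = v 0) :
    compTaylor F (invTaylor F) = idTaylor := by
  have hF : ∀ (k : ℕ) (hk : k = 1) (w : Fin k → V), F k w = w ⟨0, by omega⟩ := by
    rintro k rfl w
    exact h1 w
  have hG : ∀ (N m : ℕ) (hm : m = N) (e : Fin m → Fin N) (v : Fin N → V),
      (∀ i, (e i : ℕ) = i) → invTaylor F m (v ∘ e) = invTaylor F N v := by
    rintro N m rfl e v he
    have : e = id := funext fun i => Fin.ext (he i)
    rw [this]
    rfl
  have hs : ∀ (N : ℕ) (hN : 0 < N) (v : Fin N → V),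
      F (Composition.single N hN).length (fun j => invTaylor F
        ((Composition.single N hN).blocksFun j) (v ∘ (Composition.single N hN).embedding j)) =
      invTaylor F N v := by
    intro N hN v
    rw [hF _ (Composition.single_length hN)]
    refine hG _ _ ?_ _ _ ?_
    · exact Composition.single_blocksFun hN _
    · intro i
      rw [Composition.coe_embedding]
      simp
  funext n v
  match n, v with
  | 0, v =>
    simp only [compTaylor, idTaylor]
    refine Finset.sum_eq_zero fun c _ => ?_
    have hc : c.length = 0 := Nat.le_zero.1 c.length_le
    have : ∀ (k : ℕ), k = 0 → ∀ w : Fin k → V, F k w = 0 := by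
      rintro k rfl w
      exact h0 w
    simpa using this _ hc _
  | 1, v =>
    simp only [compTaylor, idTaylor]
    rw [Finset.sum_eq_single (Composition.single 1 one_pos)]
    · rw [hs]
      simp [invTaylor]
    · intro c _ hc
      have hl : 0 < c.length := c.length_pos_of_pos one_pos
      have := (Composition.ne_single_iff one_pos).1 hc ⟨0, hl⟩
      have := c.one_le_blocksFun ⟨0, hl⟩
      omega
    · simp
  | n + 2, v =>
    simp only [compTaylor, idTaylor]
    have hpos : 0 < n + 2 := by omega
    rw [← Finset.add_sum_erase _ _ (Finset.mem_univ (Composition.single (n + 2) hpos)), hs,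
      invTaylor, ← Finset.add_sum_erase _ _ (Finset.mem_univ (Composition.single (n + 2) hpos)),
      dif_neg, zero_add, neg_add_eq_zero]
    · refine Finset.sum_congr rfl fun c hc => ?_
      rw [dif_pos ((Composition.ne_single_iff hpos).1 (Finset.ne_of_mem_erase hc))]
    · intro hlt
      exact (Composition.ne_single_iff hpos).2 hlt rfl

/-! ## Differential forms on the interval -/

/-- The data on an algebra `R` of functions on `[0,1]` that enter the construction. -/
structure FunctionAlgebra (𝕜 R : Type*) [Field 𝕜] [CommRing R] [Algebra 𝕜 R] where
  /-- the coordinate function `t` -/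
  coord : R
  /-- evaluation at `0` -/
  ev0 : R → 𝕜
  /-- evaluation at `1` -/
  ev1 : R → 𝕜
  /-- `∫_{0 ≤ t_1 ≤ ⋯ ≤ t_n ≤ 1} a_1(t_1) ⋯ a_n(t_n) dt_1 ⋯ dt_n` -/
  iteratedIntegral : ∀ n, (Fin n → R) → 𝕜

/-- Differential forms on `[0,1]`: the pair `(f, a)` is the form `f(t) + a(t) dt`. -/
abbrev Forms (R : Type*) := R × R

/-- Whitney forms on `[0,1]`: `((a, b), c)` is the form `a t + b (1 - t) + c dt`. -/
abbrev Whitney (𝕜 : Type*) := (𝕜 × 𝕜) × 𝕜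

/-- The grading of `sΩ^*([0,1])`: zero-forms have degree `-1` and one-forms have degree `0`. -/
def suspendedDeg (𝕜 R : Type*) [Field 𝕜] [CommRing R] [Algebra 𝕜 R] (p : ℤ) :
    Submodule 𝕜 (Forms R) :=
  if p = -1 then LinearMap.ker (LinearMap.snd 𝕜 R R)
  else if p = 0 then LinearMap.ker (LinearMap.fst 𝕜 R R)
  else ⊥

section Morphisms

variable {𝕜 R : Type*} [Field 𝕜] [CommRing R] [Algebra 𝕜 R]

/-- Gugenheim's morphism `λ : Ω^*([0,1]) → C^*_∪([0,1])`: its linear part is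
`f + a dt ↦ f(1) t + f(0) (1 - t) + (∫ a) dt`, and the higher coefficients are iterated integrals of
one-forms, vanishing if some argument is a zero-form. -/
def gugenheim (S : FunctionAlgebra 𝕜 R) : ∀ n, (Fin n → Forms R) → Whitney 𝕜
  | 0, _ => 0
  | 1, v => ((S.ev1 (v 0).1, S.ev0 (v 0).1), S.iteratedIntegral 1 (fun i => (v i).2))
  | n + 2, v => ((0, 0), S.iteratedIntegral (n + 2) (fun i => (v i).2))

/-- The morphism `μ : C^*_∞([0,1]) → Ω^*([0,1])`: its linear part is the inclusion, it is unital
(the higher coefficients vanish if an argument is the constant function `1 = t + (1 - t)`), and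
`μ_{n+1}(dt^{⊗ i} ⊗ t ⊗ dt^{⊗ n-i}) = (-1)^i binom(n, i) (B_{n+1}(t) - B_{n+1}) / (n+1)!`, where
`μ_{n+1}`, `n ≥ 1`, vanishes unless precisely one argument is a function.
Note that `a t + b (1 - t) = b 1 + (a - b) t`. -/
def muMorphism [CharZero 𝕜] (S : FunctionAlgebra 𝕜 R) : ∀ n, (Fin n → Whitney 𝕜) → Forms R
  | 0, _ => 0
  | 1, v => ((v 0).1.1 • S.coord + (v 0).1.2 • (1 - S.coord), algebraMap 𝕜 R (v 0).2)
  | n + 2, v =>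
      (∑ i : Fin (n + 2),
        (((v i).1.1 - (v i).1.2) * (∏ j ∈ Finset.univ.erase i, (v j).2)
            * ((-1) ^ (i : ℕ) * ((n + 1).choose i : 𝕜) / ((n + 2).factorial : 𝕜))) •
          (Polynomial.aeval S.coord
              ((Polynomial.bernoulli (n + 2)).map (algebraMap ℚ 𝕜))
            - algebraMap 𝕜 R (algebraMap ℚ 𝕜 (bernoulli (n + 2)))), 0)

/-- `exp = λ ∘ μ : C^*_∞([0,1]) → C^*_∪([0,1])`. -/
def expMorphism [CharZero 𝕜] (S : FunctionAlgebra 𝕜 R) : ∀ n, (Fin n → Whitney 𝕜) → Whitney 𝕜 :=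
  compTaylor (gugenheim S) (muMorphism S)

/-- `log = exp⁻¹ : C^*_∪([0,1]) → C^*_∞([0,1])`. -/
def logMorphism [CharZero 𝕜] (S : FunctionAlgebra 𝕜 R) : ∀ n, (Fin n → Whitney 𝕜) → Whitney 𝕜 :=
  invTaylor (expMorphism S)

/-- `φ = log ∘ λ : Ω^*([0,1]) → C^*_∞([0,1])`. -/
def phi [CharZero 𝕜] (S : FunctionAlgebra 𝕜 R) : ∀ n, (Fin n → Forms R) → Whitney 𝕜 :=
  compTaylor (logMorphism S) (gugenheim S)

/-- `φ_s = φ ∘ β_s^*`, where `β_s^*(f(t) + a(t) dt) = f(st) + s a(st) dt`; the argument `scale` is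
the substitution `f(t) ↦ f(st)` in `R`. -/
def phiScaled [CharZero 𝕜] (S : FunctionAlgebra 𝕜 R) (s : 𝕜) (scale : R → R) :
    ∀ n, (Fin n → Forms R) → Whitney 𝕜 :=
  fun n v => phi S n (fun i => (scale (v i).1, s • scale (v i).2))

end Morphisms

/-! ## dg Lie algebras and extension of scalars -/

/-- A (cohomologically `ℤ`-graded) dg Lie algebra structure on the vector space `g`. -/
structure DGLieAlgebra (𝕜 g : Type*) [Field 𝕜] [AddCommGroup g] [Module 𝕜 g] where
  deg : ℤ → Submodule 𝕜 g
  isInternal : DirectSum.IsInternal deg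
  bracket : g →ₗ[𝕜] g →ₗ[𝕜] g
  bracket_mem : ∀ {i j : ℤ} {x y : g}, x ∈ deg i → y ∈ deg j → bracket x y ∈ deg (i + j)
  skew : ∀ {i j : ℤ} {x y : g}, x ∈ deg i → y ∈ deg j →
    bracket x y = -((i * j).negOnePow • bracket y x)
  jacobi : ∀ {i j : ℤ} {x y : g} (z : g), x ∈ deg i → y ∈ deg j →
    bracket x (bracket y z) =
      bracket (bracket x y) z + (i * j).negOnePow • bracket y (bracket x z)
  d : g →ₗ[𝕜] g
  d_mem : ∀ {i : ℤ} {x : g}, x ∈ deg i → d x ∈ deg (i + 1)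
  d_d : ∀ x, d (d x) = 0
  leibniz : ∀ {i : ℤ} {x : g} (y : g), x ∈ deg i →
    d (bracket x y) = bracket (d x) y + i.negOnePow • bracket x (d y)

namespace DGLieAlgebra

variable {𝕜 g : Type*} [Field 𝕜] [AddCommGroup g] [Module 𝕜 g] (L : DGLieAlgebra 𝕜 g)

/-- The relations `x y = (-1)^{|x||y|} y x + [x, y]` of the universal enveloping algebra. -/
inductive EnvRel : TensorAlgebra 𝕜 g → TensorAlgebra 𝕜 g → Prop
  | comm {i j : ℤ} {x y : g} (hx : x ∈ L.deg i) (hy : y ∈ L.deg j) :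
      EnvRel (TensorAlgebra.ι 𝕜 x * TensorAlgebra.ι 𝕜 y)
        ((i * j).negOnePow • (TensorAlgebra.ι 𝕜 y * TensorAlgebra.ι 𝕜 x)
          + TensorAlgebra.ι 𝕜 (L.bracket x y))

/-- The universal enveloping algebra of the graded Lie algebra `g`. -/
abbrev Env : Type _ := RingQuot L.EnvRel

/-- The canonical map from `g` to its universal enveloping algebra. -/
def toEnv : g →ₗ[𝕜] L.Env :=
  (RingQuot.mkAlgHom 𝕜 L.EnvRel).toLinearMap ∘ₗ TensorAlgebra.ι 𝕜

/-- The bracket of `R ⊗ g`, for a commutative algebra `R` in degree zero: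
`[f ⊗ x, h ⊗ y] = f h ⊗ [x, y]`. -/
def bracketExt (R : Type*) [CommRing R] [Algebra 𝕜 R] (u v : R ⊗[𝕜] g) : R ⊗[𝕜] g :=
  TensorProduct.map₂ (LinearMap.mul 𝕜 R) L.bracket u v

/-- The elements of degree `q` of `R ⊗ g`, for `R` in degree zero. -/
def degExt (R : Type*) [CommRing R] [Algebra 𝕜 R] (q : ℤ) : Submodule 𝕜 (R ⊗[𝕜] g) :=
  LinearMap.range (LinearMap.lTensor R (L.deg q).subtype)

end DGLieAlgebra

/-- The sign in `(v_1 ⊗ x_1) ⊗ ⋯ ⊗ (v_n ⊗ x_n) ↦ ± (v_1 ⊗ ⋯ ⊗ v_n) ⊗ (x_1 ⊗ ⋯ ⊗ x_n)`, where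
`v_i` has degree `p i` and `x_i` has degree `q i`. -/
def exchangeSign {n : ℕ} (p q : Fin n → ℤ) : ℤˣ :=
  ∏ e ∈ (Finset.univ : Finset (Fin n × Fin n)).filter (fun e => e.1 < e.2),
    (q e.1 * p e.2).negOnePow

section Extension

variable {𝕜 : Type*} [Field 𝕜]

/-- Extension of scalars of the Taylor coefficients `F` by a graded associative algebra `A`, on
homogeneous pure tensors:
`F_n(v_1 ⊗ x_1, …, v_n ⊗ x_n) = ± F_n(v_1, …, v_n) ⊗ x_1 ⋯ x_n`. -/
def extendTaylor {V W A : Type*} [AddCommGroup W] [Module 𝕜 W] [Ring A] [Algebra 𝕜 A]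
    (F : ∀ n, (Fin n → V) → W) {n : ℕ} (p q : Fin n → ℤ) (v : Fin n → V) (x : Fin n → A) :
    W ⊗[𝕜] A :=
  exchangeSign p q • (F n v ⊗ₜ[𝕜] (List.ofFn x).prod)

/-- The symmetrization of the previous coefficients: the `n`-th coefficient of `sym(F)` at
`(v_1 ⊗ x_1) ⊙ ⋯ ⊙ (v_n ⊗ x_n)`. -/
def symExtendTaylor {V W A : Type*} [AddCommGroup W] [Module 𝕜 W] [Ring A] [Algebra 𝕜 A]
    (F : ∀ n, (Fin n → V) → W) {n : ℕ} (p q : Fin n → ℤ) (v : Fin n → V) (x : Fin n → A) :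
    W ⊗[𝕜] A :=
  ∑ τ : Equiv.Perm (Fin n), koszulSign (p + q) τ •
    extendTaylor F (p ∘ τ) (q ∘ τ) (v ∘ τ) (x ∘ τ)

/-- `Φ` is the sequence of Taylor coefficients of the extension of scalars of `F` by the dg Lie
algebra `g`: the coefficients `Φ_n` have values in `W ⊗ g`, and after the inclusion of `g` in its
universal enveloping algebra `U(g)` they become the symmetrization of the extension of scalars of
`F` by `U(g)`. Here `Vdeg` is the grading of the source `V = ⨁ Vdeg p` (already suspended). -/
def IsLieExtension {V W g : Type*} [AddCommGroup V] [Module 𝕜 V] [AddCommGroup W] [Module 𝕜 W]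
    [AddCommGroup g] [Module 𝕜 g] (L : DGLieAlgebra 𝕜 g) (Vdeg : ℤ → Submodule 𝕜 V)
    (F : ∀ n, (Fin n → V) → W)
    (Φ : ∀ n, MultilinearMap 𝕜 (fun _ : Fin n => V ⊗[𝕜] g) (W ⊗[𝕜] g)) : Prop :=
  ∀ (n : ℕ) (p q : Fin n → ℤ) (v : Fin n → V) (x : Fin n → g),
    (∀ i, v i ∈ Vdeg (p i)) → (∀ i, x i ∈ L.deg (q i)) →
    LinearMap.lTensor W L.toEnv (Φ n (fun i => v i ⊗ₜ[𝕜] x i)) =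
      symExtendTaylor F p q v (fun i => L.toEnv (x i))

/-- The one-form `l(t) dt` with values in `g`, for `l ∈ Ω^0([0,1]; g) = R ⊗ g`. -/
def oneForm {R g : Type*} [CommRing R] [Algebra 𝕜 R] [AddCommGroup g] [Module 𝕜 g]
    (l : R ⊗[𝕜] g) : Forms R ⊗[𝕜] g :=
  LinearMap.rTensor g (LinearMap.inr 𝕜 R R) l

/-- The Whitney form `dt`. -/
def whitneyDt (𝕜 : Type*) [Field 𝕜] : Whitney 𝕜 := ((0, 0), 1)

end Extension

/-! ## Polynomial forms -/

section Polynomials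

variable (𝕜 : Type*) [Field 𝕜]

/-- The formal integral `∫_{0 ≤ t_1 ≤ ⋯ ≤ t_n ≤ s} P(t_1, …, t_n) dt_1 ⋯ dt_n`, a polynomial in `s`:
`t_1^{m_1} ⋯ t_n^{m_n}` is sent to
`s^{l_1 + ⋯ + l_n} / (l_1 (l_1 + l_2) ⋯ (l_1 + ⋯ + l_n))` with `l_i = m_i + 1`. -/
def polySimplexIntegral (n : ℕ) : MvPolynomial (Fin n) 𝕜 →ₗ[𝕜] Polynomial 𝕜 :=
  (MvPolynomial.basisMonomials (Fin n) 𝕜).constr 𝕜 fun m =>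
    Polynomial.monomial (∑ i, (m i + 1))
      (∏ j : Fin n, ((∑ i ∈ Finset.Iic j, ((m i : 𝕜) + 1))⁻¹))

/-- The primitive `∫_0^s P(u) du`, a polynomial in `s`. -/
def polyPrimitive : Polynomial 𝕜 →ₗ[𝕜] Polynomial 𝕜 :=
  (Polynomial.basisMonomials 𝕜).constr 𝕜 fun m => Polynomial.monomial (m + 1) (((m : 𝕜) + 1)⁻¹)

/-- The algebra `𝕜[t]` of polynomial functions on the interval. -/
def polyFunctions : FunctionAlgebra 𝕜 (Polynomial 𝕜) where
  coord := Polynomial.X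
  ev0 := Polynomial.eval 0
  ev1 := Polynomial.eval 1
  iteratedIntegral n a :=
    Polynomial.eval 1 (polySimplexIntegral 𝕜 n (∏ i, Polynomial.aeval (MvPolynomial.X i) (a i)))

/-- `φ_s` on polynomial forms. -/
def polyPhi [CharZero 𝕜] (s : 𝕜) : ∀ n, (Fin n → Forms (Polynomial 𝕜)) → Whitney 𝕜 :=
  phiScaled (polyFunctions 𝕜) s (fun f => f.comp (Polynomial.C s * Polynomial.X))

variable {𝕜} {g : Type*} [AddCommGroup g] [Module 𝕜 g]

/-- The value at `s` of a polynomial function with values in `g`. -/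
def polyEval (s : 𝕜) : Polynomial 𝕜 ⊗[𝕜] g →ₗ[𝕜] g :=
  (TensorProduct.lid 𝕜 g).toLinearMap ∘ₗ
    LinearMap.rTensor g (Polynomial.aeval s : Polynomial 𝕜 →ₐ[𝕜] 𝕜).toLinearMap

/-- The substitution `l(t) ↦ l(t_j)`. -/
def polyAt {n : ℕ} (j : Fin n) : Polynomial 𝕜 ⊗[𝕜] g →ₗ[𝕜] MvPolynomial (Fin n) 𝕜 ⊗[𝕜] g :=
  LinearMap.rTensor g
    (Polynomial.aeval (MvPolynomial.X j) : Polynomial 𝕜 →ₐ[𝕜] MvPolynomial (Fin n) 𝕜).toLinearMap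

/-- The recursive formula, for polynomial functions with values in `g`:
`M_1(l)(s) = ∫_0^s l(u) du` and, for homogeneous `l_1, …, l_n` with `n ≥ 2`, the value
`M_n(l_1 ⊙ ⋯ ⊙ l_n)(s)` is
`∑_{i_1 + ⋯ + i_k = n-1} (-1)^k (B_k / k!) / (i_1! ⋯ i_k!)` times
`∑_σ ε(σ) ∫_0^s [M_{i_1}(⋯)(u), ⋯ [M_{i_k}(⋯)(u), l_{σ(n)}(u)] ⋯ ] du`,
the arguments `l_{σ(1)}, …, l_{σ(n-1)}` being inserted in this order. -/
def PolyRecursion [CharZero 𝕜] (L : DGLieAlgebra 𝕜 g)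
    (M : ∀ n, (Fin n → Polynomial 𝕜 ⊗[𝕜] g) → Polynomial 𝕜 ⊗[𝕜] g) : Prop :=
  (∀ (q : ℤ) (l : Fin 1 → Polynomial 𝕜 ⊗[𝕜] g), l 0 ∈ L.degExt (Polynomial 𝕜) q →
    M 1 l = LinearMap.rTensor g (polyPrimitive 𝕜) (l 0)) ∧
  ∀ (n : ℕ) (q : Fin (n + 2) → ℤ) (l : Fin (n + 2) → Polynomial 𝕜 ⊗[𝕜] g),
    (∀ i, l i ∈ L.degExt (Polynomial 𝕜) (q i)) →
    M (n + 2) l = ∑ c : Composition (n + 1), (recursionCoeff c : 𝕜) •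
      ∑ σ : Equiv.Perm (Fin (n + 2)), koszulSign q σ •
        LinearMap.rTensor g (polyPrimitive 𝕜)
          (nest (L.bracketExt (Polynomial 𝕜))
            (fun j => M (c.blocksFun j) (fun i => l (σ (c.embedding j i).castSucc)))
            (l (σ (Fin.last (n + 1)))))

end Polynomials

/-! ## Smooth forms -/

/-- The algebra of smooth real functions on the closed interval `[0,1]`. -/
def smoothFunctions : Subalgebra ℝ (Set.Icc (0 : ℝ) 1 → ℝ) where
  carrier := {f | ContDiffOn ℝ ∞ (Set.IccExtend zero_le_one f) (Set.Icc (0 : ℝ) 1)}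
  mul_mem' := fun hf hg => ContDiffOn.mul hf hg
  add_mem' := fun hf hg => ContDiffOn.add hf hg
  algebraMap_mem' := fun _ => contDiffOn_const

/-- The coordinate function `t`. -/
def smoothCoord : smoothFunctions :=
  ⟨fun t => (t : ℝ), by
    refine (contDiffOn_id (𝕜 := ℝ)).congr fun t ht => ?_
    exact congrArg Subtype.val (Set.projIcc_of_mem zero_le_one ht)⟩

/-- The substitution `f(t) ↦ f(st)` for `s ∈ [0,1]`. -/
def smoothScale (s : Set.Icc (0 : ℝ) 1) (f : smoothFunctions) : smoothFunctions :=
  ⟨fun t => f.1 (s * t), by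
    have h : ContDiffOn ℝ ∞ (fun t : ℝ => (s : ℝ) * t) (Set.Icc (0 : ℝ) 1) :=
      (contDiff_const.mul contDiff_id).contDiffOn
    have hm : Set.MapsTo (fun t : ℝ => (s : ℝ) * t) (Set.Icc (0 : ℝ) 1) (Set.Icc (0 : ℝ) 1) :=
      fun t ht => ⟨mul_nonneg s.2.1 ht.1, mul_le_one₀ s.2.2 ht.1 ht.2⟩
    have hf : ContDiffOn ℝ ∞ (Set.IccExtend zero_le_one f.1) (Set.Icc (0 : ℝ) 1) := f.2
    refine (hf.comp h hm).congr fun t ht => ?_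
    have h1 : Set.projIcc (0 : ℝ) 1 zero_le_one t = ⟨t, ht⟩ := Set.projIcc_of_mem zero_le_one ht
    have h2 : Set.projIcc (0 : ℝ) 1 zero_le_one ((s : ℝ) * t) = ⟨(s : ℝ) * t, hm ht⟩ :=
      Set.projIcc_of_mem zero_le_one (hm ht)
    simp only [Set.IccExtend, Function.comp, h1, h2]
    rfl⟩

/-- The simplex `0 ≤ t_1 ≤ ⋯ ≤ t_n ≤ s`. -/
def simplex (n : ℕ) (s : ℝ) : Set (Fin n → ℝ) :=
  {t | Monotone t ∧ ∀ i, 0 ≤ t i ∧ t i ≤ s}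

/-- Clamping of real numbers to `[0,1]`; it is only applied to numbers in `[0,1]`. -/
abbrev toUnit : ℝ → Set.Icc (0 : ℝ) 1 := Set.projIcc 0 1 zero_le_one

/-- The algebra of smooth functions on the interval, with its integrals. -/
def smoothModel : FunctionAlgebra ℝ smoothFunctions where
  coord := smoothCoord
  ev0 f := f.1 0
  ev1 f := f.1 1
  iteratedIntegral n a := ∫ t in simplex n 1, ∏ i, (a i).1 (toUnit (t i))

/-- `φ_s` on smooth forms, for `s ∈ [0,1]`. -/
def smoothPhi (s : Set.Icc (0 : ℝ) 1) : ∀ n, (Fin n → Forms smoothFunctions) → Whitney ℝ :=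
  phiScaled smoothModel s (smoothScale s)

section Smooth

variable {h : Type*} [NormedAddCommGroup h] [NormedSpace ℝ h]

/-- The value at `s ∈ [0,1]` of a smooth function with values in `h`. For `h` of finite dimension,
these functions form the space `C^∞([0,1]) ⊗ h`. -/
def smoothEval (s : Set.Icc (0 : ℝ) 1) : smoothFunctions ⊗[ℝ] h →ₗ[ℝ] h :=
  (TensorProduct.lid ℝ h).toLinearMap ∘ₗ
    LinearMap.rTensor h ((LinearMap.proj s : (Set.Icc (0 : ℝ) 1 → ℝ) →ₗ[ℝ] ℝ) ∘ₗ
      smoothFunctions.val.toLinearMap)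

/-- The recursive formula as in `PolyRecursion`, for smooth functions with values in `h`. -/
def SmoothRecursion (L : DGLieAlgebra ℝ h)
    (M : ∀ n, (Fin n → smoothFunctions ⊗[ℝ] h) → smoothFunctions ⊗[ℝ] h) : Prop :=
  (∀ (q : ℤ) (l : Fin 1 → smoothFunctions ⊗[ℝ] h), l 0 ∈ L.degExt smoothFunctions q →
    ∀ s : Set.Icc (0 : ℝ) 1, smoothEval s (M 1 l) = ∫ u in (0 : ℝ)..s, smoothEval (toUnit u) (l 0)) ∧
  ∀ (n : ℕ) (q : Fin (n + 2) → ℤ) (l : Fin (n + 2) → smoothFunctions ⊗[ℝ] h),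
    (∀ i, l i ∈ L.degExt smoothFunctions (q i)) → ∀ s : Set.Icc (0 : ℝ) 1,
    smoothEval s (M (n + 2) l) = ∑ c : Composition (n + 1), (recursionCoeff c : ℝ) •
      ∑ σ : Equiv.Perm (Fin (n + 2)), koszulSign q σ •
        ∫ u in (0 : ℝ)..s,
          nest (fun x y => L.bracket x y)
            (fun j => smoothEval (toUnit u)
              (M (c.blocksFun j) (fun i => l (σ (c.embedding j i).castSucc))))
            (smoothEval (toUnit u) (l (σ (Fin.last (n + 1)))))

end Smooth

end Magnus

end

open Finset.HasAntidiagonal (antidiagonal mem_antidiagonal)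

noncomputable section

namespace Magnus

/-! The coefficients of `φ` form a logarithm. A higher `μ` has no one-form part, and its function
part vanishes at both ends of the interval because `B_n(1) = B_n` for `n ≥ 2`, while a higher `λ`
sees only one-form parts. Hence the `n`-th coefficient of `exp` is the product of the `dt`
components divided by `n!`, the inverse has the coefficients `(-1)^(n+1) / n`, and `φ_n` of
one-forms is the degree `n` part of the logarithm of the path-ordered exponential (`logIntegral`,
`IsPathIntegral.phi_snd`). Apart from the values at the ends, the argument uses only that
integration is a Rota-Baxter operator `J` of weight zero, i.e. integration by parts. Polynomial and
smooth forms are therefore treated together.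

Recursion. Let `Z = J ζ` with `ζ = b(ad Z) a` and `b(z) = z / (1 - e^{-z})`. For the commuting
operators `x`, `y` of left and right multiplication by `Z` one has `(e^x - e^y) / (x - y) · b(x - y)
= e^x`. With integration by parts this gives `e^Z = 1 + J(e^Z a)`, so that the recursion of Magnus
produces the logarithm (`pathOrdered_eq_coeff_exp`, `eq_sum_log_pathOrdered`). Several graded
arguments are handled by polarization: tensoring with creation operators turns graded commutators
into ordinary ones (`magnusTerm_eq_log`).

Explicit formula. The same theorem is applied to a discrete interval of `n` pieces with lengths
`e_i`, `e_i^2 = 0`. It shows that the multilinear part of `log(exp(e_1 x_1) ⋯ exp(e_n x_n))` is a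
Lie element with coefficient `wordCoeff τ` at the word `τ`. An action of `g` on `𝕜 × g` realizes
Dynkin's operator and writes this element as a sum of nested brackets (`discreteTerm_eq_lieTerm`).
The shuffle formula expands `logIntegral` with the same coefficients (`logIntegral_eq_sum`), and a
sum over the supersets of the descent set evaluates them (`wordCoeff_eq`).

Embedding in `U(g)`. The element `lieTerm` is compatible with the defining relations of `U(g)`
(`lieList_commutator`), which gives a linear retraction to `g` and so the Poincaré–Birkhoff–Witt
statement `toEnv_injective`. Over a field injectivity survives tensoring. Hence the extension of
scalars is unique, and the explicit formula and the recursion agree because their images in `R ⊗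
U(g)` do (`explicitTerm_eq_magnusTerm`). -/

theorem sum_composition_succ {M : Type*} [AddCommMonoid M] (n : ℕ) (F : List ℕ → M) :
    ∑ c : Composition (n + 1), F c.blocks =
      ∑ p ∈ antidiagonal n, ∑ c : Composition p.2, F ((p.1 + 1) :: c.blocks) := by
  rw [Finset.sum_sigma']
  symm
  refine Finset.sum_bij (fun x hx => ⟨(x.1.1 + 1) :: x.2.blocks, ?_, ?_⟩) ?_ ?_ ?_ ?_
  · intro i hi
    rcases List.mem_cons.1 hi with rfl | hi
    · omega
    · exact x.2.blocks_pos hi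
  · have := (mem_antidiagonal.1 (Finset.mem_sigma.1 hx).1)
    rw [List.sum_cons, x.2.blocks_sum]
    omega
  · intros
    exact Finset.mem_univ _
  · rintro ⟨⟨i, j⟩, c⟩ _ ⟨⟨i', j'⟩, c'⟩ _ h
    have h1 : i = i' ∧ c.blocks = c'.blocks := by
      have := congrArg Composition.blocks h
      simpa using this
    obtain ⟨rfl, h1⟩ := h1
    have : j = j' := c.blocks_sum.symm.trans ((congrArg List.sum h1).trans c'.blocks_sum)
    subst this
    have : c = c' := Composition.ext h1
    rw [this]
  · rintro ⟨l, hpos, hsum⟩ _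
    cases l with
    | nil => simp at hsum
    | cons i l =>
      have hi : 0 < i := hpos (List.mem_cons_self ..)
      rw [List.sum_cons] at hsum
      refine ⟨⟨(i - 1, l.sum), ⟨l, fun h => hpos (List.mem_cons_of_mem _ h), rfl⟩⟩, ?_, ?_⟩
      · simp only [Finset.mem_sigma, mem_antidiagonal, Finset.mem_univ, and_true]
        omega
      · ext1
        simp only [List.cons.injEq, and_true]
        omega
  · intros
    rfl

/-! ### Iterated brackets summed over compositions. -/

section Nest

variable {k V W : Type*} [CommRing k] [AddCommGroup V] [Module k V] [AddCommGroup W] [Module k W]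

/-- `[u_1, [u_2, ⋯ [u_k, z] ⋯ ]]` for a bilinear action of `V` on `W`. -/
def act (b : V →ₗ[k] W →ₗ[k] W) {n : ℕ} (u : Fin n → V) (w : W) : W :=
  (List.ofFn u).foldr (fun x y => b x y) w

@[simp]
theorem act_zero (b : V →ₗ[k] W →ₗ[k] W) (u : Fin 0 → V) (w : W) : act b u w = w := by
  simp [act]

theorem act_succ (b : V →ₗ[k] W →ₗ[k] W) {n : ℕ} (u : Fin (n + 1) → V) (w : W) :
    act b u w = b (u 0) (act b (fun i => u i.succ) w) := by
  simp [act, List.ofFn_succ]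

theorem nest_eq_act (b : V →ₗ[k] V →ₗ[k] V) {n : ℕ} (u : Fin n → V) (w : V) :
    nest (fun x y => b x y) u w = act b u w := rfl

theorem act_blocksFun (b : V →ₗ[k] W →ₗ[k] W) (z : ℕ → V) (w : W) {n : ℕ} (c : Composition n) :
    act b (fun j => z (c.blocksFun j)) w = c.blocks.foldr (fun i y => b (z i) y) w := by
  have : (List.ofFn fun j => z (c.blocksFun j)) = c.blocks.map z := by
    rw [← c.ofFn_blocksFun, List.map_ofFn]
    rfl
  rw [act, this, List.foldr_map]

/-- The sum of `[z_{i_1}, ⋯ [z_{i_k}, w] ⋯ ]` over all `i_1 + ⋯ + i_k = n`. -/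
def nestCoeff (b : V →ₗ[k] W →ₗ[k] W) (z : ℕ → V) (w : W) : ℕ → ℕ → W
  | 0, n => if n = 0 then w else 0
  | m + 1, n => ∑ p ∈ antidiagonal n, b (z p.1) (nestCoeff b z w m p.2)

/-- The sums in `nestCoeff` also allow zero parts, which `z 0 = 0` kills. A composition of `n` has
at most `n` blocks, so every cut-off `N ≥ n` gives the same value; the freedom in `N` lets one
truncation serve several degrees. -/
theorem sum_composition_act (b : V →ₗ[k] W →ₗ[k] W) (z : ℕ → V) (hz : z 0 = 0) (w : W) :
    ∀ (n N : ℕ), n ≤ N → ∀ (α : ℕ → k),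
    ∑ c : Composition n, α c.length • act b (fun j => z (c.blocksFun j)) w =
      ∑ m ∈ Finset.range (N + 1), α m • nestCoeff b z w m n := by
  -- The induction runs on the list of blocks, where splitting off the first block is `List.cons`.
  have key : ∀ (n N : ℕ), n ≤ N → ∀ (α : ℕ → k),
      ∑ c : Composition n, α c.blocks.length • c.blocks.foldr (fun i y => b (z i) y) w =
      ∑ m ∈ Finset.range (N + 1), α m • nestCoeff b z w m n := by
    intro n
    induction n using Nat.strong_induction_on with
    | _ n ih =>
      intro N hN α
      cases n with
      | zero =>
        have h0 : ∀ c : Composition 0, c.blocks = [] := fun c => c.blocks_eq_nil.2 rfl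
        have : Subsingleton (Composition 0) :=
          ⟨fun a b => Composition.ext ((h0 a).trans (h0 b).symm)⟩
        have h1 : ∑ m ∈ Finset.range N, α (m + 1) • nestCoeff b z w (m + 1) 0 = 0 :=
          Finset.sum_eq_zero fun m _ => by simp [nestCoeff, hz]
        rw [Finset.sum_range_succ', h1, Fintype.sum_subsingleton _ (Composition.ones 0)]
        simp [nestCoeff]
      | succ n =>
        obtain ⟨N, rfl⟩ : ∃ N', N = N' + 1 := ⟨N - 1, by omega⟩
        rw [sum_composition_succ n
          (fun l => α l.length • l.foldr (fun i y => b (z i) y) w), Finset.sum_range_succ']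
        simp only [nestCoeff, Nat.add_eq_zero_iff, one_ne_zero, and_false, if_false, smul_zero,
          add_zero, Finset.Nat.antidiagonal_succ, Finset.sum_cons, hz, map_zero,
          LinearMap.zero_apply, zero_add, Finset.sum_map, List.length_cons, List.foldr_cons,
          Function.Embedding.prodMap, Function.Embedding.coeFn_mk, Prod.map,
          Function.Embedding.refl_apply, Finset.smul_sum]
        rw [Finset.sum_comm]
        refine Finset.sum_congr rfl fun p hp => ?_
        have hp' := mem_antidiagonal.1 hp
        have := congrArg (b (z (p.1 + 1))) (ih p.2 (by omega) N (by omega) (fun m => α (m + 1)))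
        simpa [map_sum] using this
  intro n N hN α
  rw [← key n N hN α]
  refine Finset.sum_congr rfl fun c _ => ?_
  rw [act_blocksFun, c.blocks_length]

end Nest

/-! ### The Bernoulli identity behind the derivative of the exponential. -/

section Bernoulli

/-- The coefficients of `z / (1 - e^{-z})`. -/
def adCoeff (k : ℕ) : ℚ := bernoulli' k / (k.factorial : ℚ)

theorem adCoeff_eq (k : ℕ) : adCoeff k = (-1) ^ k * bernoulli k / (k.factorial : ℚ) := by
  rw [adCoeff, bernoulli'_eq_bernoulli]

/-- This is the coefficient of `T^(m+1)` in `b((x-y)T) (e^{xT} - e^{yT}) = (x-y) T e^{xT}` with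
`b(z) = z / (1 - e^{-z})`, i.e. the generating function of the Bernoulli numbers, rescaled by `x -
y` and multiplied by `e^{yT}`. -/
theorem sum_adCoeff_mul_sub {S : Type*} [CommRing S] [Algebra ℚ S] (x y : S) (m : ℕ) :
    ∑ p ∈ antidiagonal m, algebraMap ℚ S (adCoeff p.2 / ((p.1 + 1).factorial : ℚ)) *
      ((x ^ (p.1 + 1) - y ^ (p.1 + 1)) * (x - y) ^ p.2) =
      algebraMap ℚ S (1 / (m.factorial : ℚ)) * x ^ m * (x - y) := by
  have h1 := congrArg (PowerSeries.rescale (x - y)) (bernoulli'PowerSeries_mul_exp_sub_one S)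
  have h2 : PowerSeries.rescale (x - y) (PowerSeries.exp S) *
      PowerSeries.rescale y (PowerSeries.exp S) = PowerSeries.rescale x (PowerSeries.exp S) := by
    rw [PowerSeries.exp_mul_exp_eq_exp_add, sub_add_cancel]
  have h3 : PowerSeries.rescale (x - y) (bernoulli'PowerSeries S) *
      (PowerSeries.rescale x (PowerSeries.exp S) - PowerSeries.rescale y (PowerSeries.exp S)) =
      PowerSeries.X * (PowerSeries.C (x - y) * PowerSeries.rescale x (PowerSeries.exp S)) := by
    rw [map_mul, map_sub, map_one, map_mul, PowerSeries.rescale_X] at h1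
    rw [← h2]
    linear_combination PowerSeries.rescale y (PowerSeries.exp S) * h1
  have h4 := congrArg (PowerSeries.coeff (m + 1)) h3
  rw [PowerSeries.coeff_succ_X_mul, PowerSeries.coeff_C_mul, PowerSeries.coeff_mul,
    Finset.Nat.antidiagonal_succ'] at h4
  simp only [Finset.sum_cons, Finset.sum_map, map_sub, PowerSeries.coeff_rescale,
    PowerSeries.coeff_exp, pow_zero, sub_self, mul_zero, zero_add,
    Function.Embedding.prodMap, Function.Embedding.coeFn_mk, Prod.map,
    Function.Embedding.refl_apply, bernoulli'PowerSeries, PowerSeries.coeff_mk] at h4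
  rw [← Finset.Nat.sum_antidiagonal_swap]
  calc _ = _ := ?_
    _ = _ := h4
    _ = _ := by ring
  refine Finset.sum_congr rfl fun p _ => ?_
  rw [adCoeff, div_div, div_eq_mul_inv, map_mul, mul_inv, map_mul, div_eq_mul_inv, map_mul,
    one_div]
  simp only [Prod.fst_swap, Prod.snd_swap, Nat.succ_eq_add_one]
  ring

/-- The factor `x - y` may be cancelled in `ℚ[X₀, X₁]`, which is a domain; the result then
specializes to every commutative algebra. -/
theorem sum_adCoeff_geom {S : Type*} [CommRing S] [Algebra ℚ S] (x y : S) (m : ℕ) :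
    ∑ p ∈ antidiagonal m, (adCoeff p.2 / ((p.1 + 1).factorial : ℚ)) •
      ((∑ i ∈ Finset.range (p.1 + 1), x ^ i * y ^ (p.1 - i)) * (x - y) ^ p.2) =
      (1 / (m.factorial : ℚ)) • x ^ m := by
  have key : ∑ p ∈ antidiagonal m, (adCoeff p.2 / ((p.1 + 1).factorial : ℚ)) •
      ((∑ i ∈ Finset.range (p.1 + 1), (MvPolynomial.X 0 : MvPolynomial (Fin 2) ℚ) ^ i *
        MvPolynomial.X 1 ^ (p.1 - i)) * (MvPolynomial.X 0 - MvPolynomial.X 1) ^ p.2) =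
      (1 / (m.factorial : ℚ)) • (MvPolynomial.X 0 : MvPolynomial (Fin 2) ℚ) ^ m := by
    have hne : (MvPolynomial.X 0 - MvPolynomial.X 1 : MvPolynomial (Fin 2) ℚ) ≠ 0 := by
      rw [sub_ne_zero, Ne, MvPolynomial.X_inj]
      decide
    refine mul_right_cancel₀ hne ?_
    rw [Algebra.smul_def, ← sum_adCoeff_mul_sub, Finset.sum_mul]
    refine Finset.sum_congr rfl fun p _ => ?_
    rw [← geom_sum₂_mul, Algebra.smul_def]
    simp only [Nat.add_sub_cancel]
    ring
  have := congrArg (MvPolynomial.aeval (![x, y] : Fin 2 → S)) key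
  simpa [map_sum] using this

/-- Two commuting elements generate a commutative subalgebra. The application is to left and right
multiplication by one element. -/
theorem sum_adCoeff_geom_of_commute {E : Type*} [Ring E] [Algebra ℚ E] {x y : E} (h : Commute x y)
    (m : ℕ) :
    ∑ p ∈ antidiagonal m, (adCoeff p.2 / ((p.1 + 1).factorial : ℚ)) •
      ((∑ i ∈ Finset.range (p.1 + 1), x ^ i * y ^ (p.1 - i)) * (x - y) ^ p.2) =
      (1 / (m.factorial : ℚ)) • x ^ m := by
  have hc : ∀ a ∈ ({x, y} : Set E), ∀ b ∈ ({x, y} : Set E), a * b = b * a := by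
    rintro a (rfl | rfl) b (rfl | rfl)
    exacts [rfl, h, h.symm, rfl]
  have hm := Algebra.isMulCommutative_adjoin ℚ hc
  let _ : CommRing (Algebra.adjoin ℚ ({x, y} : Set E)) :=
    { (inferInstance : Ring (Algebra.adjoin ℚ ({x, y} : Set E))) with
      mul_comm := hm.is_comm.comm }
  have := congrArg (Subalgebra.val (Algebra.adjoin ℚ ({x, y} : Set E)))
    (sum_adCoeff_geom (S := Algebra.adjoin ℚ ({x, y} : Set E))
      ⟨x, Algebra.subset_adjoin (by simp)⟩ ⟨y, Algebra.subset_adjoin (by simp)⟩ m)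
  simpa [map_sum] using this

end Bernoulli

/-! ### Substitution of power series and the inverse pair `exp - 1`, `log`. -/

section Substitution

open PowerSeries

/-- Both sides have zero constant term and derivative one: `log' · (1 + X) = 1` becomes `log'(exp -
1) · exp = 1` under the substitution. -/
theorem log_subst_exp_sub_one (𝕜 : Type*) [Field 𝕜] [CharZero 𝕜] :
    (log 𝕜).subst (exp 𝕜 - 1) = X := by
  have hs : HasSubst (exp 𝕜 - 1) := HasSubst.exp_sub_one
  have h1 : d⁄dX 𝕜 (log 𝕜) * (1 + X) = 1 := by
    rw [deriv_log, mul_add, mul_one]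
    ext n
    rcases n with _ | n
    · simp [coeff_zero_mul_X]
    · rw [map_add, coeff_succ_mul_X, coeff_mk, coeff_mk, coeff_one, if_neg n.succ_ne_zero,
        ← map_add, pow_succ]
      simp
  have h2 : (d⁄dX 𝕜 (log 𝕜)).subst (exp 𝕜 - 1) * exp 𝕜 = 1 := by
    have := congrArg (subst (exp 𝕜 - 1)) h1
    rw [subst_mul hs, subst_add hs, subst_X hs] at this
    have h3 : (1 : 𝕜⟦X⟧).subst (exp 𝕜 - 1) = 1 := by
      rw [← coe_substAlgHom hs, map_one]
    rwa [h3, add_sub_cancel] at this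
  refine derivative.ext ?_ ?_
  · rw [derivative_subst hs, map_sub, derivative_exp, derivative_one, sub_zero, h2, derivative_X]
  · rw [constantCoeff_X]
    exact constantCoeff_subst_eq_zero (by
      have : constantCoeff (exp 𝕜 - 1) = 0 := by simp
      exact this) _ constantCoeff_log

/-- The linear coefficient of `log` is a unit, so `log` has a compositional inverse, and `log(exp -
1) = X` forces this inverse to be `exp - 1`. -/
theorem exp_sub_one_subst_log (𝕜 : Type*) [Field 𝕜] [CharZero 𝕜] :
    (exp 𝕜 - 1).subst (log 𝕜) = X := by
  have hs : HasSubst (exp 𝕜 - 1) := HasSubst.exp_sub_one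
  have hl : HasSubst (log 𝕜) := HasSubst.log
  have hu : IsUnit ((log 𝕜).coeff 1) := by simp
  have hi : HasSubst ((log 𝕜).substInvOfIsUnit hu) := HasSubst.substInvOfIsUnit _ _
  have h1 := subst_substInvOfIsUnit_left (log 𝕜) constantCoeff_log hu
  have h2 : ((log 𝕜).substInvOfIsUnit hu).subst ((log 𝕜).subst (exp 𝕜 - 1)) = exp 𝕜 - 1 := by
    rw [← subst_comp_subst_apply hl hs, h1, subst_X hs]
  rw [log_subst_exp_sub_one] at h2
  have h3 : (log 𝕜).substInvOfIsUnit hu = exp 𝕜 - 1 := by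
    rw [← h2]
    exact (map_algebraMap_eq_subst_X _).symm.trans (by simp) |>.symm
  rw [← h3, h1]

theorem coeff_pow_eq_zero_of_lt {S : Type*} [Semiring S] {f : S⟦X⟧} (hf : coeff 0 f = 0) :
    ∀ {n m : ℕ}, n < m → coeff n (f ^ m) = 0 := by
  intro n m
  induction m generalizing n with
  | zero => intro h; omega
  | succ m ih =>
    intro h
    rw [pow_succ', coeff_mul]
    refine Finset.sum_eq_zero fun p hp => ?_
    have hp := mem_antidiagonal.1 hp
    rcases Nat.eq_zero_or_pos p.1 with h0 | h0
    · rw [h0, hf, zero_mul]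
    · rw [ih (by omega), mul_zero]

theorem sum_coeff_mul_coeff_pow {S : Type*} [Field S] {f g : S⟦X⟧} (hg : coeff 0 g = 0)
    {n N : ℕ} (hN : n ≤ N) :
    ∑ m ∈ Finset.range (N + 1), coeff m f * coeff n (g ^ m) = coeff n (f.subst g) := by
  have hs : HasSubst g := HasSubst.of_constantCoeff_zero' (by simpa using hg)
  rw [coeff_subst' hs]
  symm
  refine finsum_eq_sum_of_support_subset _ fun m hm => ?_
  by_contra hlt
  simp only [Finset.coe_range, Set.mem_Iio, not_lt] at hlt
  exact hm (by simp only [coeff_pow_eq_zero_of_lt hg (show n < m by omega), smul_zero])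

/-- Terms outside the triangle `k + l ≤ n` vanish, so the square may be resummed along
antidiagonals. This is how products of truncated series are compared below. -/
theorem sum_range_sum_range_of_lt {M : Type*} [AddCommMonoid M] (n : ℕ) (t : ℕ → ℕ → M)
    (ht : ∀ k l, n < k + l → t k l = 0) :
    ∑ k ∈ Finset.range (n + 1), ∑ l ∈ Finset.range (n + 1), t k l =
      ∑ m ∈ Finset.range (n + 1), ∑ p ∈ antidiagonal m, t p.1 p.2 := by
  have h1 : ∀ m, ∑ p ∈ antidiagonal m, t p.1 p.2 = ∑ k ∈ Finset.range (m + 1), t k (m - k) :=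
    fun m => Finset.Nat.sum_antidiagonal_eq_sum_range_succ t m
  simp only [h1]
  rw [Finset.sum_range_diag_flip]
  refine Finset.sum_congr rfl fun k hk => ?_
  symm
  refine Finset.sum_subset (fun l hl => ?_) fun l _ hl => ?_
  · simp only [Finset.mem_range] at *
    omega
  · simp only [Finset.mem_range] at *
    exact ht k l (by omega)

variable {𝕜 S : Type*} [Field 𝕜] [Ring S] [Algebra 𝕜 S]

/-- The power series `F(Z)`, for a power series `Z` without constant term over an algebra which
need not be commutative. -/
def substNC (Z : S⟦X⟧) (F : 𝕜⟦X⟧) : S⟦X⟧ :=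
  mk fun n => ∑ m ∈ Finset.range (n + 1), coeff m F • coeff n (Z ^ m)

theorem coeff_substNC {Z : S⟦X⟧} (hZ : coeff 0 Z = 0) (F : 𝕜⟦X⟧) {n N : ℕ} (h : n ≤ N) :
    coeff n (substNC Z F) = ∑ m ∈ Finset.range (N + 1), coeff m F • coeff n (Z ^ m) := by
  rw [substNC, coeff_mk]
  refine Finset.sum_subset (fun l hl => ?_) fun l _ hl => ?_
  · simp only [Finset.mem_range] at *
    omega
  · simp only [Finset.mem_range] at *
    rw [coeff_pow_eq_zero_of_lt hZ (by omega), smul_zero]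

/-- Only powers of the single element `Z` occur, with scalar coefficients, so `F ↦ F(Z)` is
multiplicative although `S` need not be commutative. -/
theorem substNC_mul {Z : S⟦X⟧} (hZ : coeff 0 Z = 0) (F G : 𝕜⟦X⟧) :
    substNC Z (F * G) = substNC Z F * substNC Z G := by
  ext n
  have h1 : coeff n (substNC Z F * substNC Z G) =
      ∑ k ∈ Finset.range (n + 1), ∑ l ∈ Finset.range (n + 1),
        (coeff k F * coeff l G) • coeff n (Z ^ (k + l)) := by
    rw [coeff_mul]
    have : ∀ p ∈ antidiagonal n, coeff p.1 (substNC Z F) * coeff p.2 (substNC Z G) =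
        ∑ k ∈ Finset.range (n + 1), ∑ l ∈ Finset.range (n + 1),
        (coeff k F * coeff l G) • (coeff p.1 (Z ^ k) * coeff p.2 (Z ^ l)) := by
      intro p hp
      have hp := mem_antidiagonal.1 hp
      rw [coeff_substNC hZ F (show p.1 ≤ n by omega), coeff_substNC hZ G (show p.2 ≤ n by omega),
        Finset.sum_mul_sum]
      simp only [smul_mul_smul_comm]
    rw [Finset.sum_congr rfl this, Finset.sum_comm]
    refine Finset.sum_congr rfl fun k _ => ?_
    rw [Finset.sum_comm]
    refine Finset.sum_congr rfl fun l _ => ?_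
    rw [← Finset.smul_sum, pow_add, coeff_mul]
  rw [h1, sum_range_sum_range_of_lt, coeff_substNC hZ _ le_rfl]
  · refine Finset.sum_congr rfl fun m _ => ?_
    rw [coeff_mul, Finset.sum_smul]
    refine Finset.sum_congr rfl fun p hp => ?_
    rw [mem_antidiagonal.1 hp]
  · intro k l h
    rw [coeff_pow_eq_zero_of_lt hZ h, smul_zero]

theorem substNC_one (Z : S⟦X⟧) : substNC Z (1 : 𝕜⟦X⟧) = 1 := by
  ext n
  rw [substNC, coeff_mk, Finset.sum_eq_single 0]
  · simp
  · intro m _ hm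
    rw [coeff_one, if_neg hm, zero_smul]
  · simp

theorem substNC_pow {Z : S⟦X⟧} (hZ : coeff 0 Z = 0) (F : 𝕜⟦X⟧) (k : ℕ) :
    substNC Z (F ^ k) = substNC Z F ^ k := by
  induction k with
  | zero => rw [pow_zero, pow_zero, substNC_one]
  | succ k ih => rw [pow_succ, pow_succ, substNC_mul hZ, ih]

theorem coeff_zero_substNC (Z : S⟦X⟧) {F : 𝕜⟦X⟧} (hF : coeff 0 F = 0) :
    coeff 0 (substNC Z F) = 0 := by
  simp only [substNC, coeff_mk, zero_add, Finset.sum_range_one, hF, zero_smul]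

theorem substNC_substNC {Z : S⟦X⟧} (hZ : coeff 0 Z = 0) {G : 𝕜⟦X⟧} (hG : coeff 0 G = 0)
    (F : 𝕜⟦X⟧) : substNC (substNC Z G) F = substNC Z (F.subst G) := by
  ext n
  have h0 := coeff_zero_substNC Z hG
  rw [coeff_substNC h0 F le_rfl, coeff_substNC hZ _ le_rfl]
  have : ∀ l ∈ Finset.range (n + 1), coeff l (F.subst G) • coeff n (Z ^ l) =
      ∑ m ∈ Finset.range (n + 1), coeff m F • (coeff l (G ^ m) • coeff n (Z ^ l)) := by
    intro l hl
    rw [← sum_coeff_mul_coeff_pow hG (show l ≤ n by simpa [Nat.lt_succ_iff] using hl),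
      Finset.sum_smul]
    simp only [mul_smul]
  rw [Finset.sum_congr rfl this, Finset.sum_comm]
  refine Finset.sum_congr rfl fun m _ => ?_
  rw [← substNC_pow hZ, coeff_substNC hZ _ le_rfl, Finset.smul_sum]

theorem substNC_X {Z : S⟦X⟧} (hZ : coeff 0 Z = 0) : substNC Z (X : 𝕜⟦X⟧) = Z := by
  ext n
  rw [coeff_substNC hZ _ (Nat.le_succ n), Finset.sum_eq_single 1]
  · simp
  · intro m _ hm
    rw [coeff_X, if_neg hm, zero_smul]
  · simp

end Substitution

/-! ### The Magnus expansion of one variable for a Rota-Baxter operator. -/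

section Core

open PowerSeries

variable {𝕜 S : Type*} [Field 𝕜] [Ring S] [Algebra 𝕜 S]

/-- The commutator as a bilinear map. -/
def commutator (𝕜 S : Type*) [Field 𝕜] [Ring S] [Algebra 𝕜 S] : S →ₗ[𝕜] S →ₗ[𝕜] S :=
  LinearMap.mul 𝕜 S - (LinearMap.mul 𝕜 S).flip

@[simp]
theorem commutator_apply (x y : S) : commutator 𝕜 S x y = x * y - y * x := rfl

theorem sum_adCoeff_geom_cast [CharZero 𝕜] {x y : S} (h : Commute x y) (m : ℕ) :
    ∑ p ∈ antidiagonal m, ((adCoeff p.2 : 𝕜) / ((p.1 + 1).factorial : 𝕜)) •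
      ((∑ i ∈ Finset.range (p.1 + 1), x ^ i * y ^ (p.1 - i)) * (x - y) ^ p.2) =
      (1 / (m.factorial : 𝕜)) • x ^ m := by
  let _ : Algebra ℚ S := Algebra.compHom S (algebraMap ℚ 𝕜)
  have hq : ∀ (q : ℚ) (s : S), q • s = (q : 𝕜) • s := fun q s => by
    rw [Algebra.smul_def, Algebra.smul_def]
    rfl
  have := sum_adCoeff_geom_of_commute h m
  simp only [hq] at this
  simpa using this

theorem nestCoeff_mul (z : ℕ → S) : ∀ m n, nestCoeff (LinearMap.mul 𝕜 S) z 1 m n =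
    coeff n ((mk z) ^ m) := by
  intro m
  induction m with
  | zero => intro n; rw [nestCoeff, pow_zero, coeff_one]
  | succ m ih =>
    intro n
    rw [nestCoeff, pow_succ', coeff_mul]
    simp only [ih, LinearMap.mul_apply', coeff_mk]

/-- Left multiplication minus right multiplication. -/
def powerSeriesAd (𝕜 : Type*) {S : Type*} [Field 𝕜] [Ring S] [Algebra 𝕜 S] (Z : S⟦X⟧) :
    Module.End 𝕜 S⟦X⟧ :=
  LinearMap.mulLeft 𝕜 Z - LinearMap.mulRight 𝕜 Z

theorem coeff_zero_powerSeriesAd_pow (Z : S⟦X⟧) (a : S) (m : ℕ) :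
    coeff 0 ((powerSeriesAd 𝕜 Z ^ m) (X * C a)) = 0 := by
  induction m with
  | zero => simp
  | succ m ih =>
    rw [pow_succ', Module.End.mul_apply]
    generalize (powerSeriesAd 𝕜 Z ^ m) (X * C a) = q at ih
    rw [coeff_zero_eq_constantCoeff_apply] at ih ⊢
    simp [powerSeriesAd, ih]

/-- The letter `a` has degree one in the formal variable, whence `X * C a` and the shift from `n` to
`n + 1`. -/
theorem nestCoeff_commutator (z : ℕ → S) (a : S) : ∀ m n,
    nestCoeff (commutator 𝕜 S) z a m n =
      coeff (n + 1) ((powerSeriesAd 𝕜 (mk z) ^ m) (X * C a)) := by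
  intro m
  induction m with
  | zero =>
    intro n
    rw [nestCoeff, pow_zero, Module.End.one_apply, coeff_succ_X_mul, coeff_C]
  | succ m ih =>
    intro n
    rw [nestCoeff, pow_succ', Module.End.mul_apply]
    set q := (powerSeriesAd 𝕜 (mk z) ^ m) (X * C a) with hq
    have h0 : coeff 0 q = 0 := coeff_zero_powerSeriesAd_pow _ _ _
    rw [powerSeriesAd, LinearMap.sub_apply, LinearMap.mulLeft_apply, LinearMap.mulRight_apply,
      map_sub, coeff_mul, coeff_mul, Finset.Nat.antidiagonal_succ', Finset.sum_cons,
      ← Finset.Nat.antidiagonal_succ', Finset.Nat.antidiagonal_succ, Finset.sum_cons, h0, mul_zero,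
      zero_mul, zero_add, zero_add, Finset.sum_map, Finset.sum_map,
      ← Finset.Nat.sum_antidiagonal_swap (f := fun p => coeff _ q * coeff _ (mk z)),
      ← Finset.sum_sub_distrib]
    refine Finset.sum_congr rfl fun p _ => ?_
    simp [ih, hq]

variable (J : S →ₗ[𝕜] S) (a : S)

/-- The terms of the solution of `U = 1 + J(U a)`. -/
def pathOrdered : ℕ → S
  | 0 => 1
  | n + 1 => J (pathOrdered n * a)

/-- `J` applied to all coefficients. -/
def mapCoeff (p : S⟦X⟧) : S⟦X⟧ := mk fun n => J (coeff n p)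

/-- Rota-Baxter operators of weight zero. -/
def IsRotaBaxter (J : S →ₗ[𝕜] S) : Prop :=
  ∀ x y, J x * J y = J (x * J y) + J (J x * y)

variable {J}

theorem IsRotaBaxter.mapCoeff_mul (hJ : IsRotaBaxter J) (p q : S⟦X⟧) :
    mapCoeff J p * mapCoeff J q = mapCoeff J (p * mapCoeff J q + mapCoeff J p * q) := by
  ext n
  simp only [mapCoeff, coeff_mul, coeff_mk, map_add, map_sum, hJ _ _, Finset.sum_add_distrib]

/-- The derivative of `Z^{k+1}` in the direction of `ζ`. -/
def powDeriv (Z ζ : S⟦X⟧) (k : ℕ) : S⟦X⟧ :=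
  ∑ i ∈ Finset.range (k + 1), Z ^ i * ζ * Z ^ (k - i)

theorem powDeriv_succ (Z ζ : S⟦X⟧) (k : ℕ) :
    powDeriv Z ζ (k + 1) = ζ * Z ^ (k + 1) + Z * powDeriv Z ζ k := by
  rw [powDeriv, Finset.sum_range_succ', powDeriv, Finset.mul_sum, add_comm]
  simp [pow_succ', mul_assoc]

/-- Integrated Leibniz rule for a power of `Z = J ζ`; each step of the induction is one application
of the Rota-Baxter identity. -/
theorem IsRotaBaxter.pow_succ_eq (hJ : IsRotaBaxter J) (ζ : S⟦X⟧) (k : ℕ) :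
    mapCoeff J ζ ^ (k + 1) = mapCoeff J (powDeriv (mapCoeff J ζ) ζ k) := by
  induction k with
  | zero => simp [powDeriv]
  | succ k ih =>
    rw [pow_succ', ih, hJ.mapCoeff_mul, ← ih, powDeriv_succ]

/-- This brings the derivative of a power into the form of a polynomial in two commuting operators,
to which the Bernoulli identity applies. -/
theorem powDeriv_eq (Z ζ : S⟦X⟧) (k : ℕ) :
    powDeriv Z ζ k = (∑ i ∈ Finset.range (k + 1),
      LinearMap.mulLeft 𝕜 Z ^ i * LinearMap.mulRight 𝕜 Z ^ (k - i)) ζ := by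
  rw [powDeriv, LinearMap.sum_apply]
  refine Finset.sum_congr rfl fun i _ => ?_
  rw [Module.End.mul_apply, LinearMap.pow_mulRight, LinearMap.pow_mulLeft,
    LinearMap.mulLeft_apply, LinearMap.mulRight_apply, mul_assoc]

/-- `p` vanishes to order `d`. -/
def VanishesTo (d : ℕ) (p : S⟦X⟧) : Prop := ∀ i < d, coeff i p = 0

theorem VanishesTo.mul {d e : ℕ} {p q : S⟦X⟧} (hp : VanishesTo d p) (hq : VanishesTo e q) :
    VanishesTo (d + e) (p * q) := by
  intro i hi
  rw [coeff_mul]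
  refine Finset.sum_eq_zero fun r hr => ?_
  have hr := mem_antidiagonal.1 hr
  by_cases h : r.1 < d
  · rw [hp _ h, zero_mul]
  · rw [hq _ (by omega), mul_zero]

theorem VanishesTo.sub {d : ℕ} {p q : S⟦X⟧} (hp : VanishesTo d p) (hq : VanishesTo d q) :
    VanishesTo d (p - q) := fun i hi => by rw [map_sub, hp i hi, hq i hi, sub_zero]

theorem VanishesTo.sum {ι : Type*} {s : Finset ι} {d : ℕ} {p : ι → S⟦X⟧}
    (hp : ∀ i ∈ s, VanishesTo d (p i)) : VanishesTo d (∑ i ∈ s, p i) := fun i hi => by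
  rw [map_sum]
  exact Finset.sum_eq_zero fun j hj => hp j hj i hi

theorem vanishesTo_pow {Z : S⟦X⟧} (hZ : coeff 0 Z = 0) (k : ℕ) : VanishesTo k (Z ^ k) :=
  fun _ hi => coeff_pow_eq_zero_of_lt hZ hi

theorem vanishesTo_powDeriv {Z ζ : S⟦X⟧} (hZ : coeff 0 Z = 0) {d : ℕ} (hζ : VanishesTo d ζ)
    (k : ℕ) : VanishesTo (k + d) (powDeriv Z ζ k) := by
  refine VanishesTo.sum fun i hi => ?_
  have hi := Finset.mem_range.1 hi
  have := ((vanishesTo_pow hZ i).mul hζ).mul (vanishesTo_pow hZ (k - i))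
  rwa [show i + d + (k - i) = k + d by omega] at this

theorem vanishesTo_powerSeriesAd {Z : S⟦X⟧} (hZ : coeff 0 Z = 0) (k : ℕ) :
    VanishesTo (k + 1) ((powerSeriesAd 𝕜 Z ^ k) (X * C a)) := by
  induction k with
  | zero =>
    intro i hi
    obtain rfl : i = 0 := by omega
    simp
  | succ k ih =>
    rw [pow_succ', Module.End.mul_apply, powerSeriesAd]
    have h1 : VanishesTo 1 Z := by simpa using vanishesTo_pow hZ 1
    have h2 := (h1.mul ih).sub (by simpa [add_comm] using ih.mul h1)
    rwa [add_comm 1] at h2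

theorem powDeriv_sub (Z ζ ζ' : S⟦X⟧) (k : ℕ) :
    powDeriv Z (ζ - ζ') k = powDeriv Z ζ k - powDeriv Z ζ' k := by
  simp only [powDeriv, mul_sub, sub_mul, Finset.sum_sub_distrib]

/-- This is the truncated form of `(e^Z)' = e^Z a`. Grouping the double series in powers of `Z` and
of `ad Z` by total order `m`, the Bernoulli identity leaves `Z^m / m!` times `X a`. Since `Z` has no
constant term, `ζ` is needed only up to degree `n + 1`. -/
theorem coeff_sum_powDeriv [CharZero 𝕜] {Z ζ : S⟦X⟧} (hZ : coeff 0 Z = 0) (n : ℕ)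
    (hζ : ∀ i ≤ n + 1, coeff i ζ = coeff i (∑ l ∈ Finset.range (n + 1),
      (adCoeff l : 𝕜) • (powerSeriesAd 𝕜 Z ^ l) (X * C a))) :
    coeff (n + 1) (∑ m ∈ Finset.range (n + 1),
      (1 / ((m + 1).factorial : 𝕜)) • powDeriv Z ζ m) =
    (∑ m ∈ Finset.range (n + 1), (1 / (m.factorial : 𝕜)) • coeff n (Z ^ m)) * a := by
  set ζ' := ∑ l ∈ Finset.range (n + 1), (adCoeff l : 𝕜) • (powerSeriesAd 𝕜 Z ^ l) (X * C a)
    with hζ'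
  have h1 : ∀ m, coeff (n + 1) (powDeriv Z ζ m) = coeff (n + 1) (powDeriv Z ζ' m) := by
    intro m
    have : VanishesTo (n + 2) (ζ - ζ') := fun i hi => by
      rw [map_sub, hζ i (by omega), sub_self]
    have := vanishesTo_powDeriv hZ this m (n + 1) (by omega)
    rwa [powDeriv_sub, map_sub, sub_eq_zero] at this
  have h2 : ∀ m, (1 / ((m + 1).factorial : 𝕜)) • powDeriv Z ζ' m =
      ∑ l ∈ Finset.range (n + 1), ((adCoeff l : 𝕜) / ((m + 1).factorial : 𝕜)) •
        powDeriv Z ((powerSeriesAd 𝕜 Z ^ l) (X * C a)) m := by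
    intro m
    rw [powDeriv_eq (𝕜 := 𝕜), hζ', map_sum, Finset.smul_sum]
    refine Finset.sum_congr rfl fun l _ => ?_
    rw [map_smul, ← powDeriv_eq, smul_smul]
    congr 1
    ring
  have hc : Commute (LinearMap.mulLeft 𝕜 Z) (LinearMap.mulRight 𝕜 Z) :=
    LinearMap.commute_mulLeft_right Z Z
  have h3 : ∀ m, ∑ p ∈ antidiagonal m, ((adCoeff p.2 : 𝕜) / ((p.1 + 1).factorial : 𝕜)) •
      powDeriv Z ((powerSeriesAd 𝕜 Z ^ p.2) (X * C a)) p.1 =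
      (1 / (m.factorial : 𝕜)) • (Z ^ m * (X * C a)) := by
    intro m
    have := congrArg (fun T : Module.End 𝕜 S⟦X⟧ => T (X * C a)) (sum_adCoeff_geom_cast (𝕜 := 𝕜) hc m)
    simp only [LinearMap.sum_apply, LinearMap.smul_apply, Module.End.mul_apply] at this
    rw [LinearMap.pow_mulLeft, LinearMap.mulLeft_apply] at this
    rw [← this]
    refine Finset.sum_congr rfl fun p _ => ?_
    rw [powDeriv_eq (𝕜 := 𝕜), LinearMap.sum_apply]
    rfl
  calc _ = coeff (n + 1) (∑ m ∈ Finset.range (n + 1), ∑ l ∈ Finset.range (n + 1),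
        ((adCoeff l : 𝕜) / ((m + 1).factorial : 𝕜)) •
        powDeriv Z ((powerSeriesAd 𝕜 Z ^ l) (X * C a)) m) := by
        simp only [← h2, map_sum, coeff_smul, h1]
    _ = ∑ m ∈ Finset.range (n + 1), ∑ p ∈ antidiagonal m, coeff (n + 1)
        (((adCoeff p.2 : 𝕜) / ((p.1 + 1).factorial : 𝕜)) •
        powDeriv Z ((powerSeriesAd 𝕜 Z ^ p.2) (X * C a)) p.1) := by
        simp only [map_sum]
        -- The terms with `k + l > n` vanish to order `k + l + 1`, which exceeds `n + 1`.
        refine sum_range_sum_range_of_lt n _ fun k l hkl => ?_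
        rw [coeff_smul, vanishesTo_powDeriv hZ (vanishesTo_powerSeriesAd a hZ l) k _ (by omega),
          smul_zero]
    _ = _ := by
        rw [Finset.sum_mul]
        refine Finset.sum_congr rfl fun m _ => ?_
        rw [← map_sum, h3, coeff_smul, smul_mul_assoc, ← mul_assoc,
          (commute_X (Z ^ m)).eq, mul_assoc, coeff_succ_X_mul, coeff_mul_C]

variable [CharZero 𝕜] {a} {Z : ℕ → S}

/-- Induction on the degree: since `Z = J ζ`, the coefficient of degree `n + 1` of `e^Z` is `J` of
the derivative of `e^Z` in the direction `ζ`, and that derivative is `e^Z a`. So `e^Z` solves the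
equation `U = 1 + J(U a)` of the path-ordered exponential. -/
theorem pathOrdered_eq_coeff_exp (hJ : IsRotaBaxter J) (h0 : Z 0 = 0)
    (hZ : ∀ n, Z (n + 1) = ∑ c : Composition n, (adCoeff c.length : 𝕜) •
      J (act (commutator 𝕜 S) (fun j => Z (c.blocksFun j)) a)) :
    ∀ n, pathOrdered J a n = coeff n (substNC (mk Z) (exp 𝕜)) := by
  have hZ0 : coeff 0 (mk Z) = 0 := by rw [coeff_mk, h0]
  set ζ : S⟦X⟧ := mk fun n => match n with
    | 0 => 0
    | n + 1 => ∑ c : Composition n, (adCoeff c.length : 𝕜) •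
      act (commutator 𝕜 S) (fun j => Z (c.blocksFun j)) a with hζ
  have h1 : mapCoeff J ζ = mk Z := by
    ext n
    rw [mapCoeff, coeff_mk, hζ, coeff_mk, coeff_mk]
    cases n with
    | zero => simp [h0]
    | succ n => simp [hZ]
  intro n
  induction n with
  | zero => simp [pathOrdered, substNC]
  | succ n ih =>
    have hp : ∀ i ≤ n + 1, coeff i ζ = coeff i (∑ l ∈ Finset.range (n + 1),
        (adCoeff l : 𝕜) • (powerSeriesAd 𝕜 (mk Z) ^ l) (X * C a)) := by
      intro i hi
      simp only [map_sum, coeff_smul]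
      cases i with
      | zero => simp only [hζ, coeff_mk, coeff_zero_powerSeriesAd_pow, smul_zero,
          Finset.sum_const_zero]
      | succ i =>
        simp only [← nestCoeff_commutator]
        rw [hζ, coeff_mk]
        exact sum_composition_act (commutator 𝕜 S) Z h0 a i n (by omega) (fun l => (adCoeff l : 𝕜))
    have h2 := coeff_sum_powDeriv a hZ0 n hp
    rw [pathOrdered, ih]
    simp only [substNC, coeff_mk]
    rw [Finset.sum_range_succ' _ (n + 1)]
    have h3 : coeff 0 (exp 𝕜) • coeff (n + 1) (mk Z ^ 0) = 0 := by
      rw [pow_zero, coeff_one, if_neg n.succ_ne_zero, smul_zero]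
    have h4 : ∀ m, coeff m (exp 𝕜) = 1 / (m.factorial : 𝕜) := fun m => by simp [coeff_exp]
    rw [h3, add_zero]
    simp only [h4]
    rw [← h2, map_sum, map_sum]
    refine Finset.sum_congr rfl fun m _ => ?_
    rw [coeff_smul, map_smul, ← h1, hJ.pow_succ_eq]
    simp only [mapCoeff, coeff_mk]

/-- The coefficients of `log (1 + z)`. -/
def logCoeff (k : ℕ) : ℚ := (-1) ^ (k + 1) / k

/-- The logarithm inverts the exponential of the previous lemma. Passing from `exp` to `exp - 1`
changes only the term of degree zero, which never occurs because blocks are nonempty. -/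
theorem eq_sum_log_pathOrdered (hJ : IsRotaBaxter J) (h0 : Z 0 = 0)
    (hZ : ∀ n, Z (n + 1) = ∑ c : Composition n, (adCoeff c.length : 𝕜) •
      J (act (commutator 𝕜 S) (fun j => Z (c.blocksFun j)) a)) (n : ℕ) :
    Z n = ∑ c : Composition n, (logCoeff c.length : 𝕜) •
      (List.ofFn fun j => pathOrdered J a (c.blocksFun j)).prod := by
  have hZ0 : coeff 0 (mk Z) = 0 := by rw [coeff_mk, h0]
  have hU := pathOrdered_eq_coeff_exp hJ h0 hZ
  set U : ℕ → S := fun n => coeff n (substNC (mk Z) (exp 𝕜 - 1)) with hUdef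
  have hG : coeff 0 (exp 𝕜 - 1) = 0 := by simp
  have hU0 : U 0 = 0 := coeff_zero_substNC _ hG
  have hUn : ∀ n, 0 < n → pathOrdered J a n = U n := by
    intro n hn
    rw [hU, hUdef]
    simp only [substNC, coeff_mk, map_sub, sub_smul, Finset.sum_sub_distrib]
    rw [eq_comm, sub_eq_self]
    refine Finset.sum_eq_zero fun m _ => ?_
    rcases Nat.eq_zero_or_pos m with rfl | hm
    · rw [pow_zero, coeff_one (n := n), if_neg hn.ne', smul_zero]
    · rw [coeff_one (n := m), if_neg hm.ne', zero_smul]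
  have h1 : ∀ c : Composition n, (List.ofFn fun j => pathOrdered J a (c.blocksFun j)).prod =
      act (LinearMap.mul 𝕜 S) (fun j => U (c.blocksFun j)) 1 := by
    intro c
    have : (fun j => pathOrdered J a (c.blocksFun j)) = fun j => U (c.blocksFun j) :=
      funext fun j => hUn _ (c.one_le_blocksFun j)
    rw [this]
    rfl
  simp only [h1]
  rw [sum_composition_act _ U hU0 1 n n le_rfl (fun k => (logCoeff k : 𝕜))]
  simp only [nestCoeff_mul]
  have h2 : mk U = substNC (mk Z) (exp 𝕜 - 1) := by
    ext n
    rw [coeff_mk]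
  have h3 : ∀ k, (logCoeff k : 𝕜) = coeff k (log 𝕜) := by
    intro k
    rw [coeff_log, logCoeff]
    split_ifs with h
    · simp [h]
    · simp
  simp only [h3]
  rw [← coeff_substNC (by rw [coeff_mk, hU0]) _ le_rfl, h2, substNC_substNC hZ0 hG,
    log_subst_exp_sub_one, substNC_X hZ0, coeff_mk]

end Core

/-! ### Koszul signs and operators that obey them. -/

section Signs

theorem perm_induction_swap {n : ℕ} {motive : Equiv.Perm (Fin (n + 1)) → Prop} (one : motive 1)
    (mul_swap : ∀ τ (i : Fin n), motive τ → motive (τ * Equiv.swap i.castSucc i.succ))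
    (τ : Equiv.Perm (Fin (n + 1))) : motive τ := by
  have h : τ ∈ Submonoid.closure (Set.range fun i : Fin n => Equiv.swap i.castSucc i.succ) := by
    rw [Equiv.Perm.mclosure_swap_castSucc_succ]
    trivial
  induction h using Submonoid.closure_induction_right with
  | one => exact one
  | mul_right x y hx hy ih =>
    obtain ⟨i, rfl⟩ := hy
    exact mul_swap x i ih

/-- The factor of the Koszul sign for the letters `a`, `b`, written in this order. -/
def inversionSign {n : ℕ} (q : Fin n → ℤ) (a b : Fin n) : ℤˣ :=
  if b < a then (q a * q b).negOnePow else 1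

theorem koszulSign_eq_prod {n : ℕ} (q : Fin n → ℤ) (τ : Equiv.Perm (Fin n)) :
    koszulSign q τ = ∏ p ∈ (Finset.univ : Finset (Fin n × Fin n)).filter (fun p => p.1 < p.2),
      inversionSign q (τ p.1) (τ p.2) := by
  rw [koszulSign, ← Finset.filter_filter, Finset.prod_filter]
  rfl

theorem inversionSign_mul {n : ℕ} (q : Fin n → ℤ) {a b : Fin n} (h : a ≠ b) :
    inversionSign q b a = inversionSign q a b * (q a * q b).negOnePow := by
  rcases lt_or_gt_of_ne h with h | h
  · simp [inversionSign, h, h.le, mul_comm]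
  · simp [inversionSign, h, h.le, Int.units_mul_self]

theorem koszulSign_mul_swap {n : ℕ} (q : Fin (n + 1) → ℤ) (τ : Equiv.Perm (Fin (n + 1)))
    (i : Fin n) : koszulSign q (τ * Equiv.swap i.castSucc i.succ) =
      koszulSign q τ * (q (τ i.castSucc) * q (τ i.succ)).negOnePow := by
  rw [koszulSign_eq_prod, koszulSign_eq_prod]
  have hmem : (i.castSucc, i.succ) ∈
      (Finset.univ : Finset (Fin (n + 1) × Fin (n + 1))).filter (fun p => p.1 < p.2) := by
    simp
  rw [← Finset.mul_prod_erase _ _ hmem, ← Finset.mul_prod_erase _ _ hmem]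
  have hne : τ i.castSucc ≠ τ i.succ := fun h => by simpa [Fin.ext_iff] using τ.injective h
  simp only [Equiv.Perm.mul_apply, Equiv.swap_apply_left, Equiv.swap_apply_right]
  rw [inversionSign_mul q hne, mul_right_comm]
  congr 2
  -- The adjacent transposition permutes the remaining pairs `p.1 < p.2` among themselves; only the
  -- exchanged pair changes its factor.
  refine Finset.prod_equiv (Equiv.prodCongr (Equiv.swap i.castSucc i.succ)
    (Equiv.swap i.castSucc i.succ)) ?_ ?_
  · rintro ⟨a, b⟩
    simp only [Finset.mem_erase, ne_eq, Prod.mk.injEq, Finset.mem_filter, Finset.mem_univ,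
      true_and, Equiv.prodCongr_apply, Prod.map_apply, Equiv.swap_apply_def]
    clear hne hmem
    split_ifs <;> simp only [Fin.ext_iff, Fin.lt_def, Fin.val_castSucc, Fin.val_succ,
      and_true, and_self, not_true_eq_false] at *
    all_goals grind
  · rintro ⟨a, b⟩ _
    rfl

@[simp]
theorem koszulSign_one {n : ℕ} (q : Fin n → ℤ) : koszulSign q 1 = 1 := by
  rw [koszulSign_eq_prod]
  refine Finset.prod_eq_one fun p hp => ?_
  have hp : p.1 < p.2 := by simpa using hp
  exact if_neg (lt_asymm hp)

/-- The cocycle rule, where `σ` carries the degrees along. It follows by writing `τ` as a product of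
adjacent transpositions. -/
theorem koszulSign_mul {n : ℕ} (q : Fin n → ℤ) (σ τ : Equiv.Perm (Fin n)) :
    koszulSign q (σ * τ) = koszulSign q σ * koszulSign (q ∘ σ) τ := by
  cases n with
  | zero => rw [Subsingleton.elim τ 1]; simp
  | succ n =>
    induction τ using perm_induction_swap with
    | one => simp
    | mul_swap τ i ih =>
      rw [← mul_assoc, koszulSign_mul_swap, koszulSign_mul_swap, ih, mul_assoc]
      rfl

/-- The sign sees the degrees only modulo two. This allows multilinear extension through even and
odd parts alone. -/
theorem koszulSign_congr {n : ℕ} {q q' : Fin n → ℤ} (h : ∀ i, Even (q i - q' i))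
    (τ : Equiv.Perm (Fin n)) : koszulSign q τ = koszulSign q' τ := by
  refine Finset.prod_congr rfl fun p _ => ?_
  rw [Int.negOnePow_eq_iff]
  have : q (τ p.1) * q (τ p.2) - q' (τ p.1) * q' (τ p.2) =
    (q (τ p.1) - q' (τ p.1)) * q (τ p.2) + q' (τ p.1) * (q (τ p.2) - q' (τ p.2)) := by ring
  rw [this]
  exact ((h _).mul_right _).add ((h _).mul_left _)

@[simp]
theorem koszulSign_zero {n : ℕ} (τ : Equiv.Perm (Fin n)) : koszulSign (fun _ => 0) τ = 1 := by
  simp [koszulSign]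

/-- The elements `V` and `V'` commute up to the sign for the degrees `d` and `d'`. -/
def SignCommute {B : Type*} [Ring B] (d d' : ℤ) (V V' : B) : Prop :=
  V * V' = (d * d').negOnePow • (V' * V)

section SignCommute

variable {B : Type*} [Ring B] {d d' d₁ d₂ : ℤ} {V V' V₁ V₂ : B}

theorem SignCommute.symm (h : SignCommute d d' V V') : SignCommute d' d V' V := by
  rw [SignCommute, h, smul_smul, mul_comm d' d, Int.units_mul_self, one_smul]

theorem SignCommute.mul_left (h₁ : SignCommute d₁ d' V₁ V') (h₂ : SignCommute d₂ d' V₂ V') :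
    SignCommute (d₁ + d₂) d' (V₁ * V₂) V' := by
  rw [SignCommute, mul_assoc, h₂, mul_smul_comm, ← mul_assoc, h₁, smul_mul_assoc, smul_smul,
    mul_assoc, add_mul, Int.negOnePow_add, mul_comm]

theorem SignCommute.one_left : SignCommute 0 d' (1 : B) V' := by
  simp [SignCommute]

theorem SignCommute.prod_left : ∀ {k : ℕ} {q : Fin k → ℤ} {y : Fin k → B},
    (∀ i, SignCommute (q i) d' (y i) V') → SignCommute (∑ i, q i) d' (List.ofFn y).prod V'
  | 0, _, _, _ => by simpa using SignCommute.one_left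
  | k + 1, q, y, h => by
    rw [List.ofFn_succ, List.prod_cons, Fin.sum_univ_succ]
    exact (h 0).mul_left (SignCommute.prod_left fun i => h i.succ)

theorem SignCommute.prod_prod {k k' : ℕ} {q : Fin k → ℤ} {y : Fin k → B} {q' : Fin k' → ℤ}
    {y' : Fin k' → B} (h : ∀ i j, SignCommute (q i) (q' j) (y i) (y' j)) :
    SignCommute (∑ i, q i) (∑ i, q' i) (List.ofFn y).prod (List.ofFn y').prod :=
  SignCommute.prod_left fun i => (SignCommute.prod_left fun j => (h i j).symm).symm

theorem prod_ofFn_swap : ∀ {n : ℕ} (y : Fin (n + 1) → B) (q : Fin (n + 1) → ℤ) (i : Fin n),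
    SignCommute (q i.succ) (q i.castSucc) (y i.succ) (y i.castSucc) →
    (List.ofFn (y ∘ Equiv.swap i.castSucc i.succ)).prod =
      (q i.castSucc * q i.succ).negOnePow • (List.ofFn y).prod
  | n + 1, y, q, i => by
    induction i using Fin.cases with
    | zero =>
      intro h
      have h1 : (fun j : Fin n => (y ∘ Equiv.swap 0 (Fin.succ 0)) j.succ.succ) =
          fun j : Fin n => y j.succ.succ := by
        funext j
        rw [Function.comp_apply, Equiv.swap_apply_of_ne_of_ne] <;> simp [Fin.ext_iff]
      rw [Fin.castSucc_zero] at h ⊢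
      rw [List.ofFn_succ, List.ofFn_succ, h1, List.ofFn_succ, List.ofFn_succ (n := n)]
      simp only [List.prod_cons, Function.comp_apply, Equiv.swap_apply_left,
        Equiv.swap_apply_right]
      rw [← mul_assoc, ← mul_assoc, h, smul_mul_assoc, mul_comm (q 0)]
    | succ i =>
      intro h
      have h1 : (fun j : Fin (n + 1) => (y ∘ Equiv.swap i.succ.castSucc i.succ.succ) j.succ) =
          (fun j : Fin (n + 1) => y j.succ) ∘ Equiv.swap i.castSucc i.succ := by
        funext j
        simp only [Function.comp_apply, Equiv.swap_apply_def]
        split_ifs <;> simp_all [Fin.ext_iff]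
      have h0 : (y ∘ Equiv.swap i.succ.castSucc i.succ.succ) 0 = y 0 := by
        rw [Function.comp_apply, Equiv.swap_apply_of_ne_of_ne] <;> simp [Fin.ext_iff]
      rw [List.ofFn_succ, h0, h1, List.ofFn_succ (f := y), List.prod_cons, List.prod_cons,
        prod_ofFn_swap (fun j => y j.succ) (fun j => q j.succ) i h, mul_smul_comm]
      rfl

theorem prod_ofFn_perm {n : ℕ} {y : Fin n → B} {q : Fin n → ℤ}
    (h : ∀ i j, SignCommute (q i) (q j) (y i) (y j)) (τ : Equiv.Perm (Fin n)) :
    (List.ofFn (y ∘ τ)).prod = koszulSign q τ • (List.ofFn y).prod := by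
  cases n with
  | zero => rw [Subsingleton.elim τ 1]; simp
  | succ n =>
    induction τ using perm_induction_swap with
    | one => simp
    | mul_swap τ i ih =>
      rw [koszulSign_mul_swap, Equiv.Perm.coe_mul, ← Function.comp_assoc,
        prod_ofFn_swap (y ∘ τ) (q ∘ τ) i (h _ _), ih, smul_smul, mul_comm]
      rfl

end SignCommute

section Creation

variable (𝕜 : Type*) [Field 𝕜] {n : ℕ} (q : Fin n → ℤ)

/-- The sign of adding the letter `i` to the set `T`. -/
def creationSign (i : Fin n) (T : Finset (Fin n)) : ℤˣ :=
  ∏ j ∈ T.filter (· < i), (q i * q j).negOnePow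

/-- Creation operators, which commute up to the signs given by the degrees `q`. -/
def creation (i : Fin n) : Module.End 𝕜 (Finset (Fin n) → 𝕜) where
  toFun f T := if i ∈ T then creationSign q i (T.erase i) • f (T.erase i) else 0
  map_add' f g := by
    ext T
    by_cases h : i ∈ T <;> simp [h]
  map_smul' a f := by
    ext T
    by_cases h : i ∈ T <;> simp [h, mul_smul_comm]

theorem creation_apply (i : Fin n) (f : Finset (Fin n) → 𝕜) (T : Finset (Fin n)) :
    creation 𝕜 q i f T = if i ∈ T then creationSign q i (T.erase i) • f (T.erase i) else 0 := rfl

theorem creationSign_erase {i j : Fin n} (hij : i ≠ j) {T : Finset (Fin n)} (hj : j ∈ T) :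
    creationSign q i (T.erase i) =
      creationSign q i ((T.erase i).erase j) * inversionSign q i j := by
  have hm : j ∈ T.erase i := Finset.mem_erase.2 ⟨hij.symm, hj⟩
  rw [creationSign, creationSign, Finset.prod_filter, ← Finset.mul_prod_erase _ _ hm, mul_comm,
    Finset.prod_filter]
  rfl

theorem creation_signCommute (i j : Fin n) :
    SignCommute (q i) (q j) (creation 𝕜 q i) (creation 𝕜 q j) := by
  refine LinearMap.ext fun f => funext fun T => ?_
  rw [LinearMap.smul_apply, Pi.smul_apply, Module.End.mul_apply, Module.End.mul_apply]
  simp only [creation_apply, Finset.mem_erase]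
  by_cases hi : i ∈ T
  swap
  · simp [hi]
  by_cases hj : j ∈ T
  swap
  · simp [hj]
  -- A creation operator has square zero, so for `i = j` both sides vanish whatever the degree.
  by_cases hij : i = j
  · simp [hij]
  simp only [hi, hj, hij, Ne.symm hij, ne_eq, not_false_eq_true, and_self, if_true, smul_smul]
  rw [Finset.erase_right_comm (a := j)]
  congr 1
  rw [creationSign_erase q hij hj, creationSign_erase q (Ne.symm hij) hi,
    inversionSign_mul q (Ne.symm hij), Finset.erase_right_comm (a := j), mul_comm (q j)]
  generalize (q i * q j).negOnePow = s
  generalize inversionSign q j i = t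
  generalize creationSign q i ((T.erase i).erase j) = u
  generalize creationSign q j ((T.erase i).erase j) = v
  rw [mul_right_comm, mul_comm _ v, ← mul_assoc, ← mul_assoc]
  ac_rfl

/-- The coefficient of the set of all letters in the image of the vacuum. -/
def topCoeff (n : ℕ) : Module.End 𝕜 (Finset (Fin n) → 𝕜) →ₗ[𝕜] 𝕜 :=
  LinearMap.proj Finset.univ ∘ₗ LinearMap.applyₗ (Pi.single ∅ 1)

theorem prod_creation_apply_of_not_subset (l : List (Fin n)) (T : Finset (Fin n))
    (h : ¬ T ⊆ l.toFinset) :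
    (l.map (creation 𝕜 q)).prod (Pi.single ∅ 1) T = 0 := by
  induction l generalizing T with
  | nil =>
    have : T ≠ ∅ := fun h' => h (by simp [h'])
    simp [this]
  | cons a l ih =>
    rw [List.map_cons, List.prod_cons, Module.End.mul_apply, creation_apply]
    split_ifs with ha
    · rw [ih, smul_zero]
      intro h'
      refine h fun x hx => ?_
      by_cases hxa : x = a
      · simp [hxa]
      · have := h' (Finset.mem_erase.2 ⟨hxa, hx⟩)
        simp only [List.mem_toFinset, List.mem_cons] at this ⊢
        exact Or.inr this
    · rfl

theorem prod_creation_sorted (l : List (Fin n)) (h : l.Pairwise (· < ·)) :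
    (l.map (creation 𝕜 q)).prod (Pi.single ∅ 1) = Pi.single l.toFinset 1 := by
  induction l with
  | nil => simp
  | cons a l ih =>
    rw [List.pairwise_cons] at h
    rw [List.map_cons, List.prod_cons, Module.End.mul_apply, ih h.2]
    have ha : a ∉ l.toFinset := fun h' => (h.1 a (List.mem_toFinset.1 h')).false
    funext T
    rw [creation_apply, List.toFinset_cons]
    by_cases hT : T = insert a l.toFinset
    · subst hT
      rw [if_pos (Finset.mem_insert_self _ _), Finset.erase_insert ha, Pi.single_eq_same,
        Pi.single_eq_same, creationSign, Finset.prod_eq_one, one_smul]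
      intro j hj
      simp only [Finset.mem_filter, List.mem_toFinset] at hj
      exact absurd (h.1 j hj.1) hj.2.not_gt
    · rw [Pi.single_eq_of_ne hT]
      split_ifs with haT
      · rw [Pi.single_eq_of_ne, smul_zero]
        intro h'
        exact hT (by rw [← h', Finset.insert_erase haT])
      · rfl

theorem topCoeff_of_not_surjective {k : ℕ} (w : Fin k → Fin n) (h : ¬ Function.Surjective w) :
    topCoeff 𝕜 n (List.ofFn (creation 𝕜 q ∘ w)).prod = 0 := by
  rw [← List.map_ofFn]
  refine prod_creation_apply_of_not_subset 𝕜 q _ _ fun h' => h fun x => ?_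
  simpa using h' (Finset.mem_univ x)

theorem topCoeff_creation : topCoeff 𝕜 n (List.ofFn (creation 𝕜 q)).prod = 1 := by
  rw [List.ofFn_eq_map, topCoeff, LinearMap.comp_apply, LinearMap.applyₗ_apply_apply,
    prod_creation_sorted 𝕜 q _ (List.pairwise_lt_finRange n)]
  simp

/-- Together with `topCoeff_of_not_surjective` this makes `topCoeff` a polarization functional:
among the words of length `n` exactly the permutations survive, each with its Koszul sign. -/
theorem topCoeff_perm (τ : Equiv.Perm (Fin n)) :
    topCoeff 𝕜 n (List.ofFn (creation 𝕜 q ∘ τ)).prod = koszulSign q τ • 1 := by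
  rw [prod_ofFn_perm (creation_signCommute 𝕜 q), Units.smul_def, map_zsmul, topCoeff_creation]
  rfl

end Creation

end Signs

/-! ### Words and their decomposition into blocks. -/

section Words

theorem ofFn_flatten_composition {α : Type*} {n : ℕ} (f : Fin n → α) (c : Composition n) :
    List.ofFn f = (List.ofFn fun j => List.ofFn (f ∘ c.embedding j)).flatten := by
  have h : (List.ofFn f).splitWrtComposition c =
      List.ofFn fun j => List.ofFn (f ∘ c.embedding j) := by
    refine List.ext_getElem (by simp) fun i h1 h2 => ?_
    have hi : i < c.length := by simpa using h1
    have hs : c.sizeUpTo (i + 1) = c.sizeUpTo i + c.blocksFun ⟨i, hi⟩ := c.sizeUpTo_succ' ⟨i, hi⟩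
    have hle := c.sizeUpTo_le (i + 1)
    rw [List.getElem_splitWrtComposition, List.getElem_ofFn]
    refine List.ext_getElem ?_ fun k h3 h4 => ?_
    · simp
      omega
    · simp only [List.getElem_drop, List.getElem_take, List.getElem_ofFn, Function.comp_apply]
      congr 1
  rw [← h, List.splitWrtComposition, List.flatten_splitWrtCompositionAux]
  rw [c.blocks_sum, List.length_ofFn]

theorem prod_ofFn_composition {B : Type*} [Monoid B] {n : ℕ} (f : Fin n → B)
    (c : Composition n) :
    (List.ofFn f).prod = (List.ofFn fun j => (List.ofFn (f ∘ c.embedding j)).prod).prod := by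
  rw [ofFn_flatten_composition f c, List.prod_flatten, List.map_ofFn]
  rfl

/-- Words of length `n` are families of words indexed by the blocks of a composition. -/
def wordsBlocks {n : ℕ} (ι : Type*) (c : Composition n) :
    (Fin n → ι) ≃ ∀ j : Fin c.length, Fin (c.blocksFun j) → ι :=
  (Equiv.arrowCongr c.blocksFinEquiv.symm (Equiv.refl ι)).trans (Equiv.piCurry fun _ _ => ι)

/-- Expanding the product chooses one word for each block, and these choices concatenate to a single
word of length `n`. -/
theorem prod_ofFn_sum_blocks {𝕜 B ι : Type*} [CommRing 𝕜] [Ring B] [Algebra 𝕜 B] [Fintype ι]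
    {n : ℕ} (c : Composition n) (F : ∀ j : Fin c.length, (Fin (c.blocksFun j) → ι) → B) :
    (List.ofFn fun j => ∑ w, F j w).prod =
      ∑ w : Fin n → ι, (List.ofFn fun j => F j (w ∘ c.embedding j)).prod := by
  classical
  have := (MultilinearMap.mkPiAlgebraFin 𝕜 c.length B).map_sum F
  simp only [MultilinearMap.mkPiAlgebraFin_apply] at this
  rw [this, ← Equiv.sum_comp (wordsBlocks ι c)]
  rfl

theorem act_eq_prod {𝕜 V W : Type*} [CommRing 𝕜] [AddCommGroup V] [Module 𝕜 V] [AddCommGroup W]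
    [Module 𝕜 W] (b : V →ₗ[𝕜] W →ₗ[𝕜] W) {k : ℕ} (u : Fin k → V) (x : W) :
    act b u x = (List.ofFn fun i => (b (u i) : Module.End 𝕜 W)).prod x := by
  induction k with
  | zero => simp
  | succ k ih => rw [act_succ, ih, List.ofFn_succ, List.prod_cons, Module.End.mul_apply]

theorem act_sum_blocks {𝕜 V W ι : Type*} [CommRing 𝕜] [AddCommGroup V] [Module 𝕜 V]
    [AddCommGroup W] [Module 𝕜 W] [Fintype ι] (b : V →ₗ[𝕜] W →ₗ[𝕜] W) {n : ℕ} (c : Composition n)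
    (F : ∀ j : Fin c.length, (Fin (c.blocksFun j) → ι) → V) (x : W) :
    act b (fun j => ∑ w, F j w) x =
      ∑ w : Fin n → ι, act b (fun j => F j (w ∘ c.embedding j)) x := by
  simp only [act_eq_prod, map_sum]
  rw [prod_ofFn_sum_blocks (𝕜 := 𝕜) c (fun j w => (b (F j w) : Module.End 𝕜 W)),
    LinearMap.sum_apply]

theorem act_smul_left {𝕜 V W : Type*} [CommRing 𝕜] [AddCommGroup V] [Module 𝕜 V] [AddCommGroup W]
    [Module 𝕜 W] (b : V →ₗ[𝕜] W →ₗ[𝕜] W) {k : ℕ} (s : Fin k → 𝕜) (u : Fin k → V) (x : W) :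
    act b (fun i => s i • u i) x = (∏ i, s i) • act b u x := by
  induction k with
  | zero => simp
  | succ k ih =>
    rw [act_succ, ih, act_succ, Fin.prod_univ_succ, map_smul, map_smul, LinearMap.smul_apply,
      smul_smul, mul_comm]

theorem act_sum_right {𝕜 V W ι : Type*} [CommRing 𝕜] [AddCommGroup V] [Module 𝕜 V]
    [AddCommGroup W] [Module 𝕜 W] (b : V →ₗ[𝕜] W →ₗ[𝕜] W) {k : ℕ} (u : Fin k → V) (s : Finset ι)
    (x : ι → W) : act b u (∑ i ∈ s, x i) = ∑ i ∈ s, act b u (x i) := by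
  simp only [act_eq_prod, map_sum]

theorem sum_words_succ {M ι : Type*} [AddCommMonoid M] [Fintype ι] {n : ℕ}
    (F : (Fin n → ι) → ι → M) :
    ∑ w, ∑ i, F w i = ∑ w : Fin (n + 1) → ι, F (fun i => w i.castSucc) (w (Fin.last n)) := by
  rw [← Equiv.sum_comp (Fin.snocEquiv fun _ => ι), Fintype.sum_prod_type, Finset.sum_comm]
  simp [Fin.snocEquiv]

end Words

/-! ### The recursion in several graded variables. -/

section MagnusTerm

variable {𝕜 E : Type*} [Field 𝕜] [CharZero 𝕜] [AddCommGroup E] [Module 𝕜 E]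

/-- The terms of the Magnus expansion of several variables, given by the recursion. -/
def magnusTerm (b : E →ₗ[𝕜] E →ₗ[𝕜] E) (J : E →ₗ[𝕜] E) : ∀ n, (Fin n → ℤ) → (Fin n → E) → E
  | 0, _, _ => 0
  | n + 1, q, l => ∑ c : Composition n, (recursionCoeff c : 𝕜) •
      ∑ σ : Equiv.Perm (Fin (n + 1)), koszulSign q σ •
        J (act b (fun j =>
          have := c.blocksFun_le j
          magnusTerm b J (c.blocksFun j) (fun i => q (σ (c.embedding j i).castSucc))
            (fun i => l (σ (c.embedding j i).castSucc))) (l (σ (Fin.last n))))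
termination_by n => n

variable (b : E →ₗ[𝕜] E →ₗ[𝕜] E) (J : E →ₗ[𝕜] E)

/-- One summand of the recursion. -/
def magnusSummand {n : ℕ} (c : Composition n) (q : Fin (n + 1) → ℤ) (l : Fin (n + 1) → E) : E :=
  J (act b (fun j => magnusTerm b J (c.blocksFun j) (fun i => q (c.embedding j i).castSucc)
            (fun i => l (c.embedding j i).castSucc)) (l (Fin.last n)))

theorem magnusTerm_zero (q : Fin 0 → ℤ) (l : Fin 0 → E) : magnusTerm b J 0 q l = 0 := by
  rw [magnusTerm]

theorem magnusTerm_succ {n : ℕ} (q : Fin (n + 1) → ℤ) (l : Fin (n + 1) → E) :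
    magnusTerm b J (n + 1) q l = ∑ c : Composition n, (recursionCoeff c : 𝕜) •
      ∑ σ : Equiv.Perm (Fin (n + 1)), koszulSign q σ • magnusSummand b J c (q ∘ σ) (l ∘ σ) := by
  rw [magnusTerm]
  rfl

/-- Graded symmetry is built into the recursion: reindex its sum over permutations by left
multiplication with `τ`. -/
theorem magnusTerm_perm {n : ℕ} (q : Fin n → ℤ) (l : Fin n → E) (τ : Equiv.Perm (Fin n)) :
    magnusTerm b J n (q ∘ τ) (l ∘ τ) = koszulSign q τ • magnusTerm b J n q l := by
  cases n with
  | zero => simp [magnusTerm_zero]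
  | succ n =>
    rw [magnusTerm_succ, magnusTerm_succ, Finset.smul_sum]
    refine Finset.sum_congr rfl fun c _ => ?_
    rw [smul_comm (koszulSign q τ)]
    refine congrArg _ ?_
    rw [Finset.smul_sum,
      ← Equiv.sum_comp (Equiv.mulLeft τ) fun σ => _ • koszulSign q σ • magnusSummand b J c _ _]
    refine Finset.sum_congr rfl fun σ _ => ?_
    rw [Equiv.coe_mulLeft, koszulSign_mul, smul_smul, ← mul_assoc, Int.units_mul_self, one_mul]
    rfl

variable {b J} {deg : ℤ → Submodule 𝕜 E}

theorem act_mem (hb : ∀ {i j x y}, x ∈ deg i → y ∈ deg j → b x y ∈ deg (i + j)) {k : ℕ}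
    {d : Fin k → ℤ} {u : Fin k → E} (hu : ∀ i, u i ∈ deg (d i)) {d' : ℤ} {x : E}
    (hx : x ∈ deg d') : act b u x ∈ deg (∑ i, d i + d') := by
  induction k with
  | zero => simpa using hx
  | succ k ih =>
    rw [act_succ, Fin.sum_univ_succ, add_assoc]
    exact hb (hu 0) (ih fun i => hu i.succ)

theorem magnusTerm_mem (hb : ∀ {i j x y}, x ∈ deg i → y ∈ deg j → b x y ∈ deg (i + j))
    (hJ : ∀ {i x}, x ∈ deg i → J x ∈ deg i) (n : ℕ) (q : Fin n → ℤ) (l : Fin n → E)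
    (hl : ∀ i, l i ∈ deg (q i)) : magnusTerm b J n q l ∈ deg (∑ i, q i) := by
  induction n using Nat.strong_induction_on with
  | _ n ih =>
    cases n with
    | zero =>
      rw [magnusTerm_zero]
      exact Submodule.zero_mem _
    | succ n =>
      rw [magnusTerm_succ]
      refine Submodule.sum_mem (deg (∑ i, q i)) fun c _ => Submodule.smul_mem _ _ (Submodule.sum_mem _
        fun σ _ => ?_)
      have : magnusSummand b J c (q ∘ σ) (l ∘ σ) ∈ deg (∑ i, q i) := by
        have h0 : ∀ j, magnusTerm b J (c.blocksFun j) (fun i => q (σ (c.embedding j i).castSucc))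
            (fun i => l (σ (c.embedding j i).castSucc)) ∈
            deg (∑ i : Fin (c.blocksFun j), q (σ (c.embedding j i).castSucc)) := fun j =>
          ih _ ((c.blocksFun_le j).trans_lt n.lt_succ_self) _ _ fun i => hl _
        have h := hJ (act_mem hb h0 (hl (σ (Fin.last n))))
        rwa [c.sum_sum_apply_embedding (fun i => q (σ i.castSucc)),
          ← Fin.sum_univ_castSucc (fun i => q (σ i)), Equiv.sum_comp σ] at h
      rcases Int.units_eq_one_or (koszulSign q σ) with h | h <;> rw [h]
      · rwa [one_smul]
      · rw [Units.neg_smul, one_smul]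
        exact neg_mem this

variable {𝓐 B : Type*} [Ring 𝓐] [Algebra 𝕜 𝓐] [Ring B] [Algebra 𝕜 B] {f : ℕ → E →ₗ[𝕜] 𝓐}

/-- When the auxiliary factors obey the same sign rule as the letters, the two signs cancel, and
ordinary commutators in the tensor product compute graded brackets. The weights `m` just add up; the
Dynkin action needs them later. -/
theorem act_commutator_tmul (hb : ∀ {i j x y}, x ∈ deg i → y ∈ deg j → b x y ∈ deg (i + j))
    (hf : ∀ {i i' x y} (m m' : ℕ), x ∈ deg i → y ∈ deg i' →
      f m x * f m' y - (i * i').negOnePow • (f m' y * f m x) = f (m + m') (b x y))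
    {k : ℕ} {d : Fin k → ℤ} {u : Fin k → E} (hu : ∀ i, u i ∈ deg (d i)) {d' : ℤ} {x : E}
    (hx : x ∈ deg d') (m : Fin k → ℕ) (m' : ℕ) {V : Fin k → B} {V' : B}
    (hV : ∀ i j, SignCommute (d i) (d j) (V i) (V j))
    (hV' : ∀ i, SignCommute (d i) d' (V i) V') :
    act (commutator 𝕜 (𝓐 ⊗[𝕜] B)) (fun i => f (m i) (u i) ⊗ₜ V i) (f m' x ⊗ₜ V') =
      f (∑ i, m i + m') (act b u x) ⊗ₜ ((List.ofFn V).prod * V') := by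
  induction k with
  | zero => simp
  | succ k ih =>
    have h1 : SignCommute (d 0) (∑ i : Fin k, d i.succ + d') (V 0)
        ((List.ofFn fun i => V i.succ).prod * V') :=
      ((SignCommute.prod_left fun i => hV _ _).mul_left (hV' 0).symm).symm
    have hmem := act_mem hb (fun i : Fin k => hu i.succ) hx
    rw [act_succ, ih (fun i => hu i.succ) (fun i => m i.succ) (fun i j => hV _ _)
      (fun i => hV' _), act_succ, Fin.sum_univ_succ, add_assoc, ← hf _ _ (hu 0) hmem,
      List.ofFn_succ, List.prod_cons, mul_assoc, commutator_apply,
      Algebra.TensorProduct.tmul_mul_tmul, Algebra.TensorProduct.tmul_mul_tmul, h1.symm,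
      TensorProduct.tmul_smul, TensorProduct.sub_tmul, mul_comm (d 0), TensorProduct.smul_tmul']

end MagnusTerm

theorem prod_ofFn_tmul {𝕜 A B : Type*} [CommRing 𝕜] [Ring A] [Algebra 𝕜 A] [Ring B] [Algebra 𝕜 B]
    {n : ℕ} (x : Fin n → A) (y : Fin n → B) :
    (List.ofFn fun i => x i ⊗ₜ[𝕜] y i).prod = (List.ofFn x).prod ⊗ₜ (List.ofFn y).prod := by
  induction n with
  | zero => simp [Algebra.TensorProduct.one_def]
  | succ n ih =>
    simp only [List.ofFn_succ, List.prod_cons, ih, Algebra.TensorProduct.tmul_mul_tmul]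

/-! ### Iterated integrals and path-ordered exponentials. -/

section IteratedPath

variable {𝕜 S : Type*} [Field 𝕜] [Ring S] [Algebra 𝕜 S]

/-- The iterated integral `J (⋯ J (J (v_1) v_2) ⋯ v_n)`. -/
def iteratedPath (J : S →ₗ[𝕜] S) : ∀ {n : ℕ}, (Fin n → S) → S
  | 0, _ => 1
  | _ + 1, v => J (iteratedPath J (fun i => v i.castSucc) * v (Fin.last _))

theorem pathOrdered_sum {ι B : Type*} [Fintype ι] [Ring B] [Algebra 𝕜 B] (J : S →ₗ[𝕜] S)
    (x : ι → S) (Y : ι → B) : ∀ n, pathOrdered (LinearMap.rTensor B J) (∑ i, x i ⊗ₜ[𝕜] Y i) n =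
      ∑ w : Fin n → ι, iteratedPath J (x ∘ w) ⊗ₜ (List.ofFn (Y ∘ w)).prod
  | 0 => by
    rw [Fintype.sum_subsingleton _ Fin.elim0]
    simp [pathOrdered, iteratedPath, Algebra.TensorProduct.one_def]
  | n + 1 => by
    rw [pathOrdered, pathOrdered_sum J x Y n, Finset.sum_mul_sum, map_sum]
    simp only [map_sum, Algebra.TensorProduct.tmul_mul_tmul, LinearMap.rTensor_tmul]
    rw [sum_words_succ]
    refine Finset.sum_congr rfl fun w _ => ?_
    rw [List.ofFn_succ_last, List.prod_append, List.prod_singleton]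
    rfl

theorem IsRotaBaxter.rTensor {J : S →ₗ[𝕜] S} (hJ : IsRotaBaxter J) (B : Type*) [Ring B]
    [Algebra 𝕜 B] : IsRotaBaxter (LinearMap.rTensor B J) := by
  intro x y
  induction x using TensorProduct.induction_on with
  | zero => simp
  | add x x' hx hx' =>
    simp only [map_add, add_mul, hx, hx']
    abel
  | tmul s u =>
    induction y using TensorProduct.induction_on with
    | zero => simp
    | add y y' hy hy' =>
      simp only [map_add, mul_add, hy, hy']
      abel
    | tmul t v =>
      simp only [LinearMap.rTensor_tmul, Algebra.TensorProduct.tmul_mul_tmul, hJ s t,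
        TensorProduct.add_tmul]

end IteratedPath

/-! ### Extraction of the multilinear part. -/

section TopPart

variable {𝕜 S : Type*} [Field 𝕜] [Ring S] [Algebra 𝕜 S] {n : ℕ}

/-- The coefficient of the set of all letters. -/
def topPart (𝕜 S : Type*) [Field 𝕜] [Ring S] [Algebra 𝕜 S] (n : ℕ) :
    S ⊗[𝕜] Module.End 𝕜 (Finset (Fin n) → 𝕜) →ₗ[𝕜] S :=
  (TensorProduct.rid 𝕜 S).toLinearMap ∘ₗ LinearMap.lTensor S (topCoeff 𝕜 n)

theorem topPart_tmul (x : S) (M : Module.End 𝕜 (Finset (Fin n) → 𝕜)) :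
    topPart 𝕜 S n (x ⊗ₜ M) = topCoeff 𝕜 n M • x := by
  simp [topPart]

/-- A word of length `n` that is not a permutation misses some letter and cannot reach the set of
all letters. -/
theorem topPart_sum_words (q : Fin n → ℤ) (F : (Fin n → Fin n) → S) :
    topPart 𝕜 S n (∑ w, F w ⊗ₜ (List.ofFn (creation 𝕜 q ∘ w)).prod) =
      ∑ τ : Equiv.Perm (Fin n), koszulSign q τ • F τ := by
  rw [map_sum]
  symm
  refine Fintype.sum_of_injective (fun τ : Equiv.Perm (Fin n) => (τ : Fin n → Fin n))
    DFunLike.coe_injective _ _ (fun w hw => ?_) fun τ => ?_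
  · rw [topPart_tmul, topCoeff_of_not_surjective, zero_smul]
    intro h
    exact hw ⟨Equiv.ofBijective w (Finite.surjective_iff_bijective.1 h), rfl⟩
  · rw [topPart_tmul, topCoeff_perm, smul_assoc, one_smul]

end TopPart

/-! ### Polarization: from one variable to several. -/

section WordTerm

variable {𝕜 E 𝓐 B ι : Type*} [Field 𝕜] [CharZero 𝕜] [AddCommGroup E] [Module 𝕜 E] [Ring 𝓐]
  [Algebra 𝕜 𝓐] [Ring B] [Algebra 𝕜 B] [Fintype ι]
  (b : E →ₗ[𝕜] E →ₗ[𝕜] E) (J : E →ₗ[𝕜] E) (deg : ℤ → Submodule 𝕜 E) (f : ℕ → E →ₗ[𝕜] 𝓐)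
  (JA : 𝓐 →ₗ[𝕜] 𝓐) (q : ι → ℤ) (l : ι → E) (m : ι → ℕ) (Y : ι → B)

/-- The sum of the Magnus terms of all words of length `k` in the letters `l i ⊗ Y i`. -/
def wordTerm (k : ℕ) : 𝓐 ⊗[𝕜] B :=
  ∑ w : Fin k → ι, ((k.factorial : 𝕜)⁻¹) •
    (f (∑ i, m (w i)) (magnusTerm b J k (q ∘ w) (l ∘ w)) ⊗ₜ (List.ofFn (Y ∘ w)).prod)

variable {b J deg f JA q l m Y}

theorem wordTerm_zero : wordTerm b J f q l m Y 0 = 0 := by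
  simp [wordTerm, magnusTerm_zero]

/-- Permuting a word also permutes the product of the `Y`, and the sign of that cancels the Koszul
sign. Each of the `k!` permutations then contributes the same sum over words. -/
theorem sum_koszulSign_smul_words {k : ℕ} (hY : ∀ i j, SignCommute (q i) (q j) (Y i) (Y j))
    (G : (Fin k → ι) → E) :
    ∑ w : Fin k → ι, f (∑ i, m (w i)) (∑ σ : Equiv.Perm (Fin k), koszulSign (q ∘ w) σ •
      G (w ∘ σ)) ⊗ₜ[𝕜] (List.ofFn (Y ∘ w)).prod =
    (k.factorial : 𝕜) • ∑ w : Fin k → ι, f (∑ i, m (w i)) (G w) ⊗ₜ (List.ofFn (Y ∘ w)).prod := by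
  have h1 : ∀ (w : Fin k → ι) (σ : Equiv.Perm (Fin k)),
      f (∑ i, m (w i)) (koszulSign (q ∘ w) σ • G (w ∘ σ)) ⊗ₜ[𝕜] (List.ofFn (Y ∘ w)).prod =
      f (∑ i, m ((w ∘ σ) i)) (G (w ∘ σ)) ⊗ₜ (List.ofFn (Y ∘ (w ∘ σ))).prod := by
    intro w σ
    have h2 : ∑ i, m ((w ∘ σ) i) = ∑ i, m (w i) := Equiv.sum_comp σ fun i => m (w i)
    rw [h2, ← Function.comp_assoc, prod_ofFn_perm (y := Y ∘ w) (q := q ∘ w) (fun i j => hY _ _),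
      LinearMap.map_smul_of_tower, TensorProduct.smul_tmul]
  simp only [map_sum, TensorProduct.sum_tmul, h1]
  rw [Finset.sum_comm]
  have h3 : ∀ σ : Equiv.Perm (Fin k), ∑ w : Fin k → ι,
      f (∑ i, m ((w ∘ σ) i)) (G (w ∘ σ)) ⊗ₜ[𝕜] (List.ofFn (Y ∘ (w ∘ σ))).prod =
      ∑ w : Fin k → ι, f (∑ i, m (w i)) (G w) ⊗ₜ (List.ofFn (Y ∘ w)).prod := fun σ =>
    Equiv.sum_comp (Equiv.arrowCongr σ.symm (Equiv.refl ι))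
      fun w => f (∑ i, m (w i)) (G w) ⊗ₜ[𝕜] (List.ofFn (Y ∘ w)).prod
  simp only [h3]
  rw [Finset.sum_const, Finset.card_univ, Fintype.card_perm, Fintype.card_fin,
    ← Nat.cast_smul_eq_nsmul 𝕜]

/-- The normalization `1 / k!` in `wordTerm` absorbs the sum over permutations, and those of the
blocks supply the factors `1 / i_j!` of `recursionCoeff`. What remains is the recursion of one
variable for the generic element `∑ f(l_i) ⊗ Y_i`. -/
theorem wordTerm_succ
    (hb : ∀ {i j x y}, x ∈ deg i → y ∈ deg j → b x y ∈ deg (i + j))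
    (hJ : ∀ {i x}, x ∈ deg i → J x ∈ deg i)
    (hf : ∀ {i i' x y} (m m' : ℕ), x ∈ deg i → y ∈ deg i' →
      f m x * f m' y - (i * i').negOnePow • (f m' y * f m x) = f (m + m') (b x y))
    (hJf : ∀ m x, f m (J x) = JA (f m x))
    (hl : ∀ i, l i ∈ deg (q i)) (hY : ∀ i j, SignCommute (q i) (q j) (Y i) (Y j)) (k : ℕ) :
    wordTerm b J f q l m Y (k + 1) = ∑ c : Composition k, (adCoeff c.length : 𝕜) •
      LinearMap.rTensor B JA (act (commutator 𝕜 (𝓐 ⊗[𝕜] B))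
        (fun j => wordTerm b J f q l m Y (c.blocksFun j)) (∑ i, f (m i) (l i) ⊗ₜ Y i)) := by
  have h1 : ∀ c : Composition k, LinearMap.rTensor B JA (act (commutator 𝕜 (𝓐 ⊗[𝕜] B))
        (fun j => wordTerm b J f q l m Y (c.blocksFun j)) (∑ i, f (m i) (l i) ⊗ₜ Y i)) =
      (∏ j, ((c.blocksFun j).factorial : 𝕜)⁻¹) • ∑ w : Fin (k + 1) → ι,
        f (∑ i, m (w i)) (magnusSummand b J c (q ∘ w) (l ∘ w)) ⊗ₜ (List.ofFn (Y ∘ w)).prod := by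
    intro c
    simp only [wordTerm]
    rw [act_sum_right]
    simp only [act_sum_blocks, act_smul_left]
    rw [Finset.sum_comm, sum_words_succ (fun (w : Fin k → ι) i =>
      (∏ j, ((c.blocksFun j).factorial : 𝕜)⁻¹) • act (commutator 𝕜 (𝓐 ⊗[𝕜] B)) (fun j =>
        f (∑ i, m ((w ∘ c.embedding j) i)) (magnusTerm b J (c.blocksFun j)
          (q ∘ w ∘ c.embedding j) (l ∘ w ∘ c.embedding j)) ⊗ₜ[𝕜]
          (List.ofFn (Y ∘ w ∘ c.embedding j)).prod) (f (m i) (l i) ⊗ₜ Y i)), ← Finset.smul_sum,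
      map_smul, map_sum]
    refine congrArg _ (Finset.sum_congr rfl fun w _ => ?_)
    have hmem : ∀ j, magnusTerm b J (c.blocksFun j) (fun i => q (w (c.embedding j i).castSucc))
        (fun i => l (w (c.embedding j i).castSucc)) ∈
        deg (∑ i : Fin (c.blocksFun j), q (w (c.embedding j i).castSucc)) := fun j =>
      magnusTerm_mem (deg := deg) hb hJ _ _ _ fun i => hl _
    have hact := act_commutator_tmul (B := B) hb hf hmem (hl (w (Fin.last k)))
      (fun j => ∑ i, m (w (c.embedding j i).castSucc)) (m (w (Fin.last k)))
      (V := fun j => (List.ofFn fun i => Y (w (c.embedding j i).castSucc)).prod)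
      (V' := Y (w (Fin.last k)))
      (fun j j' => SignCommute.prod_prod fun i i' => hY _ _)
      (fun j => SignCommute.prod_left fun i => hY _ _)
    refine (congrArg (LinearMap.rTensor B JA) hact).trans ?_
    rw [LinearMap.rTensor_tmul, ← hJf, c.sum_sum_apply_embedding (fun i => m (w i.castSucc)),
      ← Fin.sum_univ_castSucc (fun i => m (w i)), List.ofFn_succ_last, List.prod_append,
      List.prod_singleton, prod_ofFn_composition _ c]
    rfl
  simp only [h1]
  have h2 := fun c : Composition k => sum_koszulSign_smul_words (f := f) (m := m) hY
    (fun w : Fin (k + 1) → ι => magnusSummand b J c (q ∘ w) (l ∘ w))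
  have h3 : ((k + 1).factorial : 𝕜) ≠ 0 := Nat.cast_ne_zero.2 (Nat.factorial_ne_zero _)
  rw [wordTerm, ← Finset.smul_sum]
  have h4 : ∀ w : Fin (k + 1) → ι, f (∑ i, m (w i)) (magnusTerm b J (k + 1) (q ∘ w) (l ∘ w)) ⊗ₜ[𝕜]
      (List.ofFn (Y ∘ w)).prod = ∑ c : Composition k, (recursionCoeff c : 𝕜) •
        (f (∑ i, m (w i)) (∑ σ : Equiv.Perm (Fin (k + 1)), koszulSign (q ∘ w) σ •
          magnusSummand b J c (q ∘ (w ∘ σ)) (l ∘ (w ∘ σ))) ⊗ₜ[𝕜] (List.ofFn (Y ∘ w)).prod) := by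
    intro w
    rw [magnusTerm_succ, map_sum, TensorProduct.sum_tmul]
    refine Finset.sum_congr rfl fun c _ => ?_
    rw [map_smul, TensorProduct.smul_tmul']
    rfl
  simp only [h4]
  rw [Finset.sum_comm, Finset.smul_sum]
  refine Finset.sum_congr rfl fun c _ => ?_
  rw [← Finset.smul_sum, h2, smul_smul, smul_smul, smul_smul, mul_right_comm,
    inv_mul_cancel₀ h3, one_mul]
  congr 1
  rw [recursionCoeff, adCoeff_eq, Finset.prod_inv_distrib]
  push_cast
  rw [div_eq_mul_inv]

end WordTerm

/-- Apply the theorem of one variable to the generic element, with creation operators as auxiliary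
letters, and take the part that contains every letter. By graded symmetry the `n!` permuted copies
of `magnusTerm` agree, which cancels the factor `1 / n!`. -/
theorem magnusTerm_eq_log {𝕜 E 𝓐 : Type*} [Field 𝕜] [CharZero 𝕜] [AddCommGroup E] [Module 𝕜 E]
    [Ring 𝓐] [Algebra 𝕜 𝓐] {b : E →ₗ[𝕜] E →ₗ[𝕜] E} {J : E →ₗ[𝕜] E} {deg : ℤ → Submodule 𝕜 E}
    {f : ℕ → E →ₗ[𝕜] 𝓐} {JA : 𝓐 →ₗ[𝕜] 𝓐} (hJA : IsRotaBaxter JA)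
    (hb : ∀ {i j x y}, x ∈ deg i → y ∈ deg j → b x y ∈ deg (i + j))
    (hJ : ∀ {i x}, x ∈ deg i → J x ∈ deg i)
    (hf : ∀ {i i' x y} (m m' : ℕ), x ∈ deg i → y ∈ deg i' →
      f m x * f m' y - (i * i').negOnePow • (f m' y * f m x) = f (m + m') (b x y))
    (hJf : ∀ m x, f m (J x) = JA (f m x)) {n : ℕ} (q : Fin n → ℤ) (l : Fin n → E) (m : Fin n → ℕ)
    (hl : ∀ i, l i ∈ deg (q i)) :
    f (∑ i, m i) (magnusTerm b J n q l) = ∑ τ : Equiv.Perm (Fin n), koszulSign q τ •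
      ∑ c : Composition n, (logCoeff c.length : 𝕜) • (List.ofFn fun j =>
        iteratedPath JA fun i => f (m (τ (c.embedding j i))) (l (τ (c.embedding j i)))).prod := by
  have hn : (n.factorial : 𝕜) ≠ 0 := Nat.cast_ne_zero.2 (Nat.factorial_ne_zero _)
  have key := eq_sum_log_pathOrdered (a := ∑ i, f (m i) (l i) ⊗ₜ[𝕜] creation 𝕜 q i)
    (hJA.rTensor _) wordTerm_zero (wordTerm_succ (m := m) hb hJ hf hJf hl (creation_signCommute 𝕜 q)) n
  have key := congrArg (topPart 𝕜 𝓐 n) key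
  rw [wordTerm, ← Finset.smul_sum, map_smul, topPart_sum_words q (fun w =>
    f (∑ i, m (w i)) (magnusTerm b J n (q ∘ w) (l ∘ w)))] at key
  have h1 : ∀ τ : Equiv.Perm (Fin n), koszulSign q τ •
      f (∑ i, m (τ i)) (magnusTerm b J n (q ∘ τ) (l ∘ τ)) = f (∑ i, m i) (magnusTerm b J n q l) := by
    intro τ
    rw [magnusTerm_perm, LinearMap.map_smul_of_tower, smul_smul, Int.units_mul_self, one_smul,
      Equiv.sum_comp τ]
  simp only [h1] at key
  rw [Finset.sum_const, Finset.card_univ, Fintype.card_perm, Fintype.card_fin,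
    ← Nat.cast_smul_eq_nsmul 𝕜, smul_smul, inv_mul_cancel₀ hn, one_smul] at key
  rw [key, map_sum]
  simp only [Finset.smul_sum]
  rw [Finset.sum_comm]
  refine Finset.sum_congr rfl fun c _ => ?_
  simp only [pathOrdered_sum]
  rw [prod_ofFn_sum_blocks (𝕜 := 𝕜) c (fun j (w : Fin (c.blocksFun j) → Fin n) =>
    iteratedPath JA ((fun i => f (m i) (l i)) ∘ w) ⊗ₜ[𝕜] (List.ofFn (creation 𝕜 q ∘ w)).prod),
    map_smul]
  have h2 : ∀ w : Fin n → Fin n, (List.ofFn fun j : Fin c.length =>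
      iteratedPath JA ((fun i => f (m i) (l i)) ∘ w ∘ c.embedding j) ⊗ₜ[𝕜]
        (List.ofFn (creation 𝕜 q ∘ w ∘ c.embedding j)).prod).prod =
      (List.ofFn fun j : Fin c.length =>
        iteratedPath JA ((fun i => f (m i) (l i)) ∘ w ∘ c.embedding j)).prod ⊗ₜ
        (List.ofFn (creation 𝕜 q ∘ w)).prod := by
    intro w
    rw [prod_ofFn_composition (creation 𝕜 q ∘ w) c, ← prod_ofFn_tmul]
    rfl
  simp only [h2]
  rw [topPart_sum_words q (fun w => (List.ofFn fun j : Fin c.length =>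
        iteratedPath JA ((fun i => f (m i) (l i)) ∘ w ∘ c.embedding j)).prod), Finset.smul_sum]
  refine Finset.sum_congr rfl fun τ _ => ?_
  rw [smul_comm]
  rfl

/-! ### Functions with values in a dg Lie algebra. -/

section PureTensors

variable {𝕜 : Type*} [Field 𝕜]

/-- The logarithm of the path ordered exponential, in terms of iterated integrals. -/
def logIntegral {R : Type*} [CommRing R] [Algebra 𝕜 R] (J : R →ₗ[𝕜] R) {n : ℕ}
    (a : Fin n → R) : R :=
  ∑ c : Composition n, algebraMap 𝕜 R (logCoeff c.length : ℚ) *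
    ∏ j, iteratedPath J (a ∘ c.embedding j)

theorem iteratedPath_tmul {R A : Type*} [CommRing R] [Algebra 𝕜 R] [Ring A] [Algebra 𝕜 A]
    (J : R →ₗ[𝕜] R) : ∀ {n : ℕ} (a : Fin n → R) (x : Fin n → A),
    iteratedPath (LinearMap.rTensor A J) (fun i => a i ⊗ₜ[𝕜] x i) =
      iteratedPath J a ⊗ₜ (List.ofFn x).prod
  | 0, a, x => by simp [iteratedPath, Algebra.TensorProduct.one_def]
  | n + 1, a, x => by
    rw [iteratedPath, iteratedPath_tmul J (fun i => a i.castSucc), iteratedPath,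
      Algebra.TensorProduct.tmul_mul_tmul, LinearMap.rTensor_tmul, List.ofFn_succ_last,
      List.prod_append, List.prod_singleton]

variable {g : Type*} [AddCommGroup g] [Module 𝕜 g] (L : DGLieAlgebra 𝕜 g)
  (R : Type*) [CommRing R] [Algebra 𝕜 R]

/-- The bracket of `R ⊗ g` as a bilinear map. -/
def bracketExtLin : R ⊗[𝕜] g →ₗ[𝕜] R ⊗[𝕜] g →ₗ[𝕜] R ⊗[𝕜] g :=
  TensorProduct.map₂ (LinearMap.mul 𝕜 R) L.bracket

theorem bracketExtLin_tmul (a a' : R) (x x' : g) :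
    bracketExtLin L R (a ⊗ₜ x) (a' ⊗ₜ x') = (a * a') ⊗ₜ L.bracket x x' := by
  simp [bracketExtLin]

variable {L R}

theorem tmul_mem_degExt (a : R) {i : ℤ} {x : g} (hx : x ∈ L.deg i) :
    a ⊗ₜ x ∈ L.degExt R i :=
  ⟨a ⊗ₜ ⟨x, hx⟩, by simp⟩

theorem degExt_induction {i : ℤ} {motive : ∀ u : R ⊗[𝕜] g, u ∈ L.degExt R i → Prop}
    (zero : motive 0 (zero_mem _))
    (add : ∀ u v hu hv, motive u hu → motive v hv → motive (u + v) (add_mem hu hv))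
    (tmul : ∀ (a : R) (x : g) (hx : x ∈ L.deg i), motive (a ⊗ₜ x) (tmul_mem_degExt a hx))
    {u : R ⊗[𝕜] g} (hu : u ∈ L.degExt R i) : motive u hu := by
  have hu' := hu
  obtain ⟨u, rfl⟩ := hu'
  induction u using TensorProduct.induction_on with
  | zero => simpa using zero
  | add u v ihu ihv => simpa using add _ _ ⟨u, rfl⟩ ⟨v, rfl⟩ (ihu _) (ihv _)
  | tmul a x => simpa using tmul a x x.2

theorem bracketExtLin_mem {i j : ℤ} {u v : R ⊗[𝕜] g} (hu : u ∈ L.degExt R i)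
    (hv : v ∈ L.degExt R j) : bracketExtLin L R u v ∈ L.degExt R (i + j) := by
  induction hu using degExt_induction with
  | zero => simp
  | add u u' _ _ hu hu' => simpa using Submodule.add_mem _ hu hu'
  | tmul a x hx =>
    induction hv using degExt_induction with
    | zero => simp
    | add u u' _ _ hu hu' => simpa using Submodule.add_mem _ hu hu'
    | tmul a' x' hx' =>
      rw [bracketExtLin_tmul]
      exact tmul_mem_degExt _ (L.bracket_mem hx hx')

theorem rTensor_mem_degExt (J : R →ₗ[𝕜] R) {i : ℤ} {u : R ⊗[𝕜] g} (hu : u ∈ L.degExt R i) :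
    LinearMap.rTensor g J u ∈ L.degExt R i := by
  induction hu using degExt_induction with
  | zero => simp
  | add u u' _ _ hu hu' => simpa using Submodule.add_mem _ hu hu'
  | tmul a x hx => exact tmul_mem_degExt _ hx

/-- Linear maps `φ m` which intertwine the graded commutator with the bracket, adding weights. -/
def IsWeightedHom {A : Type*} [Ring A] [Algebra 𝕜 A] (L : DGLieAlgebra 𝕜 g)
    (φ : ℕ → g →ₗ[𝕜] A) : Prop :=
  ∀ {i i' x y} (m m' : ℕ), x ∈ L.deg i → y ∈ L.deg i' →
    φ m x * φ m' y - (i * i').negOnePow • (φ m' y * φ m x) = φ (m + m') (L.bracket x y)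

variable {A : Type*} [Ring A] [Algebra 𝕜 A] {φ : ℕ → g →ₗ[𝕜] A}

theorem IsWeightedHom.lTensor (hφ : IsWeightedHom L φ) {i i' : ℤ} {u v : R ⊗[𝕜] g} (m m' : ℕ)
    (hu : u ∈ L.degExt R i) (hv : v ∈ L.degExt R i') :
    LinearMap.lTensor R (φ m) u * LinearMap.lTensor R (φ m') v -
      (i * i').negOnePow • (LinearMap.lTensor R (φ m') v * LinearMap.lTensor R (φ m) u) =
      LinearMap.lTensor R (φ (m + m')) (bracketExtLin L R u v) := by
  induction hu using degExt_induction with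
  | zero => simp
  | add u u' _ _ hu hu' =>
    simp only [map_add, add_mul, mul_add, LinearMap.add_apply, ← hu, ← hu', smul_add]
    abel
  | tmul a x hx =>
    induction hv using degExt_induction with
    | zero => simp
    | add u u' _ _ hu hu' =>
      simp only [map_add, add_mul, mul_add, ← hu, ← hu', smul_add]
      abel
    | tmul a' x' hx' =>
      simp only [bracketExtLin_tmul, LinearMap.lTensor_tmul, Algebra.TensorProduct.tmul_mul_tmul,
        ← hφ m m' hx hx', TensorProduct.tmul_sub, TensorProduct.tmul_smul, mul_comm a' a]
      rfl

variable [CharZero 𝕜]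

/-- For every composition the blocks multiply to the same product in `A`, so the sum over
compositions takes place entirely in the factor `R`. -/
theorem lTensor_magnusTerm {J : R →ₗ[𝕜] R} (hJ : IsRotaBaxter J) (hφ : IsWeightedHom L φ) {n : ℕ}
    (q : Fin n → ℤ) (a : Fin n → R) (x : Fin n → g) (m : Fin n → ℕ) (hx : ∀ i, x i ∈ L.deg (q i)) :
    LinearMap.lTensor R (φ (∑ i, m i)) (magnusTerm (bracketExtLin L R) (LinearMap.rTensor g J) n q
      (fun i => a i ⊗ₜ x i)) = ∑ τ : Equiv.Perm (Fin n), koszulSign q τ •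
        (logIntegral J (a ∘ τ) ⊗ₜ (List.ofFn fun i => φ (m (τ i)) (x (τ i))).prod) := by
  rw [magnusTerm_eq_log (f := fun m => LinearMap.lTensor R (φ m)) (hJ.rTensor A)
    (deg := L.degExt R) bracketExtLin_mem (rTensor_mem_degExt J) hφ.lTensor
    (fun m u => by
      rw [← LinearMap.comp_apply, ← LinearMap.comp_apply, LinearMap.lTensor_comp_rTensor,
        LinearMap.rTensor_comp_lTensor]) q _ m (fun i => tmul_mem_degExt _ (hx i))]
  refine Finset.sum_congr rfl fun τ _ => ?_
  rw [logIntegral, TensorProduct.sum_tmul]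
  refine congrArg _ (Finset.sum_congr rfl fun c _ => ?_)
  simp only [LinearMap.lTensor_tmul]
  simp only [iteratedPath_tmul J (fun i => a (τ (c.embedding _ i)))
    (fun i => φ (m (τ (c.embedding _ i))) (x (τ (c.embedding _ i))))]
  rw [prod_ofFn_tmul, prod_ofFn_composition (fun i => φ (m (τ i)) (x (τ i))) c, List.prod_ofFn,
    ← Algebra.smul_def, TensorProduct.smul_tmul']
  rfl

end PureTensors

/-! ### Integration on a discrete interval. -/

/-- The coefficient of the word `τ` in the logarithm of a product of exponentials. -/
def wordCoeff {n : ℕ} (τ : Equiv.Perm (Fin n)) : ℚ :=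
  ∑ c : Composition n, if ∀ j, StrictMono (τ ∘ c.embedding j) then logCoeff c.length else 0

/-- Adjoin dual numbers `n` times; `t` reads off the coefficient of the product of all the
infinitesimals. -/
theorem exists_squareZeroAlgebra.{u} {𝕜 : Type u} [Field 𝕜] (n : ℕ) :
    ∃ (K : Type u) (_ : CommRing K) (_ : Algebra 𝕜 K) (e : Fin n → K) (t : K →ₗ[𝕜] 𝕜),
      (∀ i, e i * e i = 0) ∧ t (∏ i, e i) = 1 := by
  induction n with
  | zero => exact ⟨𝕜, inferInstance, inferInstance, Fin.elim0, LinearMap.id, fun i => i.elim0, by simp⟩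
  | succ n ih =>
    obtain ⟨K, _, _, e, t, he, ht⟩ := ih
    refine ⟨DualNumber K, inferInstance, inferInstance,
      Fin.cons DualNumber.eps fun i => TrivSqZeroExt.inl (e i),
      t ∘ₗ (TrivSqZeroExt.sndHom K K).restrictScalars 𝕜, fun i => ?_, ?_⟩
    · induction i using Fin.cases with
      | zero => simp
      | succ i => simp [← TrivSqZeroExt.inl_mul, he]
    · rw [Fin.prod_univ_succ]
      simp only [Fin.cons_zero, Fin.cons_succ]
      have h : ∏ i, (TrivSqZeroExt.inl (e i) : DualNumber K) = TrivSqZeroExt.inl (∏ i, e i) :=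
        (map_prod (TrivSqZeroExt.inlHom K K) e Finset.univ).symm
      rw [h]
      simpa using ht

section Discrete

variable {𝕜 K : Type*} [Field 𝕜] [CommRing K] [Algebra 𝕜 K] {n : ℕ} (e : Fin n → K)

variable (𝕜) in
/-- The integration of functions which are constant on `n` pieces. -/
def discreteIntegral : (Fin (n + 1) → K) →ₗ[𝕜] (Fin (n + 1) → K) where
  toFun f p := ∑ j : Fin n, if j.castSucc < p then e j * f j.castSucc else 0
  map_add' f f' := by
    ext p
    simp only [Pi.add_apply, ← Finset.sum_add_distrib]
    refine Finset.sum_congr rfl fun j _ => ?_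
    split_ifs
    · rw [mul_add]
    · rw [add_zero]
  map_smul' s f := by
    ext p
    simp only [Pi.smul_apply, RingHom.id_apply, Finset.smul_sum]
    refine Finset.sum_congr rfl fun j _ => ?_
    split_ifs
    · rw [mul_smul_comm]
    · rw [smul_zero]

theorem discreteIntegral_apply (f : Fin (n + 1) → K) (p : Fin (n + 1)) :
    discreteIntegral 𝕜 e f p = ∑ j : Fin n, if j.castSucc < p then e j * f j.castSucc else 0 := rfl

variable {e}

/-- The diagonal of the double sum is the only obstruction to weight zero, and its terms contain `e
i * e i = 0`. -/
theorem isRotaBaxter_discreteIntegral (he : ∀ i, e i * e i = 0) :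
    IsRotaBaxter (discreteIntegral 𝕜 e) := by
  intro f f'
  ext1 p
  simp only [Pi.mul_apply, Pi.add_apply, discreteIntegral_apply]
  set F : Fin n → K := fun j => if j.castSucc < p then e j * f j.castSucc else 0 with hF
  set G : Fin n → K := fun j => if j.castSucc < p then e j * f' j.castSucc else 0 with hG
  have h1 : ∀ j : Fin n, (if j.castSucc < p then e j * (f j.castSucc *
      ∑ i : Fin n, if i.castSucc < j.castSucc then e i * f' i.castSucc else 0) else 0) =
      ∑ i : Fin n, if i < j then F j * G i else 0 := by
    intro j
    by_cases hj : j.castSucc < p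
    · rw [if_pos hj, ← mul_assoc, Finset.mul_sum]
      refine Finset.sum_congr rfl fun i _ => ?_
      by_cases hi : i < j
      · have hi' := Fin.castSucc_lt_castSucc_iff.2 hi
        simp [hF, hG, hi, hj, hi'.trans hj]
      · simp [hi]
    · simp [hF, hj]
  have h2 : ∀ j : Fin n, (if j.castSucc < p then e j * ((
      ∑ i : Fin n, if i.castSucc < j.castSucc then e i * f i.castSucc else 0) * f' j.castSucc)
        else 0) = ∑ i : Fin n, if i < j then F i * G j else 0 := by
    intro j
    by_cases hj : j.castSucc < p
    · rw [if_pos hj, mul_left_comm, Finset.sum_mul]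
      refine Finset.sum_congr rfl fun i _ => ?_
      by_cases hi : i < j
      · have hi' := Fin.castSucc_lt_castSucc_iff.2 hi
        simp [hF, hG, hi, hj, hi'.trans hj]
      · simp [hi]
    · simp [hG, hj]
  simp only [h1, h2]
  change (∑ j, F j) * ∑ j, G j = _
  rw [Finset.sum_comm (f := fun j i => if i < j then F i * G j else 0), ← Finset.sum_add_distrib,
    Finset.sum_mul_sum]
  refine Finset.sum_congr rfl fun j _ => ?_
  rw [← Finset.sum_add_distrib]
  refine Finset.sum_congr rfl fun i _ => ?_
  rcases lt_trichotomy i j with h | rfl | h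
  · simp [h, h.not_gt]
  · have : F i * G i = 0 := by
      simp only [hF, hG]
      split_ifs
      · rw [mul_mul_mul_comm, he, zero_mul]
      · simp
    simp [this]
  · simp [h, h.not_gt]

variable (K) in
/-- The function which is equal to `1` on the piece `i` and vanishes elsewhere. -/
def indicatorPiece (i : Fin n) : Fin (n + 1) → K := Pi.single i.castSucc 1

theorem strictMono_fin_succ_iff {k : ℕ} {α : Type*} [Preorder α] (w : Fin (k + 1) → α) :
    StrictMono w ↔ StrictMono (fun i : Fin k => w i.castSucc) ∧
      ∀ i : Fin k, w i.castSucc < w (Fin.last k) := by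
  constructor
  · intro h
    exact ⟨fun i j hij => h (Fin.castSucc_lt_castSucc_iff.2 hij), fun i => h (Fin.castSucc_lt_last i)⟩
  · rintro ⟨h1, h2⟩ i j hij
    induction j using Fin.lastCases with
    | last =>
      induction i using Fin.lastCases with
      | last => exact absurd hij (lt_irrefl _)
      | cast i => exact h2 i
    | cast j =>
      induction i using Fin.lastCases with
      | last => exact absurd hij (Fin.castSucc_lt_last j).not_gt
      | cast i => exact h1 (Fin.castSucc_lt_castSucc_iff.1 hij)

/-- Each integration reaches only pieces strictly to the left, so the pieces must occur in
increasing order. -/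
theorem iteratedPath_indicatorPiece : ∀ {k : ℕ} (w : Fin k → Fin n) (p : Fin (n + 1)),
    iteratedPath (discreteIntegral 𝕜 e) (indicatorPiece K ∘ w) p =
      if StrictMono w ∧ ∀ i, (w i).castSucc < p then ∏ i, e (w i) else 0
  | 0, w, p => by
    rw [if_pos ⟨Subsingleton.strictMono w, fun i => i.elim0⟩]
    simp [iteratedPath]
  | k + 1, w, p => by
    have ih := iteratedPath_indicatorPiece (fun i : Fin k => w i.castSucc) (w (Fin.last k)).castSucc
    rw [iteratedPath, discreteIntegral_apply, Finset.sum_eq_single (w (Fin.last k))]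
    · simp only [Pi.mul_apply]
      change (if _ then _ * (iteratedPath (discreteIntegral 𝕜 e)
        (indicatorPiece K ∘ fun i => w i.castSucc) _ * _) else _) = _
      rw [ih, Function.comp_apply, indicatorPiece, Pi.single_eq_same, mul_one,
        Fin.prod_univ_castSucc]
      simp only [strictMono_fin_succ_iff w, Fin.forall_fin_succ', Fin.castSucc_lt_castSucc_iff]
      by_cases h1 : StrictMono fun i : Fin k => w i.castSucc
      swap
      · simp [h1]
      by_cases h2 : ∀ i : Fin k, w i.castSucc < w (Fin.last k)
      swap
      · simp [h2]
      by_cases h3 : (w (Fin.last k)).castSucc < p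
      swap
      · simp [h3]
      have h4 : ∀ i : Fin k, (w i.castSucc).castSucc < p := fun i =>
        (Fin.castSucc_lt_castSucc_iff.2 (h2 i)).trans h3
      simp only [h1, h2, h3, h4, implies_true, and_self, if_true]
      rw [mul_comm]
    · intro j _ hj
      have : indicatorPiece K (w (Fin.last k)) j.castSucc = 0 :=
        Pi.single_eq_of_ne (fun h => hj (Fin.castSucc_injective _ h)) _
      simp [this]
    · simp

/-- The value at the end. -/
def discreteEval (n : ℕ) (t : K →ₗ[𝕜] 𝕜) : (Fin (n + 1) → K) →ₗ[𝕜] 𝕜 :=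
  t ∘ₗ LinearMap.proj (Fin.last n)

/-- A block has a nonzero iterated integral only if `τ` increases along it. If this holds for all
blocks, the product of the integrals is `∏ e i`, on which `t` is one. -/
theorem discreteEval_logIntegral [CharZero 𝕜] {t : K →ₗ[𝕜] 𝕜} (ht : t (∏ i, e i) = 1)
    (τ : Equiv.Perm (Fin n)) :
    discreteEval n t (logIntegral (discreteIntegral 𝕜 e) (indicatorPiece K ∘ τ)) = wordCoeff τ := by
  have h : ∀ c : Composition n, (∏ j, iteratedPath (discreteIntegral 𝕜 e)
      ((indicatorPiece K ∘ τ) ∘ c.embedding j)) (Fin.last n) =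
      if ∀ j, StrictMono (τ ∘ c.embedding j) then ∏ i, e i else 0 := by
    intro c
    rw [Finset.prod_apply]
    simp only [Function.comp_assoc, iteratedPath_indicatorPiece, Fin.castSucc_lt_last,
      implies_true, and_true]
    rw [Fintype.prod_ite_zero]
    simp only [Function.comp_apply]
    rw [c.prod_prod_apply_embedding (fun i => e (τ i)),
      Equiv.prod_comp τ (fun i => e i)]
  rw [logIntegral, map_sum, wordCoeff, Rat.cast_sum]
  refine Finset.sum_congr rfl fun c _ => ?_
  rw [← Algebra.smul_def, map_smul, discreteEval, LinearMap.comp_apply, LinearMap.proj_apply, h]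
  split_ifs
  · rw [ht, smul_eq_mul, mul_one]
  · simp

end Discrete

/-! ### The Eulerian idempotent and Dynkin's operator. -/

section LieTerm

variable {𝕜 g : Type*} [Field 𝕜] [CharZero 𝕜] [AddCommGroup g] [Module 𝕜 g]
  {L : DGLieAlgebra 𝕜 g}

variable (L) in
/-- The logarithm of the product of exponentials of `n` elements, the part of degree one in each. -/
def discreteTerm {K : Type*} [CommRing K] [Algebra 𝕜 K] {n : ℕ} (e : Fin n → K) (t : K →ₗ[𝕜] 𝕜)
    (q : Fin n → ℤ) (x : Fin n → g) : g :=
  TensorProduct.lid 𝕜 g (LinearMap.rTensor g (discreteEval n t)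
    (magnusTerm (bracketExtLin L (Fin (n + 1) → K))
      (LinearMap.rTensor g (discreteIntegral 𝕜 e)) n q fun i => indicatorPiece K i ⊗ₜ x i))

/-- `discreteTerm` is built from brackets, so this exhibits the multilinear part of the logarithm of
a product of exponentials as the image of an element of `g`, without any use of the
Poincaré–Birkhoff–Witt theorem. -/
theorem IsWeightedHom.discreteTerm {A K : Type*} [Ring A] [Algebra 𝕜 A] {φ : ℕ → g →ₗ[𝕜] A}
    (hφ : IsWeightedHom L φ) [CommRing K] [Algebra 𝕜 K] {n : ℕ} {e : Fin n → K} {t : K →ₗ[𝕜] 𝕜}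
    (he : ∀ i, e i * e i = 0) (ht : t (∏ i, e i) = 1) (q : Fin n → ℤ) (x : Fin n → g)
    (m : Fin n → ℕ) (hx : ∀ i, x i ∈ L.deg (q i)) :
    φ (∑ i, m i) (discreteTerm L e t q x) = ∑ τ : Equiv.Perm (Fin n), koszulSign q τ •
      ((wordCoeff τ : 𝕜) • (List.ofFn fun i => φ (m (τ i)) (x (τ i))).prod) := by
  have h := lTensor_magnusTerm (isRotaBaxter_discreteIntegral he) hφ q (indicatorPiece K) x m hx
  have h := congrArg (fun u => TensorProduct.lid 𝕜 A (LinearMap.rTensor A (discreteEval n t) u)) h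
  have h0 : ∀ u, TensorProduct.lid 𝕜 A (LinearMap.rTensor A (discreteEval n t)
      (LinearMap.lTensor _ (φ (∑ i, m i)) u)) = φ (∑ i, m i)
      (TensorProduct.lid 𝕜 g (LinearMap.rTensor g (discreteEval n t) u)) := by
    intro u
    induction u using TensorProduct.induction_on with
    | zero => simp
    | add u v hu hv => simp only [map_add, hu, hv]
    | tmul a y => simp
  simp only [h0, map_sum] at h
  refine h.trans (Finset.sum_congr rfl fun τ _ => ?_)
  rw [LinearMap.map_smul_of_tower, ← LinearEquiv.coe_coe, LinearMap.map_smul_of_tower,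
    LinearEquiv.coe_coe, LinearMap.rTensor_tmul, TensorProduct.lid_tmul,
    discreteEval_logIntegral ht]

/-- The action of `g` on `𝕜 × g`, where an element of weight `m` sends `(1, 0)` to `m` times
itself. -/
def dynkinAction (L : DGLieAlgebra 𝕜 g) (m : ℕ) : g →ₗ[𝕜] Module.End 𝕜 (𝕜 × g) :=
  LinearMap.mk₂ 𝕜 (fun z p => ((0 : 𝕜), (p.1 * (m : 𝕜)) • z + L.bracket z p.2))
    (fun z z' p => by
      simp only [smul_add, map_add, LinearMap.add_apply, Prod.mk_add_mk, add_zero]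
      congr 1
      abel)
    (fun c z p => by
      simp [smul_comm c])
    (fun z p p' => by
      simp only [Prod.fst_add, Prod.snd_add, add_mul, add_smul, map_add, Prod.mk_add_mk, add_zero]
      congr 1
      abel)
    (fun c z p => by
      simp [mul_assoc, mul_smul])

theorem dynkinAction_apply (m : ℕ) (z : g) (p : 𝕜 × g) :
    dynkinAction L m z p = (0, (p.1 * (m : 𝕜)) • z + L.bracket z p.2) := rfl

/-- On `(1, 0)` skew symmetry gives `m' [x, y] + m [x, y]`, which is why weights add; on `g` this is
the Jacobi identity. -/
theorem isWeightedHom_dynkinAction : IsWeightedHom L (dynkinAction L) := by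
  intro i i' x y m m' hx hy
  refine LinearMap.ext fun p => ?_
  rw [LinearMap.sub_apply, LinearMap.smul_apply, Module.End.mul_apply, Module.End.mul_apply]
  simp only [dynkinAction_apply, zero_mul, zero_smul, zero_add, map_add, map_smul]
  have h1 := L.skew hx hy
  have h2 := L.jacobi p.2 hx hy
  refine Prod.ext ?_ ?_
  · simp
  · simp only [Prod.snd_sub, Prod.smul_snd, smul_add]
    rw [h2, smul_comm _ (p.1 * (m : 𝕜)), show (i * i').negOnePow • L.bracket y x =
      - L.bracket x y by rw [h1, neg_neg], smul_neg, Nat.cast_add, mul_add, add_smul]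
    abel

theorem prod_dynkinAction (m : ℕ) : ∀ {k : ℕ} (x : Fin (k + 1) → g),
    (List.ofFn fun i => dynkinAction L m (x i)).prod (1, 0) =
      (0, (m : 𝕜) • nestedBracket (fun x y => L.bracket x y) x)
  | 0, x => by simp [dynkinAction_apply, nestedBracket, nest]
  | k + 1, x => by
    rw [List.ofFn_succ, List.prod_cons, Module.End.mul_apply,
      prod_dynkinAction m (fun i => x i.succ), dynkinAction_apply]
    simp [nestedBracket, nest, List.ofFn_succ]

variable (L) in
/-- The image of a product of elements of `g` under the Eulerian idempotent. -/
def lieTerm : ∀ {n : ℕ}, (Fin n → ℤ) → (Fin n → g) → g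
  | 0, _, _ => 0
  | n + 1, q, x => ∑ τ : Equiv.Perm (Fin (n + 1)), koszulSign q τ •
      ((wordCoeff τ / ((n : ℚ) + 1) : ℚ) : 𝕜) • nestedBracket (fun x y => L.bracket x y) (x ∘ τ)

/-- The argument of Dynkin, Specht and Wever: at `(1, 0)` an element of weight `n` acts as `n` times
itself, whereas a product of letters of weight one acts as a nested bracket. The result no longer
involves `K`, `e` and `t`. -/
theorem discreteTerm_eq_lieTerm {K : Type*} [CommRing K] [Algebra 𝕜 K] {n : ℕ} {e : Fin n → K}
    {t : K →ₗ[𝕜] 𝕜} (he : ∀ i, e i * e i = 0) (ht : t (∏ i, e i) = 1) (q : Fin n → ℤ)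
    (x : Fin n → g) (hx : ∀ i, x i ∈ L.deg (q i)) : discreteTerm L e t q x = lieTerm L q x := by
  cases n with
  | zero => simp [discreteTerm, magnusTerm_zero, lieTerm]
  | succ n =>
    have h := isWeightedHom_dynkinAction.discreteTerm he ht q x (fun _ => 1) hx
    have h := congrArg (fun T : Module.End 𝕜 (𝕜 × g) => (T (1, 0)).2) h
    have h1 : ∀ τ : Equiv.Perm (Fin (n + 1)),
        (List.ofFn fun i => dynkinAction L 1 (x (τ i))).prod (1, 0) =
        (0, nestedBracket (fun x y => L.bracket x y) (x ∘ τ)) := fun τ => by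
      simpa using prod_dynkinAction 1 (x ∘ τ)
    have h2 : ((n : 𝕜) + 1) ≠ 0 := by exact_mod_cast n.succ_ne_zero
    simp only [LinearMap.sum_apply, LinearMap.smul_apply, Prod.snd_sum, Prod.smul_snd, h1,
      dynkinAction_apply, map_zero, add_zero, one_mul, Finset.sum_const, Finset.card_univ,
      Fintype.card_fin, smul_eq_mul, mul_one] at h
    rw [lieTerm, ← inv_smul_smul₀ h2 (discreteTerm L e t q x)]
    push_cast at h
    rw [h, Finset.smul_sum]
    refine Finset.sum_congr rfl fun τ _ => ?_
    rw [smul_comm, smul_smul]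
    congr 2
    push_cast
    rw [div_eq_inv_mul]

theorem IsWeightedHom.lieTerm {A : Type*} [Ring A] [Algebra 𝕜 A] {φ : ℕ → g →ₗ[𝕜] A}
    (hφ : IsWeightedHom L φ) {n : ℕ} (q : Fin n → ℤ) (x : Fin n → g) (m : Fin n → ℕ)
    (hx : ∀ i, x i ∈ L.deg (q i)) :
    φ (∑ i, m i) (lieTerm L q x) = ∑ τ : Equiv.Perm (Fin n), koszulSign q τ •
      ((wordCoeff τ : 𝕜) • (List.ofFn fun i => φ (m (τ i)) (x (τ i))).prod) := by
  obtain ⟨K, _, _, e, t, he, ht⟩ := exists_squareZeroAlgebra (𝕜 := 𝕜) n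
  rw [← discreteTerm_eq_lieTerm he ht q x hx, hφ.discreteTerm he ht q x m hx]

end LieTerm

/-! ### Labelled words and the convolution logarithm. -/

section Labelings

theorem card_filter_index {n : ℕ} (c : Composition n) (j : Fin c.length) :
    (Finset.univ.filter fun i => c.index i = j).card = c.blocksFun j := by
  have : (Finset.univ.filter fun i => c.index i = j) =
      Finset.univ.map (c.embedding j).toEmbedding := by
    ext i
    simp only [Finset.mem_filter, Finset.mem_univ, true_and, Finset.mem_map]
    exact eq_comm.trans (c.mem_range_embedding_iff'.symm)
  rw [this, Finset.card_map, Finset.card_univ, Fintype.card_fin]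

/-- The composition given by the cardinalities of the fibres of a surjective labeling. -/
def fiberComposition {n k : ℕ} (f : Fin n → Fin k) (hf : Function.Surjective f) :
    Composition n where
  blocks := List.ofFn fun j => (Finset.univ.filter fun i => f i = j).card
  blocks_pos := by
    intro i hi
    obtain ⟨j, rfl⟩ := (List.mem_ofFn' _ _).1 hi
    obtain ⟨i, hi⟩ := hf j
    exact Finset.card_pos.2 ⟨i, by simpa using hi⟩
  blocks_sum := by
    rw [List.sum_ofFn, ← Finset.card_eq_sum_card_fiberwise (fun _ _ => Finset.mem_coe.2
      (Finset.mem_univ _)), Finset.card_univ, Fintype.card_fin]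

theorem fiberComposition_length {n k : ℕ} (f : Fin n → Fin k) (hf : Function.Surjective f) :
    (fiberComposition f hf).length = k := by
  simp [Composition.length, fiberComposition]

theorem fiberComposition_sizeUpTo {n k : ℕ} (f : Fin n → Fin k) (hf : Function.Surjective f)
    (j : ℕ) : (fiberComposition f hf).sizeUpTo j =
      (Finset.univ.filter fun i => (f i : ℕ) < j).card := by
  rw [Composition.sizeUpTo, fiberComposition, List.sum_take_ofFn,
    Finset.card_eq_sum_card_fiberwise (f := f)
      (t := Finset.univ.filter fun j' : Fin k => (j' : ℕ) < j)]
  · refine Finset.sum_congr rfl fun j' hj' => ?_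
    have hj' : (j' : ℕ) < j := by simpa using hj'
    congr 1
    ext i
    simp only [Finset.mem_filter, Finset.mem_univ, true_and]
    exact ⟨fun h => ⟨h ▸ hj', h⟩, fun h => h.2⟩
  · intro i hi
    simpa using hi

theorem fiberComposition_index {n k : ℕ} (f : Fin n → Fin k) (hf : Function.Surjective f)
    (hm : Monotone f) (i : Fin n) : ((fiberComposition f hf).index i : ℕ) = f i := by
  have h : (⟨f i, by rw [fiberComposition_length]; exact (f i).2⟩ :
      Fin (fiberComposition f hf).length) = (fiberComposition f hf).index i := by
    rw [← Composition.mem_range_embedding_iff', Composition.mem_range_embedding_iff]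
    simp only [fiberComposition_sizeUpTo]
    constructor
    · calc _ ≤ (Finset.Iio i).card := Finset.card_le_card fun i' hi' => by
            simp only [Finset.mem_filter, Finset.mem_univ, true_and, Finset.mem_Iio] at hi' ⊢
            by_contra h
            exact (hm (not_lt.1 h)).not_gt hi'
        _ = i := by simp
    · calc (i : ℕ) < (Finset.Iic i).card := by simp
        _ ≤ _ := Finset.card_le_card fun i' hi' => by
            simp only [Finset.mem_filter, Finset.mem_univ, true_and, Finset.mem_Iic] at hi' ⊢
            exact Nat.lt_succ_of_le (hm hi')
  rw [← h]

theorem index_monotone {n : ℕ} (c : Composition n) : Monotone c.index := by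
  intro i j hij
  by_contra h
  have h : (c.index j : ℕ) + 1 ≤ c.index i := not_le.1 h
  have h1 : (j : ℕ) < c.sizeUpTo (c.index j + 1) := c.lt_sizeUpTo_index_succ j
  have h2 := c.sizeUpTo_index_le i
  have h3 := c.monotone_sizeUpTo h
  have hij : (i : ℕ) ≤ j := hij
  omega

/-- Give the letter `τ i` the index of the block of `i` as its label. `Tuple.sort` is stable: equal
labels keep their order. Hence `τ` is the sorting permutation exactly when it increases inside each
block. -/
theorem strictMono_blocks_iff {n : ℕ} (c : Composition n) (τ : Equiv.Perm (Fin n)) :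
    (∀ j, StrictMono (τ ∘ c.embedding j)) ↔ Tuple.sort (c.index ∘ τ.symm) = τ := by
  rw [eq_comm, Tuple.eq_sort_iff]
  simp only [Function.comp_apply, Equiv.symm_apply_apply]
  constructor
  · intro h
    refine ⟨?_, fun i j hij hc => ?_⟩
    · intro i j hij
      simpa using index_monotone c hij
    · obtain ⟨i', hi'⟩ := c.mem_range_embedding i
      obtain ⟨j', hj'⟩ : j ∈ Set.range (c.embedding (c.index i)) :=
        c.mem_range_embedding_iff'.2 hc
      rw [← hi', ← hj']
      refine h (c.index i) ?_
      rw [← hi', ← hj'] at hij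
      exact (c.embedding _).lt_iff_lt.1 hij
  · rintro ⟨-, h⟩ j i i' hii'
    exact h _ _ ((c.embedding j).lt_iff_lt.2 hii') (by rw [c.index_embedding, c.index_embedding])

/-- A composition with `τ` increasing on its blocks is the same as a surjective labelling whose
stable sort is `τ`; the inverse takes the sizes of the fibres, `fiberComposition`. -/
theorem sum_composition_strictMono {M : Type*} [AddCommMonoid M] {n N : ℕ} (hN : n ≤ N)
    (τ : Equiv.Perm (Fin n)) (F : ℕ → M) :
    ∑ c : Composition n, (if ∀ j, StrictMono (τ ∘ c.embedding j) then F c.length else 0) =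
      ∑ k ∈ Finset.range (N + 1), ∑ f : Fin n → Fin k,
        if Function.Surjective f ∧ Tuple.sort f = τ then F k else 0 := by
  classical
  simp only [← Finset.sum_filter]
  rw [Finset.sum_sigma']
  have hext : ∀ {k k' : ℕ} (f : Fin n → Fin k) (f' : Fin n → Fin k'), k = k' →
      (∀ i, (f i : ℕ) = f' i) → (⟨k, f⟩ : Σ k, Fin n → Fin k) = ⟨k', f'⟩ := by
    rintro k _ f f' rfl h
    rw [show f = f' from funext fun i => Fin.ext (h i)]
  refine Finset.sum_bij (fun c _ => ⟨c.length, c.index ∘ τ.symm⟩) ?_ ?_ ?_ ?_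
  · intro c hc
    have hc := (Finset.mem_filter.1 hc).2
    simp only [Finset.mem_sigma, Finset.mem_range, Finset.mem_filter, Finset.mem_univ, true_and]
    refine ⟨by have := c.length_le; omega, ?_, (strictMono_blocks_iff c τ).1 hc⟩
    refine Function.Surjective.comp (fun j => ?_) τ.symm.surjective
    exact ⟨c.embedding j ⟨0, c.one_le_blocksFun j⟩, c.index_embedding _ _⟩
  · intro c _ c' _ h
    have h := congrArg (fun x : Σ k, Fin n → Fin k =>
      List.ofFn fun j => (Finset.univ.filter fun i => x.2 (τ i) = j).card) h
    simp only [Function.comp_apply, Equiv.symm_apply_apply, card_filter_index,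
      Composition.ofFn_blocksFun] at h
    exact Composition.ext h
  · rintro ⟨k, f⟩ hf
    simp only [Finset.mem_sigma, Finset.mem_range, Finset.mem_filter, Finset.mem_univ,
      true_and] at hf
    obtain ⟨-, hf, hτ⟩ := hf
    have hm : Monotone (f ∘ τ) := hτ ▸ Tuple.monotone_sort f
    have hs : Function.Surjective (f ∘ τ) := hf.comp τ.surjective
    have he : (⟨(fiberComposition (f ∘ τ) hs).length,
        (fiberComposition (f ∘ τ) hs).index ∘ τ.symm⟩ : Σ k, Fin n → Fin k) = ⟨k, f⟩ :=
      hext _ _ (fiberComposition_length _ _) fun i => by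
        rw [Function.comp_apply, fiberComposition_index _ _ hm]
        simp
    refine ⟨fiberComposition (f ∘ τ) hs, ?_, he⟩
    rw [Finset.mem_filter, strictMono_blocks_iff]
    refine ⟨Finset.mem_univ _, ?_⟩
    have : Tuple.sort (⟨k, f⟩ : Σ k, Fin n → Fin k).2 = τ := hτ
    rw [← he] at this
    exact this
  · intros
    rfl

/-- The letters of a labeled word, sorted according to their labels. -/
theorem flatten_filter_eq_sort {n k : ℕ} (f : Fin n → Fin k) :
    ((List.finRange k).flatMap fun j => (List.finRange n).filter fun i => f i = j) =
      List.ofFn (Tuple.sort f) := by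
  have hs := (Tuple.eq_sort_iff (f := f) (σ := Tuple.sort f)).1 rfl
  let r : Fin n → Fin n → Prop := fun a b => f a < f b ∨ (f a = f b ∧ a < b)
  have h1 : ((List.finRange k).flatMap fun j =>
      (List.finRange n).filter fun i => f i = j).Pairwise r := by
    rw [List.pairwise_flatMap]
    constructor
    · intro j _
      refine (List.pairwise_filter.2 ((List.pairwise_lt_finRange n).imp ?_))
      intro a b hab ha hb
      simp only [decide_eq_true_eq] at ha hb
      exact Or.inr ⟨ha.trans hb.symm, hab⟩
    · refine (List.pairwise_lt_finRange k).imp fun {j j'} hjj' a ha b hb => Or.inl ?_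
      simp only [List.mem_filter, decide_eq_true_eq] at ha hb
      rw [ha.2, hb.2]
      exact hjj'
  have h2 : (List.ofFn (Tuple.sort f)).Pairwise r := by
    rw [List.ofFn_eq_map, List.pairwise_map]
    refine (List.pairwise_lt_finRange n).imp fun {a b} hab => ?_
    rcases (hs.1 hab.le).lt_or_eq with h | h
    · exact Or.inl h
    · exact Or.inr ⟨h, hs.2 _ _ hab h⟩
  have hirr : ∀ a b, r a b → r b a → a = b := by
    rintro a b (h | h) (h' | h')
    · exact absurd h h'.not_gt
    · exact absurd h h'.1.not_gt
    · exact absurd h' h.1.not_gt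
    · exact absurd h.2 h'.2.not_gt
  refine List.Perm.eq_of_pairwise (fun a b _ _ => hirr a b) h1 h2 ?_
  have hne : ∀ {a b : Fin n}, r a b → a ≠ b := by
    rintro a _ h rfl
    rcases h with h | h
    · exact lt_irrefl _ h
    · exact lt_irrefl _ h.2
  refine List.perm_of_nodup_nodup_toFinset_eq (h1.imp hne) (h2.imp hne) ?_
  ext i
  simp only [List.mem_toFinset, List.mem_flatMap, List.mem_finRange, List.mem_filter, true_and,
    decide_eq_true_eq, exists_eq', true_iff]
  exact (List.mem_ofFn' _ _).2 ⟨(Tuple.sort f).symm i, by simp⟩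

/-- The sum over all labelings of the letters of a word. -/
def labelSum {α M : Type*} [AddCommMonoid M] (k : ℕ) : List α → (List (Fin k × α) → M) → M
  | [], G => G []
  | x :: l, G => ∑ a, labelSum k l fun L => G ((a, x) :: L)

variable {α M : Type*}

theorem labelSum_append [AddCommMonoid M] {k : ℕ} (l₁ l₂ : List α) (G : List (Fin k × α) → M) :
    labelSum k (l₁ ++ l₂) G = labelSum k l₁ fun L₁ => labelSum k l₂ fun L₂ => G (L₁ ++ L₂) := by
  induction l₁ generalizing G with
  | nil => rfl
  | cons x l ih => simp only [List.cons_append, labelSum, ih]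

theorem labelSum_sub [AddCommGroup M] {k : ℕ} (l : List α) (G G' : List (Fin k × α) → M) :
    labelSum k l (fun L => G L - G' L) = labelSum k l G - labelSum k l G' := by
  induction l generalizing G G' with
  | nil => rfl
  | cons x l ih => simp only [labelSum, ih, Finset.sum_sub_distrib]

theorem labelSum_ofFn [AddCommMonoid M] {k : ℕ} : ∀ {n : ℕ} (y : Fin n → α)
    (G : List (Fin k × α) → M), labelSum k (List.ofFn y) G =
      ∑ f : Fin n → Fin k, G (List.ofFn fun i => (f i, y i))
  | 0, y, G => by
    rw [Fintype.sum_subsingleton _ Fin.elim0]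
    simp [labelSum]
  | n + 1, y, G => by
    rw [List.ofFn_succ, labelSum, ← Equiv.sum_comp (Fin.consEquiv fun _ => Fin k),
      Fintype.sum_prod_type]
    refine Finset.sum_congr rfl fun a _ => ?_
    rw [labelSum_ofFn]
    refine Finset.sum_congr rfl fun f _ => ?_
    rw [List.ofFn_succ]
    rfl

section SlotProduct

variable {A : Type*} [Ring A]

/-- The product of the letters with the label `j`. -/
def slot {k : ℕ} (L : List (Fin k × A)) (j : Fin k) : A :=
  ((L.filter fun p => p.1 = j).map Prod.snd).prod

theorem slot_append {k : ℕ} (L₁ L₂ : List (Fin k × A)) (j : Fin k) :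
    slot (L₁ ++ L₂) j = slot L₁ j * slot L₂ j := by
  simp [slot]

theorem slot_cons {k : ℕ} (a : Fin k) (x : A) (L : List (Fin k × A)) (j : Fin k) :
    slot ((a, x) :: L) j = (if a = j then x else 1) * slot L j := by
  by_cases h : a = j <;> simp [slot, h]

open Classical in
/-- The product of all slots, provided that all labels occur. -/
def slotProd {k : ℕ} (L : List (Fin k × A)) : A :=
  if ∀ j : Fin k, ∃ p ∈ L, p.1 = j then (List.ofFn (slot L)).prod else 0

/-- Letters with different labels lie in different slots, so their relative order is invisible. -/
theorem slotProd_swap {k : ℕ} {a b : Fin k} (h : a ≠ b) (x y : A) (L₁ L₂ : List (Fin k × A)) :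
    slotProd (L₁ ++ (a, x) :: (b, y) :: L₂) = slotProd (L₁ ++ (b, y) :: (a, x) :: L₂) := by
  have h1 : slot (L₁ ++ (a, x) :: (b, y) :: L₂) = slot (L₁ ++ (b, y) :: (a, x) :: L₂) := by
    funext j
    simp only [slot_append, slot_cons]
    by_cases ha : a = j
    · have hb : b ≠ j := fun hb => h (ha.trans hb.symm)
      simp [ha, hb]
    · simp [ha]
  rw [slotProd, slotProd, h1]
  congr 1
  simp only [List.mem_append, List.mem_cons, eq_iff_iff]
  refine forall_congr' fun j => exists_congr fun p => ?_
  tauto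

/-- Letters with the same label become neighbours in one slot, in which the product is linear.
Merging them removes no label, so the condition that all labels occur is the same for the three
words. -/
theorem slotProd_commutator {k : ℕ} (a : Fin k) (x y : A) (L₁ L₂ : List (Fin k × A)) :
    slotProd (L₁ ++ (a, x) :: (a, y) :: L₂) - slotProd (L₁ ++ (a, y) :: (a, x) :: L₂) =
      slotProd (L₁ ++ (a, x * y - y * x) :: L₂) := by
  have h1 : ∀ z, slot (L₁ ++ (a, z) :: L₂) =
      Function.update (slot (L₁ ++ L₂)) a (slot L₁ a * z * slot L₂ a) := by
    intro z
    funext j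
    by_cases h : a = j
    · subst h
      simp [slot_append, slot_cons, mul_assoc]
    · rw [Function.update_of_ne (Ne.symm h)]
      simp [slot_append, slot_cons, h]
  have h2 : ∀ z w, slot (L₁ ++ (a, z) :: (a, w) :: L₂) = slot (L₁ ++ (a, z * w) :: L₂) := by
    intro z w
    funext j
    by_cases h : a = j <;> simp [slot_append, slot_cons, h, mul_assoc]
  have h3 : ∀ z w, (∀ j : Fin k, ∃ p ∈ L₁ ++ (a, z) :: (a, w) :: L₂, p.1 = j) ↔
      ∀ j : Fin k, ∃ p ∈ L₁ ++ (a, x * y - y * x) :: L₂, p.1 = j := by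
    intro z w
    simp [or_and_right, exists_or]
  simp only [slotProd, h3, h2]
  split_ifs with hc
  · have := (MultilinearMap.mkPiAlgebraFin ℤ k A).map_update_sub (slot (L₁ ++ L₂)) a
      (slot L₁ a * (x * y) * slot L₂ a) (slot L₁ a * (y * x) * slot L₂ a)
    simp only [MultilinearMap.mkPiAlgebraFin_apply] at this
    rw [h1, h1, h1, ← this, mul_sub, sub_mul]
  · rw [sub_zero]

/-- Labels play the role of an iterated coproduct for which commutators are primitive: terms with
two different labels cancel, and those with equal labels form the commutator. -/
theorem labelSum_commutator {k : ℕ} (x y : A) (l₁ l₂ : List A) :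
    labelSum k (l₁ ++ x :: y :: l₂) slotProd - labelSum k (l₁ ++ y :: x :: l₂) slotProd =
      labelSum k (l₁ ++ (x * y - y * x) :: l₂) slotProd := by
  simp only [labelSum_append, ← labelSum_sub]
  congr 1
  funext L₁
  simp only [labelSum]
  rw [Finset.sum_comm (f := fun a b => labelSum k l₂ fun L₂ =>
    slotProd (L₁ ++ (a, y) :: (b, x) :: L₂)), ← Finset.sum_sub_distrib]
  refine Finset.sum_congr rfl fun a _ => ?_
  rw [← Finset.sum_sub_distrib, Finset.sum_eq_single a]
  · rw [← labelSum_sub]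
    simp only [slotProd_commutator]
  · intro b _ hb
    simp only [slotProd_swap hb.symm, sub_self]
  · simp

theorem slotProd_ofFn {n k : ℕ} (f : Fin n → Fin k) (y : Fin n → A) [Decidable (Function.Surjective f)] :
    slotProd (List.ofFn fun i => (f i, y i)) =
      if Function.Surjective f then (List.ofFn (y ∘ Tuple.sort f)).prod else 0 := by
  have h1 : (∀ j : Fin k, ∃ p ∈ List.ofFn fun i => (f i, y i), p.1 = j) ↔
      Function.Surjective f := by
    refine forall_congr' fun j => ?_
    simp [List.mem_ofFn']
  have h2 : (List.ofFn (slot (List.ofFn fun i => (f i, y i)))).prod =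
      (List.ofFn (y ∘ Tuple.sort f)).prod := by
    rw [← List.map_ofFn, ← flatten_filter_eq_sort, List.map_flatMap, List.flatMap_def,
      List.prod_flatten, List.map_map, List.ofFn_eq_map]
    congr 2
    funext j
    rw [slot, List.ofFn_eq_map, List.filter_map, List.map_map]
    rfl
  rw [slotProd, h2]
  by_cases h : Function.Surjective f
  · rw [if_pos h, if_pos (h1.2 h)]
  · rw [if_neg h, if_neg (mt h1.1 h)]

/-- In the form with labels the letters stay in their places, so a relation can be applied inside a
word. The common bound `N` allows words of lengths `n` and `n - 1` to be compared. -/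
theorem sum_wordCoeff_smul {𝕜 : Type*} [Field 𝕜] [CharZero 𝕜] [Algebra 𝕜 A] {n N : ℕ} (hN : n ≤ N)
    (y : Fin n → A) :
    ∑ τ : Equiv.Perm (Fin n), (wordCoeff τ : 𝕜) • (List.ofFn (y ∘ τ)).prod =
      ∑ k ∈ Finset.range (N + 1), (logCoeff k : 𝕜) • labelSum k (List.ofFn y) slotProd := by
  classical
  simp only [labelSum_ofFn, slotProd_ofFn, wordCoeff]
  simp only [fun τ => sum_composition_strictMono hN τ logCoeff, Rat.cast_sum, Finset.sum_smul]
  rw [Finset.sum_comm]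
  refine Finset.sum_congr rfl fun k _ => ?_
  rw [Finset.sum_comm, Finset.smul_sum]
  refine Finset.sum_congr rfl fun f _ => ?_
  by_cases h : Function.Surjective f
  · simp [h, apply_ite, ite_smul]
  · simp [h]

end SlotProduct

end Labelings

/-! ### Compatibility with the relations of the enveloping algebra. -/

section LieList

variable {𝕜 g : Type*} [Field 𝕜] [AddCommGroup g] [Module 𝕜 g] [CharZero 𝕜] {L : DGLieAlgebra 𝕜 g}

variable (L) in
/-- `lieTerm` for a list of letters with their degrees. -/
def lieList (l : List (ℤ × g)) : g :=
  lieTerm L (fun i : Fin l.length => (l.get i).1) fun i => (l.get i).2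

theorem lieList_ofFn {n : ℕ} (q : Fin n → ℤ) (x : Fin n → g) :
    lieList L (List.ofFn fun i => (q i, x i)) = lieTerm L q x := by
  have h : ∀ (l : List (ℤ × g)) (h : l.length = n), lieList L l =
      lieTerm L (fun i => (l.get (Fin.cast h.symm i)).1) fun i => (l.get (Fin.cast h.symm i)).2 := by
    rintro l rfl
    rfl
  rw [h _ (List.length_ofFn)]
  simp

variable {B : Type*} [Ring B] [Algebra 𝕜 B]

/-- Reordering the factors in `B` produces exactly the Koszul signs of `lieTerm`, so that no signs
are left in `A ⊗ B`. -/
theorem IsWeightedHom.lieList_tmul {A : Type*} [Ring A] [Algebra 𝕜 A] {φ : ℕ → g →ₗ[𝕜] A}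
    (hφ : IsWeightedHom L φ) {N : ℕ} (l : List ((ℤ × g) × ℕ × B)) (hN : l.length ≤ N)
    (hl : ∀ a ∈ l, a.1.2 ∈ L.deg a.1.1)
    (hs : ∀ a ∈ l, ∀ b ∈ l, SignCommute a.1.1 b.1.1 a.2.2 b.2.2) :
    φ (l.map fun a => a.2.1).sum (lieList L (l.map Prod.fst)) ⊗ₜ[𝕜] (l.map fun a => a.2.2).prod =
      ∑ k ∈ Finset.range (N + 1), (logCoeff k : 𝕜) •
        labelSum k (l.map fun a => φ a.2.1 a.1.2 ⊗ₜ[𝕜] a.2.2) slotProd := by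
  obtain ⟨n, a, rfl⟩ : ∃ (n : ℕ) (a : Fin n → (ℤ × g) × ℕ × B), l = List.ofFn a :=
    ⟨l.length, l.get, (List.ofFn_get l).symm⟩
  simp only [List.map_ofFn, List.length_ofFn] at hN ⊢
  have h1 : (Prod.fst ∘ a) = fun i => ((a i).1.1, (a i).1.2) := rfl
  rw [h1, lieList_ofFn, List.sum_ofFn]
  simp only [Function.comp_apply]
  rw [hφ.lieTerm _ _ (fun i => (a i).2.1) fun i => hl _ (by simp), TensorProduct.sum_tmul,
    ← sum_wordCoeff_smul hN]
  refine Finset.sum_congr rfl fun τ _ => ?_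
  have h2 := prod_ofFn_perm (q := fun i => (a i).1.1) (y := fun i => (a i).2.2)
    (fun i j => hs _ (by simp) _ (by simp)) τ
  have h3 := prod_ofFn_tmul (𝕜 := 𝕜) (fun i => φ (a (τ i)).2.1 (a (τ i)).1.2)
    ((fun i => (a i).2.2) ∘ τ)
  have h4 : ((fun b : (ℤ × g) × ℕ × B => φ b.2.1 b.1.2 ⊗ₜ[𝕜] b.2.2) ∘ a) ∘ τ =
      fun i => φ (a (τ i)).2.1 (a (τ i)).1.2 ⊗ₜ[𝕜] ((fun i => (a i).2.2) ∘ τ) i := rfl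
  rw [h4, h3, h2, TensorProduct.tmul_smul, smul_comm]
  rfl

/-- Creation operators absorb the signs, and `labelSum_commutator` gives the relation in `End(𝕜 × g)
⊗ B`. With weight two for the letter `[x, y]` all three words have total weight `n`. At `(1, 0)`
each of them gives `n` times its `lieList`, and `n ≠ 0` cancels. -/
theorem lieList_commutator {i j : ℤ} {x y : g} (hx : x ∈ L.deg i) (hy : y ∈ L.deg j)
    (l₁ l₂ : List (ℤ × g)) (h₁ : ∀ a ∈ l₁, a.2 ∈ L.deg a.1) (h₂ : ∀ a ∈ l₂, a.2 ∈ L.deg a.1) :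
    lieList L (l₁ ++ (i, x) :: (j, y) :: l₂) =
      (i * j).negOnePow • lieList L (l₁ ++ (j, y) :: (i, x) :: l₂) +
        lieList L (l₁ ++ (i + j, L.bracket x y) :: l₂) := by
  set l := l₁ ++ (i, x) :: (j, y) :: l₂ with hldef
  set n := l.length with hn
  set B := Module.End 𝕜 (Finset (Fin n) → 𝕜)
  let q : Fin n → ℤ := fun r => (l.get r).1
  set Λ : List ((ℤ × g) × ℕ × B) := List.ofFn fun r => (l.get r, 1, creation 𝕜 q r) with hΛ
  have hΛ1 : Λ.map Prod.fst = l := by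
    rw [hΛ, List.map_ofFn]
    exact List.ofFn_get l
  have hs : ∀ a ∈ Λ, ∀ b ∈ Λ, SignCommute a.1.1 b.1.1 a.2.2 b.2.2 := by
    intro a ha b hb
    obtain ⟨r, rfl⟩ := (List.mem_ofFn' _ _).1 ha
    obtain ⟨s, rfl⟩ := (List.mem_ofFn' _ _).1 hb
    exact creation_signCommute 𝕜 q r s
  have hl : ∀ a ∈ Λ, a.1.2 ∈ L.deg a.1.1 := by
    intro a ha
    have : a.1 ∈ l := hΛ1 ▸ List.mem_map_of_mem ha
    rw [hldef] at this
    simp only [List.mem_append, List.mem_cons] at this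
    rcases this with h | h | h | h
    · exact h₁ _ h
    · rw [h]; exact hx
    · rw [h]; exact hy
    · exact h₂ _ h
  have hw : ∀ a ∈ Λ, a.2.1 = 1 := by
    intro a ha
    obtain ⟨r, rfl⟩ := (List.mem_ofFn' _ _).1 ha
    rfl
  have htop : topCoeff 𝕜 n (Λ.map fun a => a.2.2).prod = 1 := by
    rw [hΛ, List.map_ofFn]
    exact topCoeff_creation 𝕜 q
  have hlen : Λ.length = n := List.length_ofFn
  obtain ⟨Λ₁, Λ', rfl', e₁, e'⟩ := List.map_eq_append_iff.1 hΛ1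
  obtain ⟨a, Λ'', rfl, ea, e''⟩ := List.map_eq_cons_iff.1 e'
  obtain ⟨b, Λ₂, rfl, eb, e₂⟩ := List.map_eq_cons_iff.1 e''
  rw [rfl'] at hs hl hw htop hlen
  clear_value Λ
  clear rfl' hΛ hΛ1 Λ e' e''
  obtain ⟨a, ma, Ya⟩ := a
  obtain ⟨b, mb, Yb⟩ := b
  obtain rfl : a = (i, x) := ea
  obtain rfl : b = (j, y) := eb
  obtain rfl : ma = 1 := hw ((i, x), ma, Ya) (by simp)
  obtain rfl : mb = 1 := hw ((j, y), mb, Yb) (by simp)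
  have hab : SignCommute i j Ya Yb := hs ((i, x), 1, Ya) (by simp) ((j, y), 1, Yb) (by simp)
  have hφ : IsWeightedHom L (dynkinAction L) := isWeightedHom_dynkinAction
  have k1 := hφ.lieList_tmul (N := n) _ hlen.le hl hs
  have k2 := hφ.lieList_tmul (N := n) (Λ₁ ++ ((j, y), 1, Yb) :: ((i, x), 1, Ya) :: Λ₂)
    (by simpa using hlen.le) (fun c hc => hl c (by
      simp only [List.mem_append, List.mem_cons] at hc ⊢; tauto)) (fun c hc d hd => hs c (by
      simp only [List.mem_append, List.mem_cons] at hc ⊢; tauto) d (by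
      simp only [List.mem_append, List.mem_cons] at hd ⊢; tauto))
  -- The product `Ya * Yb` obeys the sign rule for the degree `i + j`, which is the degree of `[x,
  -- y]`.
  have hs' : ∀ c ∈ Λ₁ ++ ((i + j, L.bracket x y), 2, Ya * Yb) :: Λ₂,
      ∀ d ∈ Λ₁ ++ ((i, x), 1, Ya) :: ((j, y), 1, Yb) :: Λ₂,
      SignCommute c.1.1 d.1.1 c.2.2 d.2.2 := by
    intro c hc d hd
    simp only [List.mem_append, List.mem_cons] at hc
    rcases hc with hc | rfl | hc
    · exact hs c (by simp [hc]) d hd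
    · exact (hs ((i, x), 1, Ya) (by simp) d hd).mul_left (hs ((j, y), 1, Yb) (by simp) d hd)
    · exact hs c (by simp [hc]) d hd
  have hs'' : ∀ c ∈ Λ₁ ++ ((i + j, L.bracket x y), 2, Ya * Yb) :: Λ₂,
      ∀ d ∈ Λ₁ ++ ((i + j, L.bracket x y), 2, Ya * Yb) :: Λ₂,
      SignCommute c.1.1 d.1.1 c.2.2 d.2.2 := by
    intro c hc d hd
    simp only [List.mem_append, List.mem_cons] at hd
    rcases hd with hd | rfl | hd
    · exact hs' c hc d (by simp [hd])
    · exact ((hs' c hc ((i, x), 1, Ya) (by simp)).symm.mul_left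
        (hs' c hc ((j, y), 1, Yb) (by simp)).symm).symm
    · exact hs' c hc d (by simp [hd])
  have k3 := hφ.lieList_tmul (N := n) (Λ₁ ++ ((i + j, L.bracket x y), 2, Ya * Yb) :: Λ₂)
    (by simp at hlen ⊢; omega) (fun c hc => by
      simp only [List.mem_append, List.mem_cons] at hc
      rcases hc with hc | rfl | hc
      · exact hl c (by simp [hc])
      · exact L.bracket_mem hx hy
      · exact hl c (by simp [hc])) hs''
  have hcomm : dynkinAction L 1 x ⊗ₜ[𝕜] Ya * dynkinAction L 1 y ⊗ₜ[𝕜] Yb -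
      dynkinAction L 1 y ⊗ₜ[𝕜] Yb * dynkinAction L 1 x ⊗ₜ[𝕜] Ya =
      dynkinAction L 2 (L.bracket x y) ⊗ₜ[𝕜] (Ya * Yb) := by
    rw [Algebra.TensorProduct.tmul_mul_tmul, Algebra.TensorProduct.tmul_mul_tmul,
      ← hφ 1 1 hx hy, TensorProduct.sub_tmul, hab.symm, mul_comm j i, TensorProduct.tmul_smul]
    rfl
  have hL : ∀ k : ℕ, labelSum k (List.map (fun a => dynkinAction L a.2.1 a.1.2 ⊗ₜ[𝕜] a.2.2)
      (Λ₁ ++ ((i, x), 1, Ya) :: ((j, y), 1, Yb) :: Λ₂)) slotProd -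
      labelSum k (List.map (fun a => dynkinAction L a.2.1 a.1.2 ⊗ₜ[𝕜] a.2.2)
      (Λ₁ ++ ((j, y), 1, Yb) :: ((i, x), 1, Ya) :: Λ₂)) slotProd =
      labelSum k (List.map (fun a => dynkinAction L a.2.1 a.1.2 ⊗ₜ[𝕜] a.2.2)
      (Λ₁ ++ ((i + j, L.bracket x y), 2, Ya * Yb) :: Λ₂)) slotProd := by
    intro k
    simp only [List.map_append, List.map_cons]
    rw [labelSum_commutator, hcomm]
  have key := k3.symm
  simp only [← hL, smul_sub, Finset.sum_sub_distrib] at key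
  rw [← k1, ← k2] at key
  have hw1 : (Λ₁.map fun a => a.2.1).sum + (2 + (Λ₂.map fun a => a.2.1).sum) = n := by
    have h1 : ∀ Λ : List ((ℤ × g) × ℕ × B), (∀ a ∈ Λ, a.2.1 = 1) →
        (Λ.map fun a => a.2.1).sum = Λ.length := by
      intro Λ h
      rw [List.map_congr_left h]
      simp
    rw [h1 Λ₁ fun a ha => hw a (by simp [ha]), h1 Λ₂ fun a ha => hw a (by simp [ha])]
    simp at hlen
    omega
  have hP2 : (List.map (fun a => a.2.2) (Λ₁ ++ ((j, y), 1, Yb) :: ((i, x), 1, Ya) :: Λ₂)).prod =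
      (i * j).negOnePow • (List.map (fun a => a.2.2)
        (Λ₁ ++ ((i, x), 1, Ya) :: ((j, y), 1, Yb) :: Λ₂)).prod := by
    simp only [List.map_append, List.map_cons, List.prod_append, List.prod_cons]
    rw [← mul_assoc Yb, hab.symm, mul_comm j i, smul_mul_assoc, mul_smul_comm, mul_assoc]
  have hP3 : (List.map (fun a => a.2.2) (Λ₁ ++ ((i + j, L.bracket x y), 2, Ya * Yb) :: Λ₂)).prod =
      (List.map (fun a => a.2.2) (Λ₁ ++ ((i, x), 1, Ya) :: ((j, y), 1, Yb) :: Λ₂)).prod := by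
    simp [List.prod_append, mul_assoc]
  have hW1 : (List.map (fun a => a.2.1)
      (Λ₁ ++ ((i, x), 1, Ya) :: ((j, y), 1, Yb) :: Λ₂)).sum = n := by
    refine Eq.trans ?_ hw1; simp; omega
  have hW2 : (List.map (fun a => a.2.1)
      (Λ₁ ++ ((j, y), 1, Yb) :: ((i, x), 1, Ya) :: Λ₂)).sum = n := by
    refine Eq.trans ?_ hw1; simp; omega
  have hW3 : (List.map (fun a => a.2.1)
      (Λ₁ ++ ((i + j, L.bracket x y), 2, Ya * Yb) :: Λ₂)).sum = n := by
    refine Eq.trans ?_ hw1; simp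
  rw [hP2, hP3, hW1, hW2, hW3] at key
  have key := congrArg (topPart 𝕜 _ n) key
  rw [map_sub, topPart_tmul, topPart_tmul, topPart_tmul, Units.smul_def, map_zsmul, htop, one_smul]
    at key
  have key := congrArg (fun T : Module.End 𝕜 (𝕜 × g) => (T (1, 0)).2) key
  have hn0 : (n : 𝕜) ≠ 0 := by
    exact_mod_cast (by omega : n ≠ 0)
  have hfst : ∀ z : ℤ × g, ∀ w Y, (((z, w, Y) : (ℤ × g) × ℕ × B)).1 = z := fun _ _ _ => rfl
  simp only [LinearMap.sub_apply, LinearMap.smul_apply, Prod.snd_sub, Prod.smul_snd,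
    dynkinAction_apply, map_zero, add_zero, one_mul, List.map_append, List.map_cons, e₁, e₂,
    smul_assoc, one_smul] at key
  rw [← smul_comm (n : 𝕜), ← smul_sub] at key
  have key := smul_right_injective g hn0 key
  rw [hldef, Units.smul_def, ← key]
  simp

end LieList

/-! ### Linear maps out of the tensor algebra. -/

section TensorLift

variable {𝕜 V W : Type*} [CommRing 𝕜] [AddCommGroup V] [Module 𝕜 V] [AddCommGroup W] [Module 𝕜 W]

/-- The linear map on the tensor algebra given by multilinear maps in each degree. -/
def tensorLift (F : ∀ n, MultilinearMap 𝕜 (fun _ : Fin n => V) W) : TensorAlgebra 𝕜 V →ₗ[𝕜] W :=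
  DirectSum.toModule 𝕜 ℕ W (fun n => PiTensorProduct.lift (F n)) ∘ₗ
    (TensorAlgebra.toDirectSum (R := 𝕜) (M := V)).toLinearMap

theorem tensorLift_prod (F : ∀ n, MultilinearMap 𝕜 (fun _ : Fin n => V) W) {n : ℕ} (x : Fin n → V) :
    tensorLift F (List.ofFn fun i => TensorAlgebra.ι 𝕜 (x i)).prod = F n x := by
  rw [← TensorAlgebra.tprod_apply, tensorLift, LinearMap.comp_apply, AlgHom.toLinearMap_apply,
    TensorAlgebra.toDirectSum_tensorPower_tprod, ← DirectSum.lof_eq_of 𝕜, DirectSum.toModule_lof,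
    PiTensorProduct.lift.tprod]

end TensorLift

/-! ### Multilinear extension through even and odd parts. -/

section Parity

variable {𝕜 E W : Type*} [Field 𝕜] [AddCommGroup E] [Module 𝕜 E] [AddCommGroup W] [Module 𝕜 W]

/-- The projections `par b` single out the elements of parity `b`. -/
def IsParity (deg : ℤ → Submodule 𝕜 E) (par : ZMod 2 → E →ₗ[𝕜] E) : Prop :=
  ∀ {i : ℤ} {x : E} (b : ZMod 2), x ∈ deg i → par b x = if (i : ZMod 2) = b then x else 0

/-- A degree of a given parity. -/
def parityDeg (b : ZMod 2) : ℤ := (b.val : ℤ)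

theorem even_sub_parityDeg (i : ℤ) : Even (i - parityDeg (i : ZMod 2)) := by
  rw [even_iff_two_dvd]
  apply (ZMod.intCast_zmod_eq_zero_iff_dvd _ 2).1
  simp [parityDeg]

/-- The multilinear map which is `F q` on elements of the degrees `q`, where `F q` depends only on
the parities. -/
def parityExtend (par : ZMod 2 → E →ₗ[𝕜] E) {n : ℕ}
    (F : (Fin n → ℤ) → MultilinearMap 𝕜 (fun _ : Fin n => E) W) :
    MultilinearMap 𝕜 (fun _ : Fin n => E) W :=
  ∑ b : Fin n → ZMod 2, (F fun i => parityDeg (b i)).compLinearMap fun i => par (b i)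

/-- Of the finitely many patterns of parities only that of `q` survives on arguments of degrees `q`.
-/
theorem parityExtend_apply {deg : ℤ → Submodule 𝕜 E} {par : ZMod 2 → E →ₗ[𝕜] E}
    (hpar : IsParity deg par) {n : ℕ} {F : (Fin n → ℤ) → MultilinearMap 𝕜 (fun _ : Fin n => E) W}
    (hF : ∀ q q' : Fin n → ℤ, (∀ i, Even (q i - q' i)) → F q = F q') (q : Fin n → ℤ) (x : Fin n → E)
    (hx : ∀ i, x i ∈ deg (q i)) : parityExtend par F x = F q x := by
  rw [parityExtend, _root_.sum_apply, Finset.sum_eq_single fun i => (q i : ZMod 2)]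
  · rw [MultilinearMap.compLinearMap_apply, ← hF q _ fun i => even_sub_parityDeg (q i)]
    congr 1
    funext i
    rw [hpar _ (hx i), if_pos rfl]
  · intro b _ hb
    obtain ⟨i, hi⟩ := Function.ne_iff.1 hb
    rw [MultilinearMap.compLinearMap_apply]
    refine MultilinearMap.map_coord_zero _ i ?_
    rw [hpar _ (hx i), if_neg (Ne.symm hi)]
  · simp

end Parity

/-! ### The Poincaré–Birkhoff–Witt theorem. -/

section PBW

variable {𝕜 g : Type*} [Field 𝕜] [AddCommGroup g] [Module 𝕜 g] (L : DGLieAlgebra 𝕜 g)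

namespace DGLieAlgebra

/-- The projections to the even and odd parts. -/
def parity (b : ZMod 2) : g →ₗ[𝕜] g :=
  DirectSum.toModule 𝕜 ℤ g (fun i => if (i : ZMod 2) = b then (L.deg i).subtype else 0) ∘ₗ
    (LinearEquiv.ofBijective (DirectSum.coeLinearMap L.deg) L.isInternal).symm.toLinearMap

theorem isParity_parity : IsParity L.deg L.parity := by
  intro i x b hx
  have h : (LinearEquiv.ofBijective (DirectSum.coeLinearMap L.deg) L.isInternal).symm x =
      DirectSum.lof 𝕜 ℤ (fun i => L.deg i) i ⟨x, hx⟩ := by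
    rw [LinearEquiv.symm_apply_eq]
    exact (DirectSum.coeLinearMap_lof L.deg i ⟨x, hx⟩).symm
  rw [parity, LinearMap.comp_apply, LinearEquiv.coe_coe, h, DirectSum.toModule_lof]
  split_ifs <;> rfl

theorem deg_iSup : ⨆ i, L.deg i = ⊤ := L.isInternal.submodule_iSup_eq_top

theorem homogeneous_induction {motive : g → Prop} (zero : motive 0)
    (add : ∀ x y, motive x → motive y → motive (x + y))
    (homogeneous : ∀ i, ∀ x ∈ L.deg i, motive x) (x : g) : motive x :=
  Submodule.iSup_induction L.deg (motive := motive) (L.deg_iSup ▸ Submodule.mem_top)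
    homogeneous zero add

end DGLieAlgebra

variable {L} [CharZero 𝕜]

variable (L) in
/-- The expressions `lieTerm L q` as multilinear maps. -/
def lieTermMulti {n : ℕ} (q : Fin n → ℤ) : MultilinearMap 𝕜 (fun _ : Fin n => g) g :=
  ∑ τ : Equiv.Perm (Fin n), koszulSign q τ • ((wordCoeff τ / n : ℚ) : 𝕜) •
    ((LinearMap.snd 𝕜 𝕜 g ∘ₗ LinearMap.applyₗ ((1, 0) : 𝕜 × g)).compMultilinearMap
      ((MultilinearMap.mkPiAlgebraFin 𝕜 n (Module.End 𝕜 (𝕜 × g))).compLinearMap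
        fun _ => dynkinAction L 1)).domDomCongr τ

theorem lieTermMulti_apply {n : ℕ} (q : Fin n → ℤ) (x : Fin n → g) :
    lieTermMulti L q x = lieTerm L q x := by
  rw [lieTermMulti, _root_.sum_apply]
  cases n with
  | zero =>
    -- For `n = 0` the coefficient `wordCoeff τ / 0` is zero by convention, in agreement with
    -- `lieTerm`.
    refine Finset.sum_eq_zero fun τ _ => ?_
    simp
  | succ n =>
    rw [lieTerm]
    refine Finset.sum_congr rfl fun τ _ => ?_
    have := prod_dynkinAction (L := L) 1 (x ∘ τ)
    rw [_root_.smul_apply, _root_.smul_apply, MultilinearMap.domDomCongr_apply,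
      LinearMap.compMultilinearMap_apply, MultilinearMap.compLinearMap_apply,
      MultilinearMap.mkPiAlgebraFin_apply, LinearMap.comp_apply, LinearMap.applyₗ_apply_apply]
    have h2 : (List.ofFn fun i => dynkinAction L 1 (x (τ i))).prod (1, 0) = _ := this
    rw [h2]
    simp

theorem lieTermMulti_congr {n : ℕ} {q q' : Fin n → ℤ} (h : ∀ i, Even (q i - q' i)) :
    lieTermMulti L q = lieTermMulti L q' := by
  simp only [lieTermMulti, koszulSign_congr h]

variable (L) in
/-- The linear extension of `lieTerm` to the tensor algebra. -/
def lieTensor : TensorAlgebra 𝕜 g →ₗ[𝕜] g :=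
  tensorLift fun _ => parityExtend L.parity (lieTermMulti L)

theorem lieTensor_prod (l : List (ℤ × g)) (hl : ∀ a ∈ l, a.2 ∈ L.deg a.1) :
    lieTensor L (l.map fun a => TensorAlgebra.ι 𝕜 a.2).prod = lieList L l := by
  obtain ⟨n, a, rfl⟩ : ∃ (n : ℕ) (a : Fin n → ℤ × g), l = List.ofFn a :=
    ⟨l.length, l.get, (List.ofFn_get l).symm⟩
  rw [List.map_ofFn]
  have h1 : ((fun a : ℤ × g => TensorAlgebra.ι 𝕜 a.2) ∘ a) =
    fun i => TensorAlgebra.ι 𝕜 (a i).2 := rfl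
  rw [h1, lieTensor, tensorLift_prod, parityExtend_apply L.isParity_parity
    (fun q q' h => lieTermMulti_congr h) (fun i => (a i).1) _ (fun i => hl _ (by simp)),
    lieTermMulti_apply]
  exact (lieList_ofFn _ _).symm

theorem wordCoeff_fin_one (τ : Equiv.Perm (Fin 1)) : wordCoeff τ = 1 := by
  rw [wordCoeff, Finset.sum_eq_single (Composition.single 1 one_pos)]
  · rw [if_pos]
    · simp [logCoeff]
    · intro j a b hab
      exact absurd (Subsingleton.elim (α := Fin 1) _ _)
        ((Composition.embedding _ j).injective.ne hab.ne)
  · intro c _ hc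
    have hl : 0 < c.length := c.length_pos_of_pos one_pos
    have := (Composition.ne_single_iff one_pos).1 hc ⟨0, hl⟩
    have := c.one_le_blocksFun ⟨0, hl⟩
    omega
  · simp

theorem lieTensor_ι (x : g) : lieTensor L (TensorAlgebra.ι 𝕜 x) = x := by
  induction x using L.homogeneous_induction with
  | zero => simp
  | add x y hx hy => rw [map_add, map_add, hx, hy]
  | homogeneous i x hx =>
    have := lieTensor_prod [(i, x)] (L := L) (by simpa using hx)
    rw [List.map_singleton, List.prod_singleton] at this
    rw [this]
    simp [lieList, lieTerm, wordCoeff_fin_one, koszulSign_one, nestedBracket, nest,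
      Subsingleton.elim (default : Equiv.Perm (Fin 1)) 1]

variable (L) in
theorem span_homogeneous_words :
    Submodule.span 𝕜 {u : TensorAlgebra 𝕜 g | ∃ l : List (ℤ × g), (∀ a ∈ l, a.2 ∈ L.deg a.1) ∧
      (l.map fun a => TensorAlgebra.ι 𝕜 a.2).prod = u} = ⊤ := by
  set S : Set (TensorAlgebra 𝕜 g) := {u | ∃ i, ∃ x ∈ L.deg i, TensorAlgebra.ι 𝕜 x = u}
  have h1 : Algebra.adjoin 𝕜 S = ⊤ := by
    rw [eq_top_iff, ← TensorAlgebra.adjoin_range_ι]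
    refine Algebra.adjoin_le ?_
    rintro _ ⟨x, rfl⟩
    induction x using L.homogeneous_induction with
    | zero => rw [map_zero]; exact zero_mem _
    | add x y hx hy => rw [map_add]; exact add_mem hx hy
    | homogeneous i x hx => exact Algebra.subset_adjoin ⟨i, x, hx, rfl⟩
  have h2 := congrArg Subalgebra.toSubmodule h1
  rw [Algebra.adjoin_eq_span, Algebra.top_toSubmodule] at h2
  rw [eq_top_iff, ← h2]
  refine Submodule.span_mono fun u hu => ?_
  obtain ⟨l, hl, rfl⟩ := Submonoid.exists_list_of_mem_closure hu
  clear hu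
  induction l with
  | nil => exact ⟨[], by simp, rfl⟩
  | cons u l ih =>
    obtain ⟨l', hl', e⟩ := ih fun a ha => hl a (by simp [ha])
    obtain ⟨i, x, hx, rfl⟩ := hl u (by simp)
    refine ⟨(i, x) :: l', ?_, ?_⟩
    · intro a ha
      rcases List.mem_cons.1 ha with rfl | ha
      exacts [hx, hl' a ha]
    · simp [e]

/-- By linearity `u` and `v` may be taken to be words of homogeneous letters, and then this is
`lieList_commutator`. -/
theorem lieTensor_mul_mul {a b : TensorAlgebra 𝕜 g} (h : L.EnvRel a b) (u v : TensorAlgebra 𝕜 g) :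
    lieTensor L (u * a * v) = lieTensor L (u * b * v) := by
  have hu : u ∈ Submodule.span 𝕜 _ := (span_homogeneous_words L).symm ▸ Submodule.mem_top
  induction hu using Submodule.span_induction with
  | zero => simp
  | add u u' _ _ hu hu' => simp only [add_mul, map_add, hu, hu']
  | smul c u _ hu => simp only [smul_mul_assoc, map_smul, hu]
  | mem u hu =>
  obtain ⟨l₁, hl₁, rfl⟩ := hu
  have hv : v ∈ Submodule.span 𝕜 _ := (span_homogeneous_words L).symm ▸ Submodule.mem_top
  induction hv using Submodule.span_induction with
  | zero => simp
  | add u u' _ _ hu hu' => simp only [mul_add, map_add, hu, hu']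
  | smul c u _ hu => simp only [mul_smul_comm, map_smul, hu]
  | mem v hv =>
  obtain ⟨l₂, hl₂, rfl⟩ := hv
  induction h with
  | @comm i j x y hx hy =>
    have h1 := lieTensor_prod (L := L) (l₁ ++ (i, x) :: (j, y) :: l₂) (by
      intro a ha
      simp only [List.mem_append, List.mem_cons] at ha
      rcases ha with ha | rfl | rfl | ha
      exacts [hl₁ a ha, hx, hy, hl₂ a ha])
    have h2 := lieTensor_prod (L := L) (l₁ ++ (j, y) :: (i, x) :: l₂) (by
      intro a ha
      simp only [List.mem_append, List.mem_cons] at ha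
      rcases ha with ha | rfl | rfl | ha
      exacts [hl₁ a ha, hy, hx, hl₂ a ha])
    have h3 := lieTensor_prod (L := L) (l₁ ++ (i + j, L.bracket x y) :: l₂) (by
      intro a ha
      simp only [List.mem_append, List.mem_cons] at ha
      rcases ha with ha | rfl | ha
      exacts [hl₁ a ha, L.bracket_mem hx hy, hl₂ a ha])
    simp only [List.map_append, List.map_cons, List.prod_append, List.prod_cons] at h1 h2 h3
    rw [mul_add, add_mul, map_add, mul_smul_comm, smul_mul_assoc, LinearMap.map_smul_of_tower]
    simp only [mul_assoc] at h1 h2 h3 ⊢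
    rw [h1, h2, h3, lieList_commutator hx hy _ _ hl₁ hl₂]

/-- The Poincaré–Birkhoff–Witt theorem: `g` embeds in its universal enveloping algebra. -/
theorem toEnv_injective : Function.Injective L.toEnv := by
  -- `RingQuot.Rel` closes the relations under sums and products; the two-sided context `u`, `v`
  -- absorbs the products.
  have h1 : ∀ {a b : TensorAlgebra 𝕜 g}, RingQuot.Rel L.EnvRel a b → ∀ u v,
      lieTensor L (u * a * v) = lieTensor L (u * b * v) := by
    intro a b h
    induction h with
    | of h => exact lieTensor_mul_mul h
    | add_left _ ih => intro u v; simp only [mul_add, add_mul, map_add, ih]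
    | mul_left _ ih => intro u v; simpa only [mul_assoc] using ih u (_ * v)
    | mul_right _ ih => intro u v; simpa only [mul_assoc] using ih (u * _) v
  have h2 : ∀ {a b : TensorAlgebra 𝕜 g}, Relation.EqvGen (RingQuot.Rel L.EnvRel) a b →
      lieTensor L a = lieTensor L b := by
    intro a b h
    induction h with
    | rel _ _ h => simpa using h1 h 1 1
    | refl => rfl
    | symm _ _ _ h => exact h.symm
    | trans _ _ _ _ _ h h' => exact h.trans h'
  intro x y hxy
  have h3 : RingQuot.mkRingHom L.EnvRel (TensorAlgebra.ι 𝕜 x) =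
      RingQuot.mkRingHom L.EnvRel (TensorAlgebra.ι 𝕜 y) := by
    rw [← RingQuot.mkAlgHom_coe 𝕜]
    exact hxy
  simp only [RingQuot.mkRingHom_def] at h3
  have h4 : Quot.mk (RingQuot.Rel L.EnvRel) (TensorAlgebra.ι 𝕜 x) = Quot.mk _ (TensorAlgebra.ι 𝕜 y) :=
    congrArg RingQuot.toQuot h3
  -- `lieTensor` is constant on the classes of the quotient and is the identity on `g`.
  have := h2 (Quot.eqvGen_exact h4)
  rwa [lieTensor_ι, lieTensor_ι] at this

theorem lTensor_toEnv_injective (W : Type*) [AddCommGroup W] [Module 𝕜 W] :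
    Function.Injective (LinearMap.lTensor W L.toEnv) :=
  Module.Flat.lTensor_preserves_injective_linearMap _ toEnv_injective

theorem isWeightedHom_toEnv : IsWeightedHom L fun _ => L.toEnv := by
  intro i j x y _ _ hx hy
  have h : RingQuot.mkAlgHom 𝕜 L.EnvRel _ = RingQuot.mkAlgHom 𝕜 L.EnvRel _ :=
    RingQuot.mkAlgHom_rel 𝕜 (DGLieAlgebra.EnvRel.comm hx hy)
  rw [sub_eq_iff_eq_add']
  refine (map_mul (RingQuot.mkAlgHom 𝕜 L.EnvRel) _ _).symm.trans (h.trans ?_)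
  rw [map_add, Units.smul_def, map_zsmul, map_mul]
  rfl

end PBW

/-! ### Shuffle products of iterated integrals. -/

section Shuffle

/-- The permutation of `n + 1` letters which maps the last letter to `m` and is given by `ρ` on the
other letters. -/
def permInsert {n : ℕ} (p : Fin (n + 1) × Equiv.Perm (Fin n)) : Equiv.Perm (Fin (n + 1)) :=
  ((finSuccEquiv' (Fin.last n)).trans (Equiv.optionCongr p.2)).trans (finSuccEquiv' p.1).symm

theorem permInsert_last {n : ℕ} (p : Fin (n + 1) × Equiv.Perm (Fin n)) :
    permInsert p (Fin.last n) = p.1 := by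
  simp [permInsert]

theorem permInsert_castSucc {n : ℕ} (p : Fin (n + 1) × Equiv.Perm (Fin n)) (i : Fin n) :
    permInsert p i.castSucc = p.1.succAbove (p.2 i) := by
  simp [permInsert, finSuccEquiv'_last_apply_castSucc]

theorem permInsert_bijective (n : ℕ) : Function.Bijective (permInsert (n := n)) := by
  rw [Fintype.bijective_iff_injective_and_card]
  constructor
  · rintro ⟨m, ρ⟩ ⟨m', ρ'⟩ h
    have h1 : m = m' := by
      have := congrArg (fun σ : Equiv.Perm (Fin (n + 1)) => σ (Fin.last n)) h
      simpa only [permInsert_last] using this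
    subst h1
    refine Prod.ext rfl (Equiv.ext fun i => ?_)
    have := congrArg (fun σ : Equiv.Perm (Fin (n + 1)) => σ i.castSucc) h
    simpa only [permInsert_castSucc, Fin.succAbove_right_inj] using this
  · simp [Fintype.card_perm, Nat.factorial_succ]

/-- The permutation `ρ` is increasing along the fibres of `f`. -/
def FibreMono {n : ℕ} {K : Type*} (f : Fin n → K) (ρ : Equiv.Perm (Fin n)) : Prop :=
  ∀ p p', f (ρ p) = f (ρ p') → p < p' → ρ p < ρ p'

/-- The last letter `m` of a shuffle must be the last position of its fibre, and the rest is a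
shuffle of the word without `m`. -/
theorem fibreMono_permInsert {n : ℕ} {K : Type*} (f : Fin (n + 1) → K) (m : Fin (n + 1))
    (ρ : Equiv.Perm (Fin n)) : FibreMono f (permInsert (m, ρ)) ↔
      (∀ i, f (m.succAbove i) = f m → m.succAbove i < m) ∧ FibreMono (f ∘ m.succAbove) ρ := by
  simp only [FibreMono, Fin.forall_fin_succ', permInsert_last, permInsert_castSucc,
    Fin.castSucc_lt_castSucc_iff, Function.comp_apply, Fin.succAbove_lt_succAbove_iff]
  constructor
  · rintro ⟨h, -⟩
    refine ⟨fun i hi => ?_, fun p p' => (h p).1 p'⟩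
    simpa using (h (ρ.symm i)).2 (by simpa using hi) (Fin.castSucc_lt_last _)
  · rintro ⟨h1, h2⟩
    refine ⟨fun p => ⟨h2 p, fun hp _ => h1 _ hp⟩, fun p' _ hp => ?_, fun _ hp => ?_⟩
    · exact absurd hp (Fin.castSucc_lt_last _).not_gt
    · exact absurd hp (lt_irrefl _)

variable {𝕜 R : Type*} [Field 𝕜] [CommRing R] [Algebra 𝕜 R]

/-- The iterated integral of a list of functions. -/
def listPath (J : R →ₗ[𝕜] R) (l : List R) : R := l.foldl (fun x y => J (x * y)) 1

theorem listPath_ofFn (J : R →ₗ[𝕜] R) : ∀ {n : ℕ} (a : Fin n → R),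
    listPath J (List.ofFn a) = iteratedPath J a
  | 0, _ => rfl
  | n + 1, a => by
    rw [iteratedPath, ← listPath_ofFn J fun i => a i.castSucc, List.ofFn_succ', listPath]
    simp [listPath, List.concat_eq_append]

/-- The integrated Leibniz rule: each summand singles out the primitive that carries the outermost
integration. -/
theorem IsRotaBaxter.prod_eq_sum {J : R →ₗ[𝕜] R} (hJ : IsRotaBaxter J) {ι : Type*} [DecidableEq ι]
    (x : ι → R) {s : Finset ι} (hs : s.Nonempty) :
    ∏ i ∈ s, J (x i) = ∑ i ∈ s, J (x i * ∏ j ∈ s.erase i, J (x j)) := by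
  induction hs using Finset.Nonempty.cons_induction with
  | singleton a => simp
  | cons a s ha hs ih =>
    rw [Finset.prod_cons, Finset.sum_cons, Finset.erase_cons]
    have h1 : ∀ i ∈ s, J (x i * ∏ j ∈ (Finset.cons a s ha).erase i, J (x j)) =
        J (J (x a) * (x i * ∏ j ∈ s.erase i, J (x j))) := by
      intro i hi
      have hne : a ≠ i := fun h => ha (h ▸ hi)
      have : (Finset.cons a s ha).erase i = Finset.cons a (s.erase i)
          (fun h => ha (Finset.mem_of_mem_erase h)) := by
        ext j
        simp only [Finset.mem_erase, Finset.mem_cons]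
        constructor
        · rintro ⟨h, rfl | h'⟩
          exacts [Or.inl rfl, Or.inr ⟨h, h'⟩]
        · rintro (rfl | ⟨h, h'⟩)
          exacts [⟨hne, Or.inl rfl⟩, ⟨h, Or.inr h'⟩]
      rw [this, Finset.prod_cons]
      congr 1
      ring
    rw [Finset.sum_congr rfl h1, ← map_sum, ← Finset.mul_sum]
    nth_rw 1 [ih]
    rw [← map_sum, hJ, map_sum, ← ih]

/-- The positions of the letters with the label `j`. -/
def fibreList {n : ℕ} {K : Type*} [DecidableEq K] (f : Fin n → K) (j : K) : List (Fin n) :=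
  (List.finRange n).filter fun i => f i = j

theorem mem_fibreList {n : ℕ} {K : Type*} [DecidableEq K] {f : Fin n → K} {j : K} {i : Fin n} :
    i ∈ fibreList f j ↔ f i = j := by
  simp [fibreList]

theorem eq_fibreList {n : ℕ} {K : Type*} [DecidableEq K] {f : Fin n → K} {j : K} {l : List (Fin n)}
    (hl : l.Pairwise (· < ·)) (h : ∀ i, i ∈ l ↔ f i = j) : fibreList f j = l := by
  have h1 : (fibreList f j).Pairwise (· < ·) := (List.pairwise_lt_finRange n).filter _
  refine List.Perm.eq_of_pairwise (fun a b _ _ hab hba => absurd hab hba.not_gt) h1 hl ?_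
  refine List.perm_of_nodup_nodup_toFinset_eq (h1.imp ne_of_lt) (hl.imp ne_of_lt) ?_
  ext i
  simp [mem_fibreList, h]

theorem fibreList_pairwise {n : ℕ} {K : Type*} [DecidableEq K] (f : Fin n → K) (j : K) :
    (fibreList f j).Pairwise (· < ·) := (List.pairwise_lt_finRange n).filter _

theorem fibreList_succAbove_of_ne {n : ℕ} {K : Type*} [DecidableEq K] (f : Fin (n + 1) → K)
    {m : Fin (n + 1)} {j : K} (h : f m ≠ j) :
    fibreList f j = (fibreList (f ∘ m.succAbove) j).map m.succAbove := by
  refine eq_fibreList ?_ fun i => ?_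
  · rw [List.pairwise_map]
    exact (fibreList_pairwise _ _).imp fun hab => Fin.strictMono_succAbove m hab
  · simp only [List.mem_map, mem_fibreList, Function.comp_apply]
    constructor
    · rintro ⟨i, hi, rfl⟩
      exact hi
    · intro hi
      obtain ⟨i', rfl⟩ := Fin.exists_succAbove_eq (x := i) (y := m) (by rintro rfl; exact h hi)
      exact ⟨i', hi, rfl⟩

theorem fibreList_succAbove {n : ℕ} {K : Type*} [DecidableEq K] (f : Fin (n + 1) → K)
    {m : Fin (n + 1)} (h : ∀ i, f (m.succAbove i) = f m → m.succAbove i < m) :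
    fibreList f (f m) = (fibreList (f ∘ m.succAbove) (f m)).map m.succAbove ++ [m] := by
  refine eq_fibreList ?_ fun i => ?_
  · rw [List.pairwise_append, List.pairwise_map]
    refine ⟨(fibreList_pairwise _ _).imp fun hab => Fin.strictMono_succAbove m hab, by simp, ?_⟩
    intro a ha b hb
    obtain rfl := List.mem_singleton.1 hb
    obtain ⟨i, hi, rfl⟩ := List.mem_map.1 ha
    exact h i (mem_fibreList (f := f ∘ b.succAbove).1 hi)
  · simp only [List.mem_append, List.mem_map, mem_fibreList, Function.comp_apply, List.mem_singleton]
    constructor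
    · rintro (⟨i, hi, rfl⟩ | rfl)
      exacts [hi, rfl]
    · intro hi
      by_cases him : i = m
      · exact Or.inr him
      · obtain ⟨i', rfl⟩ := Fin.exists_succAbove_eq him
        exact Or.inl ⟨i', hi, rfl⟩

open Classical in
/-- The shuffle product formula for iterated integrals. -/
theorem IsRotaBaxter.prod_listPath {J : R →ₗ[𝕜] R} (hJ : IsRotaBaxter J) {K : Type*} [Fintype K] :
    ∀ {n : ℕ} (f : Fin n → K) (a : Fin n → R),
    ∏ j, listPath J ((fibreList f j).map a) =
      ∑ ρ : Equiv.Perm (Fin n), if FibreMono f ρ then iteratedPath J (a ∘ ρ) else 0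
  | 0, f, a => by
    rw [Fintype.sum_subsingleton _ 1, if_pos (show FibreMono f 1 from fun p => p.elim0)]
    refine Finset.prod_eq_one fun j _ => ?_
    rfl
  | n + 1, f, a => by
    rw [← (permInsert_bijective n).sum_comp, Fintype.sum_prod_type]
    -- `P m` says that `m` is the last position of its fibre; these are the candidates for the
    -- outermost integration variable.
    let P : Fin (n + 1) → Prop := fun m => ∀ i, f (m.succAbove i) = f m → m.succAbove i < m
    let s : Finset (Fin (n + 1)) := Finset.univ.filter P
    let x : Fin (n + 1) → R := fun m =>
      listPath J ((fibreList (f ∘ m.succAbove) (f m)).map (a ∘ m.succAbove)) * a m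
    have hx : ∀ m ∈ s, listPath J ((fibreList f (f m)).map a) = J (x m) := by
      intro m hm
      have hm : P m := (Finset.mem_filter.1 hm).2
      rw [fibreList_succAbove f hm, listPath]
      simp [x, listPath]
    have hinj : Set.InjOn f s := by
      intro m hm m' hm' h
      have hm : P m := (Finset.mem_filter.1 hm).2
      have hm' : P m' := (Finset.mem_filter.1 hm').2
      by_contra hne
      obtain ⟨i, hi⟩ := Fin.exists_succAbove_eq hne
      obtain ⟨i', hi'⟩ := Fin.exists_succAbove_eq (Ne.symm hne)
      have h1 := hm' i (by rw [hi, h])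
      have h2 := hm i' (by rw [hi', h])
      rw [hi] at h1
      rw [hi'] at h2
      exact absurd h1 h2.not_gt
    have himg : ∀ i, f i ∈ s.image f := by
      intro i
      obtain ⟨m, hm, hmax⟩ := (Finset.univ.filter fun i' => f i' = f i).exists_max_image id
        ⟨i, by simp⟩
      refine Finset.mem_image.2 ⟨m, ?_, (Finset.mem_filter.1 hm).2⟩
      refine Finset.mem_filter.2 ⟨Finset.mem_univ _, fun i' hi' => ?_⟩
      refine lt_of_le_of_ne (hmax _ ?_) (Fin.succAbove_ne _ _)
      rw [Finset.mem_filter] at hm ⊢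
      exact ⟨Finset.mem_univ _, hi'.trans hm.2⟩
    -- Each nonempty fibre has exactly one last position, and an empty fibre contributes the empty
    -- integral, which is one.
    have hprod : ∀ (t : Finset K), s.image f ⊆ t →
        ∏ j ∈ t, listPath J ((fibreList f j).map a) = ∏ m ∈ s, J (x m) := by
      intro t ht
      rw [← Finset.prod_subset ht, Finset.prod_image hinj]
      · exact Finset.prod_congr rfl hx
      · intro j _ hj
        have : fibreList f j = [] := by
          refine List.eq_nil_iff_forall_not_mem.2 fun i hi => hj ?_
          rw [← mem_fibreList.1 hi]
          exact himg i
        rw [this]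
        rfl
    have hs : s.Nonempty := by
      have := himg 0
      exact (Finset.image_nonempty.1 ⟨_, this⟩)
    rw [hprod _ (Finset.subset_univ _), hJ.prod_eq_sum x hs, ← Finset.sum_filter_add_sum_filter_not
      (Finset.univ : Finset (Fin (n + 1))) P]
    rw [Finset.sum_eq_zero (s := Finset.univ.filter fun m => ¬ P m), add_zero]
    · refine Finset.sum_congr rfl fun m hm => ?_
      have hm' : P m := (Finset.mem_filter.1 hm).2
      have h1 : x m * ∏ j ∈ s.erase m, J (x j) =
          (∏ j, listPath J ((fibreList (f ∘ m.succAbove) j).map (a ∘ m.succAbove))) * a m := by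
        rw [← Finset.mul_prod_erase _ _ (Finset.mem_univ (f m))]
        simp only [x]
        have h2 : ∏ j ∈ s.erase m, J (x j) = ∏ j ∈ Finset.univ.erase (f m),
            listPath J ((fibreList (f ∘ m.succAbove) j).map (a ∘ m.succAbove)) := by
          have h3 : ∀ j ∈ Finset.univ.erase (f m),
              listPath J ((fibreList (f ∘ m.succAbove) j).map (a ∘ m.succAbove)) =
              listPath J ((fibreList f j).map a) := by
            intro j hj
            rw [fibreList_succAbove_of_ne f (Finset.ne_of_mem_erase hj).symm, List.map_map]
          rw [Finset.prod_congr rfl h3]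
          have h4 : (s.erase m).image f ⊆ Finset.univ.erase (f m) := by
            intro j hj
            obtain ⟨m', hm', rfl⟩ := Finset.mem_image.1 hj
            refine Finset.mem_erase.2 ⟨fun h => ?_, Finset.mem_univ _⟩
            exact (Finset.mem_erase.1 hm').1 (hinj (Finset.mem_erase.1 hm').2 hm h)
          rw [← Finset.prod_subset h4, Finset.prod_image (hinj.mono fun i hi => Finset.mem_of_mem_erase hi)]
          · exact Finset.prod_congr rfl fun m' hm' => (hx m' (Finset.mem_of_mem_erase hm')).symm
          · intro j hj hj'
            have : fibreList f j = [] := by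
              refine List.eq_nil_iff_forall_not_mem.2 fun i hi => hj' ?_
              obtain ⟨m', hm', h⟩ := Finset.mem_image.1 (himg i)
              rw [mem_fibreList.1 hi] at h
              refine Finset.mem_image.2 ⟨m', Finset.mem_erase.2 ⟨?_, hm'⟩, h⟩
              rintro rfl
              exact (Finset.mem_erase.1 hj).1 h.symm
            rw [this]
            rfl
        rw [← h2]
        ring
      rw [h1, IsRotaBaxter.prod_listPath hJ, Finset.sum_mul, map_sum]
      refine Finset.sum_congr rfl fun ρ _ => ?_
      simp only [fibreMono_permInsert]
      have h5 : J (iteratedPath J ((a ∘ m.succAbove) ∘ ρ) * a m) =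
          iteratedPath J (a ∘ permInsert (m, ρ)) := by
        rw [iteratedPath]
        simp only [Function.comp_apply, permInsert_last, permInsert_castSucc]
        rfl
      by_cases h6 : FibreMono (f ∘ m.succAbove) ρ
      · rw [if_pos h6, if_pos ⟨hm', h6⟩, h5]
      · rw [if_neg h6, if_neg (fun h => h6 h.2), zero_mul, map_zero]
    · intro m hm
      refine Finset.sum_eq_zero fun ρ _ => ?_
      rw [fibreMono_permInsert, if_neg fun h => (Finset.mem_filter.1 hm).2 h.1]

/-- `FibreMono` compares values on a fibre, while `wordCoeff` asks for increase along blocks;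
inverting the permutation exchanges the two conditions. -/
theorem fibreMono_index_iff {n : ℕ} (c : Composition n) (σ : Equiv.Perm (Fin n)) :
    FibreMono c.index σ.symm ↔ ∀ j, StrictMono (σ ∘ c.embedding j) := by
  constructor
  · intro h j i i' hii'
    by_contra hlt
    have hne : σ (c.embedding j i') ≠ σ (c.embedding j i) := fun h =>
      hii'.ne' ((c.embedding j).injective (σ.injective h))
    have hlt : σ (c.embedding j i') < σ (c.embedding j i) := lt_of_le_of_ne (not_lt.1 hlt) hne
    have := h _ _ (by simp [c.index_embedding]) hlt
    simp only [Equiv.symm_apply_apply] at this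
    exact absurd ((c.embedding j).lt_iff_lt.1 this) hii'.not_gt
  · intro h p p' hpp hlt
    obtain ⟨i, hi⟩ := c.mem_range_embedding (σ.symm p)
    obtain ⟨i', hi'⟩ : σ.symm p' ∈ Set.range (c.embedding (c.index (σ.symm p))) :=
      c.mem_range_embedding_iff'.2 hpp
    rw [← hi, ← hi', (c.embedding _).lt_iff_lt]
    by_contra hle
    rcases (not_lt.1 hle).lt_or_eq with hle | hle
    · have := h _ hle
      simp only [Function.comp_apply, hi, hi', Equiv.apply_symm_apply] at this
      exact absurd this hlt.not_gt
    · rw [hle, hi, σ.symm.injective.eq_iff] at hi'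
      exact hlt.ne hi'

theorem fibreList_index {n : ℕ} (c : Composition n) (j : Fin c.length) :
    fibreList c.index j = List.ofFn (c.embedding j) := by
  refine eq_fibreList ?_ fun i => ?_
  · rw [List.ofFn_eq_map, List.pairwise_map]
    exact (List.pairwise_lt_finRange _).imp fun hab => (c.embedding j).lt_iff_lt.2 hab
  · rw [List.mem_ofFn', c.mem_range_embedding_iff']
    exact eq_comm

/-- Expand the product over the blocks of each composition by the shuffle formula and exchange the
sums; the compositions that allow a given `σ` add up to `wordCoeff σ`. -/
theorem logIntegral_eq_sum [CharZero 𝕜] {J : R →ₗ[𝕜] R} (hJ : IsRotaBaxter J) {n : ℕ} (a : Fin n → R) :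
    logIntegral J a = ∑ σ : Equiv.Perm (Fin n), (wordCoeff σ : 𝕜) • iteratedPath J (a ∘ σ.symm) := by
  classical
  have h1 : ∀ c : Composition n, ∏ j, iteratedPath J (a ∘ c.embedding j) =
      ∑ σ : Equiv.Perm (Fin n), if ∀ j, StrictMono (σ ∘ c.embedding j) then
        iteratedPath J (a ∘ σ.symm) else 0 := by
    intro c
    have := hJ.prod_listPath c.index a
    have h2 : ∀ j, listPath J ((@fibreList _ _ (fun a b => Classical.propDecidable (a = b)) c.index j).map a) =
        iteratedPath J (a ∘ c.embedding j) := by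
      intro j
      rw [← listPath_ofFn, ← List.map_ofFn, ← fibreList_index]
      congr!
    rw [Finset.prod_congr rfl fun j _ => h2 j] at this
    rw [this, ← Equiv.sum_comp (Equiv.inv (Equiv.Perm (Fin n)))]
    refine Finset.sum_congr rfl fun σ _ => ?_
    exact if_congr (fibreMono_index_iff c σ) rfl rfl
  simp only [logIntegral, wordCoeff, h1, Finset.mul_sum, Rat.cast_sum, Finset.sum_smul]
  rw [Finset.sum_comm]
  refine Finset.sum_congr rfl fun σ _ => Finset.sum_congr rfl fun c _ => ?_
  by_cases h : ∀ j, StrictMono (σ ∘ c.embedding j)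
  · rw [if_pos h, if_pos h, Algebra.smul_def]
  · rw [if_neg h, if_neg h, mul_zero, Rat.cast_zero, zero_smul]

end Shuffle

/-! ### Descents and the Eulerian coefficients. -/

section Eulerian

/-- Compositions of `m + 1` correspond to subsets of the set of `m` gaps. -/
def cuts (m : ℕ) : Composition (m + 1) ≃ Finset (Fin m) :=
  (compositionEquiv (m + 1)).trans (compositionAsSetEquiv (m + 1))

theorem mem_cuts {m : ℕ} {c : Composition (m + 1)} {i : Fin m} :
    i ∈ cuts m c ↔ i.succ.castSucc ∈ c.boundaries := by
  have h : (⟨1 + (i : ℕ), by omega⟩ : Fin (m + 1 + 1)) = i.succ.castSucc :=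
    Fin.ext (by simp [add_comm])
  simp only [cuts, compositionAsSetEquiv, compositionEquiv, Equiv.trans_apply, Equiv.coe_fn_mk,
    Set.mem_toFinset, Composition.toCompositionAsSet]
  rw [← h]
  rfl

theorem length_eq_card_cuts {m : ℕ} (c : Composition (m + 1)) : c.length = (cuts m c).card + 1 := by
  have h0 : (0 : Fin (m + 2)) ∈ c.boundaries := c.toCompositionAsSet.zero_mem
  have hl : Fin.last (m + 1) ∈ c.boundaries := c.toCompositionAsSet.getLast_mem
  have h : c.boundaries = insert 0 (insert (Fin.last (m + 1))
      ((cuts m c).image fun i => i.succ.castSucc)) := by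
    ext j
    simp only [Finset.mem_insert, Finset.mem_image, mem_cuts]
    constructor
    · intro hj
      induction j using Fin.cases with
      | zero => exact Or.inl rfl
      | succ j =>
        induction j using Fin.lastCases with
        | last => exact Or.inr (Or.inl rfl)
        | cast j => exact Or.inr (Or.inr ⟨j, hj, rfl⟩)
    · rintro (rfl | rfl | ⟨i, hi, rfl⟩)
      exacts [h0, hl, hi]
  have h1 := c.card_boundaries_eq_succ_length
  rw [h, Finset.card_insert_of_notMem, Finset.card_insert_of_notMem,
    Finset.card_image_of_injective] at h1
  · omega
  · exact fun i j hij => Fin.succ_injective _ (Fin.castSucc_injective _ hij)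
  · simp [Fin.ext_iff]
    intro i _
    omega
  · simp [Fin.ext_iff]

theorem mem_boundaries_iff {n : ℕ} (c : Composition n) (j : Fin (n + 1)) :
    j ∈ c.boundaries ↔ ∃ k ≤ c.length, c.sizeUpTo k = j := by
  simp only [Composition.boundaries, Finset.mem_map, Finset.mem_univ, true_and]
  constructor
  · rintro ⟨k, rfl⟩
    exact ⟨k, Nat.lt_succ_iff.1 k.2, rfl⟩
  · rintro ⟨k, hk, h⟩
    exact ⟨⟨k, Nat.lt_succ_iff.2 hk⟩, Fin.ext h⟩

theorem mem_cuts_iff_index {m : ℕ} (c : Composition (m + 1)) (i : Fin m) :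
    i ∈ cuts m c ↔ c.index i.castSucc ≠ c.index i.succ := by
  have h1 : (i : ℕ) < c.sizeUpTo (c.index i.castSucc + 1) := c.lt_sizeUpTo_index_succ i.castSucc
  have h2 : c.sizeUpTo (c.index i.castSucc) ≤ i := c.sizeUpTo_index_le i.castSucc
  have h3 : (i : ℕ) + 1 < c.sizeUpTo (c.index i.succ + 1) := c.lt_sizeUpTo_index_succ i.succ
  have h4 : c.sizeUpTo (c.index i.succ) ≤ i + 1 := c.sizeUpTo_index_le i.succ
  rw [mem_cuts, mem_boundaries_iff]
  simp only [Fin.val_castSucc, Fin.val_succ]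
  constructor
  · rintro ⟨k, _, hk⟩ h
    rw [← h] at h3
    rcases Nat.lt_or_ge (c.index i.castSucc) k with h5 | h5
    · have := c.monotone_sizeUpTo (Nat.succ_le_of_lt h5)
      simp only [Nat.succ_eq_add_one] at this
      omega
    · have := c.monotone_sizeUpTo h5
      omega
  · intro h
    have h5 := index_monotone c (show i.castSucc ≤ i.succ from Fin.castSucc_lt_succ.le)
    have h6 : (c.index i.castSucc : ℕ) + 1 ≤ c.index i.succ := Nat.succ_le_of_lt (lt_of_le_of_ne h5 (Fin.val_ne_of_ne h))
    have := c.monotone_sizeUpTo h6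
    exact ⟨c.index i.succ, (c.index i.succ).2.le, by omega⟩

/-- To increase along every block means that no descent lies inside a block. -/
theorem strictMono_blocks_iff_subset {m : ℕ} (c : Composition (m + 1))
    (σ : Equiv.Perm (Fin (m + 1))) : (∀ j, StrictMono (σ ∘ c.embedding j)) ↔
      (Finset.univ.filter fun i : Fin m => σ i.succ < σ i.castSucc) ⊆ cuts m c := by
  constructor
  · intro h i hi
    rw [mem_cuts_iff_index]
    intro hc
    obtain ⟨p, hp⟩ := c.mem_range_embedding i.castSucc
    obtain ⟨p', hp'⟩ : i.succ ∈ Set.range (c.embedding (c.index i.castSucc)) :=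
      c.mem_range_embedding_iff'.2 hc
    have hlt : p < p' := by
      rw [← (c.embedding _).lt_iff_lt, hp, hp']
      exact Fin.castSucc_lt_succ
    have := h _ hlt
    simp only [Function.comp_apply, hp, hp'] at this
    exact absurd (Finset.mem_filter.1 hi).2 this.not_gt
  · intro h
    have key : ∀ p' p : Fin (m + 1), p < p' → c.index p = c.index p' → σ p < σ p' := by
      intro p'
      induction p' using Fin.induction with
      | zero => intro p hp; exact absurd hp (Fin.not_lt_zero p)
      | succ i ih =>
        intro p hp hc
        have hp : p ≤ i.castSucc := Fin.le_castSucc_iff.2 hp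
        have h1 := index_monotone c hp
        have h2 := index_monotone c (show i.castSucc ≤ i.succ from Fin.castSucc_lt_succ.le)
        have h3 : c.index i.castSucc = c.index i.succ := le_antisymm h2 (hc ▸ h1)
        have h4 : σ i.castSucc < σ i.succ := by
          refine lt_of_le_of_ne (not_lt.1 fun hlt => ?_)
            (σ.injective.ne (Fin.castSucc_lt_succ (i := i)).ne)
          exact (mem_cuts_iff_index c i).1 (h (Finset.mem_filter.2 ⟨Finset.mem_univ _, hlt⟩)) h3
        rcases hp.lt_or_eq with hp | rfl
        · exact (ih p hp (hc.trans h3.symm)).trans h4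
        · exact h4
    intro j p p' hp
    exact key _ _ ((c.embedding j).lt_iff_lt.2 hp) (by rw [c.index_embedding, c.index_embedding])

/-- The sum is the Beta integral of `x^d (1 - x)^|s|` over `[0, 1]`. Adding an element to `s`
subtracts the value for `d + 1` from that for `d`. -/
theorem sum_powerset_alternating {α : Type*} [DecidableEq α] (s : Finset α) (d : ℕ) :
    ∑ t ∈ s.powerset, ((-1 : ℚ) ^ t.card / (d + t.card + 1)) =
      d.factorial * s.card.factorial / (d + s.card + 1).factorial := by
  induction s using Finset.induction_on generalizing d with
  | empty =>
    have := Nat.factorial_ne_zero d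
    simp [Nat.factorial_succ]
    field_simp
  | insert a s ha ih =>
    rw [Finset.sum_powerset_insert ha, ih d]
    have h1 : ∀ t ∈ s.powerset, ((-1 : ℚ) ^ (insert a t).card / (d + (insert a t).card + 1)) =
        - ((-1 : ℚ) ^ t.card / ((d + 1 : ℕ) + t.card + 1)) := by
      intro t ht
      rw [Finset.card_insert_of_notMem fun h => ha (Finset.mem_powerset.1 ht h), pow_succ]
      push_cast
      rw [mul_neg_one, neg_div, show (d : ℚ) + (t.card + 1) + 1 = d + 1 + t.card + 1 by ring]
    rw [Finset.sum_congr rfl h1, Finset.sum_neg_distrib, ih (d + 1), Finset.card_insert_of_notMem ha,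
      show d + 1 + s.card + 1 = (d + s.card + 1) + 1 by ring,
      show d + (s.card + 1) + 1 = (d + s.card + 1) + 1 by ring, Nat.factorial_succ (d + s.card + 1),
      Nat.factorial_succ d, Nat.factorial_succ s.card]
    have h2 : ((d + s.card + 1).factorial : ℚ) ≠ 0 := by exact_mod_cast Nat.factorial_ne_zero _
    have h3 : (d : ℚ) + s.card + 1 + 1 ≠ 0 := by positivity
    push_cast
    field_simp
    ring

/-- The admissible compositions are the supersets `S` of the descent set, each with coefficient
`(-1)^|S| / (|S| + 1)`. Splitting `S` into the descents and the rest reduces the sum to the Beta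
integral. -/
theorem wordCoeff_eq {m : ℕ} (σ : Equiv.Perm (Fin (m + 1))) :
    wordCoeff σ = (-1) ^ descents σ / ((m + 1) * m.choose (descents σ)) := by
  set D := Finset.univ.filter fun i : Fin m => σ i.succ < σ i.castSucc with hD
  have hd : descents σ = D.card := rfl
  have h1 : wordCoeff σ = ∑ S : Finset (Fin m), if D ⊆ S then (-1 : ℚ) ^ S.card / (S.card + 1) else 0 := by
    rw [wordCoeff, ← (cuts m).sum_comp]
    refine Finset.sum_congr rfl fun c _ => ?_
    refine if_congr (strictMono_blocks_iff_subset c σ) ?_ rfl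
    rw [length_eq_card_cuts, logCoeff]
    push_cast
    ring
  have h2 : (Finset.univ.filter fun S : Finset (Fin m) => D ⊆ S) =
      (Finset.univ \ D).powerset.image fun t => D ∪ t := by
    rw [← Finset.Icc_eq_image_powerset (Finset.subset_univ D)]
    ext S
    simp
  rw [h1, ← Finset.sum_filter, h2, Finset.sum_image]
  · have h3 : ∀ t ∈ (Finset.univ \ D).powerset, ((-1 : ℚ) ^ (D ∪ t).card / ((D ∪ t).card + 1)) =
        (-1) ^ D.card * ((-1) ^ t.card / (D.card + t.card + 1)) := by
      intro t ht
      rw [Finset.card_union_of_disjoint (Finset.disjoint_of_subset_right (Finset.mem_powerset.1 ht)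
        Finset.disjoint_sdiff), pow_add]
      push_cast
      rw [mul_div_assoc]
    rw [Finset.sum_congr rfl h3, ← Finset.mul_sum, sum_powerset_alternating]
    have hle : D.card ≤ m := by simpa using Finset.card_le_univ D
    have hc : (Finset.univ \ D).card = m - D.card := by
      rw [Finset.card_sdiff_of_subset (Finset.subset_univ D)]
      simp
    rw [hc, hd, show D.card + (m - D.card) + 1 = m + 1 by omega, Nat.cast_choose ℚ hle,
      Nat.factorial_succ]
    have h4 : (m.factorial : ℚ) ≠ 0 := by exact_mod_cast Nat.factorial_ne_zero _
    have h5 : (D.card.factorial : ℚ) ≠ 0 := by exact_mod_cast Nat.factorial_ne_zero _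
    have h6 : ((m - D.card).factorial : ℚ) ≠ 0 := by exact_mod_cast Nat.factorial_ne_zero _
    have h7 : (m : ℚ) + 1 ≠ 0 := by positivity
    push_cast
    field_simp
  · intro t ht t' ht' h
    have ht := Finset.mem_powerset.1 ht
    have ht' := Finset.mem_powerset.1 ht'
    have h8 : ∀ {u : Finset (Fin m)}, u ⊆ Finset.univ \ D → (D ∪ u) \ D = u := by
      intro u hu
      rw [Finset.union_sdiff_left]
      exact Finset.sdiff_eq_self_of_disjoint (Finset.disjoint_of_subset_left hu Finset.sdiff_disjoint)
    rw [← h8 ht, ← h8 ht']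
    exact congrArg (· \ D) h

theorem eulerianCoeff_eq {m : ℕ} (σ : Equiv.Perm (Fin (m + 1))) :
    eulerianCoeff σ = wordCoeff σ / (m + 1) := by
  rw [wordCoeff_eq, eulerianCoeff, div_div, one_div, inv_mul_eq_div, div_div]
  congr 1
  ring

end Eulerian

/-! ### Multilinear maps along compositions and on tensor products. -/

section Multilinear

variable {𝕜 : Type*} [Field 𝕜]

/-- The composition of multilinear maps along the blocks of a composition. -/
def compBlocks {E F G : Type*} [AddCommGroup E] [Module 𝕜 E] [AddCommGroup F] [Module 𝕜 F]
    [AddCommGroup G] [Module 𝕜 G] {n : ℕ} (c : Composition n)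
    (f : MultilinearMap 𝕜 (fun _ : Fin c.length => F) G)
    (p : ∀ j, MultilinearMap 𝕜 (fun _ : Fin (c.blocksFun j) => E) F) :
    MultilinearMap 𝕜 (fun _ : Fin n => E) G :=
  have update : ∀ (i : DecidableEq (Fin n)) (v : Fin n → E) (k : Fin n) (z : E),
      (fun j => p j (Function.update v k z ∘ c.embedding j)) =
      Function.update (fun j => p j (v ∘ c.embedding j)) (c.index k)
        (p (c.index k) (Function.update (v ∘ c.embedding (c.index k)) (c.invEmbedding k) z)) := by
    intro _ v k z
    ext j
    by_cases h : j = c.index k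
    · subst h
      rw [Function.update_self, ← Function.update_comp_eq_of_injective _ (c.embedding _).injective,
        c.embedding_comp_inv]
    · rw [Function.update_of_ne h, Function.update_comp_eq_of_notMem_range]
      rwa [c.mem_range_embedding_iff']
  MultilinearMap.mk' (fun v => f fun j => p j (v ∘ c.embedding j))
    (fun v k x y => by
      rw [update, update, update, (p _).map_update_add, f.map_update_add])
    (fun v k a x => by
      rw [update, update, (p _).map_update_smul, f.map_update_smul])

/-- The nested brackets in the recursion, as a multilinear map. -/
def nestBlocks {E : Type*} [AddCommGroup E] [Module 𝕜 E] (b : E →ₗ[𝕜] E →ₗ[𝕜] E)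
    (M : ∀ n, MultilinearMap 𝕜 (fun _ : Fin n => E) E) {n : ℕ} (c : Composition n) :
    MultilinearMap 𝕜 (fun _ : Fin (n + 1) => E) E :=
  (compBlocks c ((MultilinearMap.mkPiAlgebraFin 𝕜 c.length (Module.End 𝕜 E)).compLinearMap
    fun _ => b) fun j => M (c.blocksFun j)).uncurryRight

theorem nestBlocks_apply {E : Type*} [AddCommGroup E] [Module 𝕜 E] (b : E →ₗ[𝕜] E →ₗ[𝕜] E)
    (M : ∀ n, MultilinearMap 𝕜 (fun _ : Fin n => E) E) {n : ℕ} (c : Composition n)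
    (l : Fin (n + 1) → E) : nestBlocks b M c l =
      act b (fun j => M (c.blocksFun j) fun i => l (c.embedding j i).castSucc) (l (Fin.last n)) := by
  rw [act_eq_prod]
  rfl

/-- The multilinear map `(r_i ⊗ x_i) ↦ F(r) ⊗ G(x)`. -/
def tmulMulti {V V' W W' : Type*} [AddCommGroup V] [Module 𝕜 V] [AddCommGroup V'] [Module 𝕜 V']
    [AddCommGroup W] [Module 𝕜 W] [AddCommGroup W'] [Module 𝕜 W'] {n : ℕ}
    (F : MultilinearMap 𝕜 (fun _ : Fin n => V) W) (G : MultilinearMap 𝕜 (fun _ : Fin n => V') W') :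
    MultilinearMap 𝕜 (fun _ : Fin n => V ⊗[𝕜] V') (W ⊗[𝕜] W') :=
  (TensorProduct.map
      (tensorLift fun k => if h : n = k then F.domDomCongr (finCongr h) else 0)
      (tensorLift fun k => if h : n = k then G.domDomCongr (finCongr h) else 0)).compMultilinearMap
    ((MultilinearMap.mkPiAlgebraFin 𝕜 n (TensorAlgebra 𝕜 V ⊗[𝕜] TensorAlgebra 𝕜 V')).compLinearMap
      fun _ => TensorProduct.map (TensorAlgebra.ι 𝕜) (TensorAlgebra.ι 𝕜))

/-- Multiplying the `a_i ⊗ x_i` in the product of two tensor algebras separates the factors; `F` and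
`G` are then applied as linear maps concentrated in degree `n`. -/
theorem tmulMulti_tmul {V V' W W' : Type*} [AddCommGroup V] [Module 𝕜 V] [AddCommGroup V']
    [Module 𝕜 V'] [AddCommGroup W] [Module 𝕜 W] [AddCommGroup W'] [Module 𝕜 W'] {n : ℕ}
    (F : MultilinearMap 𝕜 (fun _ : Fin n => V) W) (G : MultilinearMap 𝕜 (fun _ : Fin n => V') W')
    (a : Fin n → V) (x : Fin n → V') : tmulMulti F G (fun i => a i ⊗ₜ x i) = F a ⊗ₜ G x := by
  rw [tmulMulti, LinearMap.compMultilinearMap_apply, MultilinearMap.compLinearMap_apply,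
    MultilinearMap.mkPiAlgebraFin_apply]
  simp only [TensorProduct.map_tmul]
  rw [prod_ofFn_tmul, TensorProduct.map_tmul, tensorLift_prod, tensorLift_prod, dif_pos rfl,
    dif_pos rfl]
  rfl

variable {R : Type*} [CommRing R] [Algebra 𝕜 R]

/-- Iterated integrals as multilinear maps. -/
def iteratedPathMulti (J : R →ₗ[𝕜] R) : ∀ n, MultilinearMap 𝕜 (fun _ : Fin n => R) R
  | 0 => MultilinearMap.constOfIsEmpty 𝕜 _ 1
  | n + 1 => (((LinearMap.mul 𝕜 R).compr₂ J).compMultilinearMap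
      (iteratedPathMulti J n)).uncurryRight

theorem iteratedPathMulti_apply (J : R →ₗ[𝕜] R) : ∀ {n : ℕ} (a : Fin n → R),
    iteratedPathMulti J n a = iteratedPath J a
  | 0, _ => rfl
  | n + 1, a => by
    rw [iteratedPath, ← iteratedPathMulti_apply]
    rfl

end Multilinear

/-! ### Agreement of the explicit formula and the recursion. -/

section Explicit

variable {𝕜 g : Type*} [Field 𝕜] [CharZero 𝕜] [AddCommGroup g] [Module 𝕜 g] {L : DGLieAlgebra 𝕜 g}
  {R : Type*} [CommRing R] [Algebra 𝕜 R]

theorem isParity_lTensor : IsParity (L.degExt R) fun b => LinearMap.lTensor R (L.parity b) := by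
  intro i u b hu
  induction hu using degExt_induction with
  | zero => simp
  | add u v _ _ hu hv => rw [map_add, hu, hv]; split_ifs <;> simp
  | tmul a x hx =>
    rw [LinearMap.lTensor_tmul, L.isParity_parity b hx]
    split_ifs <;> simp

theorem multilinear_eq_of_degExt {W : Type*} [AddCommGroup W] [Module 𝕜 W] : ∀ {n : ℕ}
    (f f' : MultilinearMap 𝕜 (fun _ : Fin n => R ⊗[𝕜] g) W) (q : Fin n → ℤ)
    (_ : ∀ (a : Fin n → R) (x : Fin n → g), (∀ i, x i ∈ L.deg (q i)) →
      f (fun i => a i ⊗ₜ x i) = f' fun i => a i ⊗ₜ x i)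
    (l : Fin n → R ⊗[𝕜] g), (∀ i, l i ∈ L.degExt R (q i)) → f l = f' l
  | 0, f, f', q, h, l, _ => by
    rw [Subsingleton.elim l fun i => (Fin.elim0 i : R) ⊗ₜ (Fin.elim0 i : g)]
    exact h _ _ fun i => i.elim0
  | n + 1, f, f', q, h, l, hl => by
    have key : ∀ u ∈ L.degExt R (q 0), f.curryLeft u (fun i => l i.succ) =
        f'.curryLeft u (fun i => l i.succ) := by
      intro u hu
      induction hu using degExt_induction with
      | zero => simp
      | add u v _ _ hu hv =>
        rw [map_add, map_add, _root_.add_apply, _root_.add_apply, hu, hv]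
      | tmul a₀ x₀ hx₀ =>
        refine multilinear_eq_of_degExt _ _ (fun i => q i.succ) (fun a x hx => ?_) _
          fun i => hl i.succ
        have h1 : (Fin.cons (a₀ ⊗ₜ x₀) fun i => a i ⊗ₜ x i : Fin (n + 1) → R ⊗[𝕜] g) =
            fun i => (Fin.cons a₀ a : Fin (n + 1) → R) i ⊗ₜ (Fin.cons x₀ x : Fin (n + 1) → g) i := by
          funext i
          refine Fin.cases ?_ (fun i => ?_) i <;> rfl
        rw [MultilinearMap.curryLeft_apply, MultilinearMap.curryLeft_apply, h1]
        refine h _ _ fun i => ?_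
        refine Fin.cases ?_ (fun i => ?_) i
        exacts [hx₀, hx i]
    have := key _ (hl 0)
    rw [MultilinearMap.curryLeft_apply, MultilinearMap.curryLeft_apply] at this
    have h2 : (Fin.cons (l 0) fun i => l i.succ : Fin (n + 1) → R ⊗[𝕜] g) = l := Fin.cons_self_tail l
    rwa [h2] at this

variable (L) in
/-- The maps given by the explicit formula. -/
def explicitTerm (J : R →ₗ[𝕜] R) (n : ℕ) : MultilinearMap 𝕜 (fun _ : Fin n => R ⊗[𝕜] g) (R ⊗[𝕜] g) :=
  parityExtend (fun b => LinearMap.lTensor R (L.parity b)) fun q =>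
    ∑ ρ : Equiv.Perm (Fin n), koszulSign q ρ •
      (tmulMulti (iteratedPathMulti J n) (lieTermMulti L (q ∘ ρ))).domDomCongr ρ

variable {J : R →ₗ[𝕜] R}

theorem explicitTerm_tmul {n : ℕ} (q : Fin n → ℤ) (a : Fin n → R) (x : Fin n → g)
    (hx : ∀ i, x i ∈ L.deg (q i)) : explicitTerm L J n (fun i => a i ⊗ₜ x i) =
      ∑ ρ : Equiv.Perm (Fin n), koszulSign q ρ •
        (iteratedPath J (a ∘ ρ) ⊗ₜ lieTerm L (q ∘ ρ) (x ∘ ρ)) := by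
  rw [explicitTerm, parityExtend_apply isParity_lTensor (q := q) _ _
    fun i => tmul_mem_degExt _ (hx i), _root_.sum_apply]
  · refine Finset.sum_congr rfl fun ρ _ => ?_
    rw [_root_.smul_apply, MultilinearMap.domDomCongr_apply,
      tmulMulti_tmul _ _ (fun i => a (ρ i)) fun i => x (ρ i), iteratedPathMulti_apply,
      lieTermMulti_apply]
    rfl
  · intro q q' h
    refine Finset.sum_congr rfl fun ρ _ => ?_
    rw [koszulSign_congr h, lieTermMulti_congr (q := q ∘ ρ) (q' := q' ∘ ρ) fun i => h _]

/-- Replacing the outer permutation by `τ σ⁻¹` merges the two Koszul signs by the cocycle rule and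
moves `σ` from the bracket to the time variables. -/
theorem explicitTerm_tmul_eq {n : ℕ} (q : Fin (n + 1) → ℤ) (a : Fin (n + 1) → R)
    (x : Fin (n + 1) → g) (hx : ∀ i, x i ∈ L.deg (q i)) :
    explicitTerm L J (n + 1) (fun i => a i ⊗ₜ x i) =
      ∑ σ : Equiv.Perm (Fin (n + 1)), ∑ τ : Equiv.Perm (Fin (n + 1)),
        koszulSign q τ • (eulerianCoeff σ : 𝕜) • (iteratedPath J (a ∘ τ ∘ σ.symm) ⊗ₜ
          nestedBracket (fun x y => L.bracket x y) (x ∘ τ)) := by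
  rw [explicitTerm_tmul q a x hx]
  simp only [lieTerm, TensorProduct.tmul_sum, Finset.smul_sum]
  rw [Finset.sum_comm]
  refine Finset.sum_congr rfl fun σ _ => ?_
  rw [← Equiv.sum_comp (Equiv.mulRight σ⁻¹)]
  refine Finset.sum_congr rfl fun τ _ => ?_
  have h1 : koszulSign q τ = koszulSign q (τ * σ⁻¹) * koszulSign (q ∘ (τ * σ⁻¹ : Equiv.Perm _)) σ := by
    rw [← koszulSign_mul, inv_mul_cancel_right]
  have h2 : (x ∘ (τ * σ⁻¹ : Equiv.Perm _)) ∘ σ = x ∘ τ := by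
    funext i
    simp
  rw [Equiv.coe_mulRight, h1, h2, eulerianCoeff_eq, mul_smul, TensorProduct.tmul_smul,
    TensorProduct.tmul_smul]
  rfl

/-- On the left `wordCoeff` comes from the Lie element and multiplies words in `A`; on the right it
comes from shuffles and multiplies iterated integrals. The substitution of `τ σ⁻¹` turns one double
sum into the other. -/
theorem lTensor_explicitTerm {A : Type*} [Ring A] [Algebra 𝕜 A] {φ : ℕ → g →ₗ[𝕜] A}
    (hφ : IsWeightedHom L φ) (hJ : IsRotaBaxter J) {n : ℕ} (q : Fin n → ℤ) (a : Fin n → R)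
    (x : Fin n → g) (m : Fin n → ℕ) (hx : ∀ i, x i ∈ L.deg (q i)) :
    LinearMap.lTensor R (φ (∑ i, m i)) (explicitTerm L J n fun i => a i ⊗ₜ x i) =
      ∑ τ : Equiv.Perm (Fin n), koszulSign q τ •
        (logIntegral J (a ∘ τ) ⊗ₜ (List.ofFn fun i => φ (m (τ i)) (x (τ i))).prod) := by
  rw [explicitTerm_tmul q a x hx, map_sum]
  have h1 : ∀ ρ : Equiv.Perm (Fin n), φ (∑ i, m i) (lieTerm L (q ∘ ρ) (x ∘ ρ)) =
      ∑ τ : Equiv.Perm (Fin n), koszulSign (q ∘ ρ) τ • ((wordCoeff τ : 𝕜) •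
        (List.ofFn fun i => φ (m (ρ (τ i))) (x (ρ (τ i)))).prod) := fun ρ => by
    rw [← Equiv.sum_comp ρ m]
    exact hφ.lieTerm (q ∘ ρ) (x ∘ ρ) (m ∘ ρ) fun i => hx _
  simp only [LinearMap.map_smul_of_tower, LinearMap.lTensor_tmul, h1, TensorProduct.tmul_sum,
    Finset.smul_sum, logIntegral_eq_sum hJ, TensorProduct.sum_tmul]
  rw [Finset.sum_comm, Finset.sum_comm (s := Finset.univ) (t := Finset.univ)
    (f := fun τ σ => koszulSign q τ • (((wordCoeff σ : 𝕜) • iteratedPath J ((a ∘ τ) ∘ σ.symm)) ⊗ₜ[𝕜]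
      (List.ofFn fun i => φ (m (τ i)) (x (τ i))).prod))]
  refine Finset.sum_congr rfl fun σ _ => ?_
  rw [← Equiv.sum_comp (Equiv.mulRight σ⁻¹)]
  refine Finset.sum_congr rfl fun τ _ => ?_
  have h2 : koszulSign q τ = koszulSign q (τ * σ⁻¹) * koszulSign (q ∘ (τ * σ⁻¹ : Equiv.Perm _)) σ := by
    rw [← koszulSign_mul, inv_mul_cancel_right]
  have h3 : (fun i => φ (m ((τ * σ⁻¹ : Equiv.Perm _) (σ i))) (x ((τ * σ⁻¹ : Equiv.Perm _) (σ i)))) =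
      fun i => φ (m (τ i)) (x (τ i)) := by
    funext i
    simp
  rw [Equiv.coe_mulRight, h2, h3, mul_smul, TensorProduct.tmul_smul, TensorProduct.tmul_smul,
    TensorProduct.smul_tmul']
  rfl

theorem lTensor_toEnv_explicitTerm (hJ : IsRotaBaxter J) {n : ℕ} (q : Fin n → ℤ) (a : Fin n → R)
    (x : Fin n → g) (hx : ∀ i, x i ∈ L.deg (q i)) :
    LinearMap.lTensor R L.toEnv (explicitTerm L J n fun i => a i ⊗ₜ x i) =
      ∑ τ : Equiv.Perm (Fin n), koszulSign q τ •
        (logIntegral J (a ∘ τ) ⊗ₜ (List.ofFn fun i => L.toEnv (x (τ i))).prod) :=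
  lTensor_explicitTerm isWeightedHom_toEnv hJ q a x (fun _ => 1) hx

theorem explicitTerm_eq_magnusTerm_tmul (hJ : IsRotaBaxter J) {n : ℕ} (q : Fin n → ℤ) (a : Fin n → R)
    (x : Fin n → g) (hx : ∀ i, x i ∈ L.deg (q i)) :
    explicitTerm L J n (fun i => a i ⊗ₜ x i) =
      magnusTerm (bracketExtLin L R) (LinearMap.rTensor g J) n q fun i => a i ⊗ₜ x i := by
  apply lTensor_toEnv_injective R
  rw [lTensor_toEnv_explicitTerm hJ q a x hx]
  exact (lTensor_magnusTerm hJ isWeightedHom_toEnv q a x (fun _ => 1) hx).symm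

/-- `magnusTerm` is not multilinear by construction, because the degrees are part of its data.
Inserting `explicitTerm` into the recursion gives a multilinear map `T`, which equals `magnusTerm`
on homogeneous arguments by induction and can be compared with `explicitTerm` on pure tensors. -/
theorem explicitTerm_eq_magnusTerm (hJ : IsRotaBaxter J) {n : ℕ} (q : Fin n → ℤ)
    (l : Fin n → R ⊗[𝕜] g) (hl : ∀ i, l i ∈ L.degExt R (q i)) :
    explicitTerm L J n l = magnusTerm (bracketExtLin L R) (LinearMap.rTensor g J) n q l := by
  induction n using Nat.strong_induction_on with
  | _ n ih =>
    cases n with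
    | zero =>
      rw [Subsingleton.elim l fun i => (Fin.elim0 i : R) ⊗ₜ (Fin.elim0 i : g)]
      exact explicitTerm_eq_magnusTerm_tmul hJ _ _ _ fun i => i.elim0
    | succ n =>
      let T : MultilinearMap 𝕜 (fun _ : Fin (n + 1) => R ⊗[𝕜] g) (R ⊗[𝕜] g) :=
        ∑ c : Composition n, (recursionCoeff c : 𝕜) • ∑ σ : Equiv.Perm (Fin (n + 1)),
          koszulSign q σ • ((LinearMap.rTensor g J).compMultilinearMap
            (nestBlocks (bracketExtLin L R) (explicitTerm L J) c)).domDomCongr σ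
      have hT : ∀ l, (∀ i, l i ∈ L.degExt R (q i)) →
          T l = magnusTerm (bracketExtLin L R) (LinearMap.rTensor g J) (n + 1) q l := by
        intro l hl
        rw [magnusTerm_succ]
        simp only [T, _root_.sum_apply, _root_.smul_apply,
          MultilinearMap.domDomCongr_apply, LinearMap.compMultilinearMap_apply, nestBlocks_apply]
        refine Finset.sum_congr rfl fun c _ => congrArg _ (Finset.sum_congr rfl fun σ _ => ?_)
        rw [magnusSummand]
        congr 3
        funext j
        exact ih _ (Nat.lt_succ_of_le (c.blocksFun_le j)) _ _ fun i => hl _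
      rw [← hT l hl]
      refine multilinear_eq_of_degExt _ _ q (fun a x hx => ?_) l hl
      rw [explicitTerm_eq_magnusTerm_tmul hJ q a x hx, hT _ fun i => tmul_mem_degExt _ (hx i)]

variable (L J) in
/-- The recursive formula, for functions with values in `g` and integration given by `J`. -/
def TensorRecursion (M : ∀ n, (Fin n → R ⊗[𝕜] g) → R ⊗[𝕜] g) : Prop :=
  (∀ (q : ℤ) (l : Fin 1 → R ⊗[𝕜] g), l 0 ∈ L.degExt R q →
    M 1 l = LinearMap.rTensor g J (l 0)) ∧
  ∀ (n : ℕ) (q : Fin (n + 2) → ℤ) (l : Fin (n + 2) → R ⊗[𝕜] g),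
    (∀ i, l i ∈ L.degExt R (q i)) →
    M (n + 2) l = ∑ c : Composition (n + 1), (recursionCoeff c : 𝕜) •
      ∑ σ : Equiv.Perm (Fin (n + 2)), koszulSign q σ •
        LinearMap.rTensor g J
          (nest (L.bracketExt R)
            (fun j => M (c.blocksFun j) (fun i => l (σ (c.embedding j i).castSucc)))
            (l (σ (Fin.last (n + 1)))))

theorem TensorRecursion.eq_magnusTerm {M : ∀ n, (Fin n → R ⊗[𝕜] g) → R ⊗[𝕜] g}
    (hM : TensorRecursion L J M) {n : ℕ} (q : Fin (n + 1) → ℤ) (l : Fin (n + 1) → R ⊗[𝕜] g)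
    (hl : ∀ i, l i ∈ L.degExt R (q i)) :
    M (n + 1) l = magnusTerm (bracketExtLin L R) (LinearMap.rTensor g J) (n + 1) q l := by
  induction n using Nat.strong_induction_on with
  | _ n ih =>
    cases n with
    | zero =>
      -- The only composition of zero is the empty one, with coefficient one, so the recursion
      -- degenerates to a single integral.
      have hs : Subsingleton (Equiv.Perm (Fin (0 + 1))) :=
        inferInstanceAs (Subsingleton (Equiv.Perm (Fin 1)))
      have hs' : Subsingleton (Composition 0) :=
        Fintype.card_le_one_iff_subsingleton.1 (composition_card 0).le
      rw [hM.1 (q 0) l (hl 0), magnusTerm_succ, Fintype.sum_subsingleton _ (Composition.ones 0),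
        Fintype.sum_subsingleton _ 1]
      have h2 : (Composition.ones 0).length = 0 := Nat.le_zero.1 (Composition.length_le _)
      have h3 : ∀ k, k = 0 → ∀ (b : R ⊗[𝕜] g →ₗ[𝕜] R ⊗[𝕜] g →ₗ[𝕜] R ⊗[𝕜] g) (u : Fin k → R ⊗[𝕜] g) w,
          act b u w = w := by
        rintro k rfl b u w
        exact act_zero b u w
      have h4 : recursionCoeff (Composition.ones 0) = 1 := by
        have : IsEmpty (Fin (Composition.ones 0).length) := by rw [h2]; infer_instance
        rw [recursionCoeff, Finset.prod_of_isEmpty, h2]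
        simp
      rw [koszulSign_one, magnusSummand, h3 _ h2, h4]
      simp
    | succ n =>
      rw [hM.2 n q l hl, magnusTerm_succ]
      refine Finset.sum_congr rfl fun c _ => congrArg _ (Finset.sum_congr rfl fun σ _ => ?_)
      rw [magnusSummand]
      congr 2
      refine (nest_eq_act (bracketExtLin L R) _ _).trans ?_
      congr 1
      funext j
      have h1 := c.one_le_blocksFun j
      have h2 := c.blocksFun_le j
      have key : ∀ (k : ℕ), 1 ≤ k → k ≤ n + 1 → ∀ (q : Fin k → ℤ) (l : Fin k → R ⊗[𝕜] g),
          (∀ i, l i ∈ L.degExt R (q i)) → M k l =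
            magnusTerm (bracketExtLin L R) (LinearMap.rTensor g J) k q l := by
        intro k hk hk' q l hl
        obtain ⟨k, rfl⟩ := Nat.exists_eq_add_of_le' hk
        exact ih k (by omega) q l hl
      exact key _ h1 h2 _ _ fun i => hl _

theorem tensorRecursion_explicitTerm (hJ : IsRotaBaxter J) :
    TensorRecursion L J fun n => explicitTerm L J n := by
  constructor
  · intro q l hl
    have hl' : ∀ i, l i ∈ L.degExt R ((fun _ => q) i) := fun i => by
      rw [Subsingleton.elim i 0]; exact hl
    refine multilinear_eq_of_degExt (explicitTerm L J 1) ((LinearMap.rTensor g J).compMultilinearMap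
      (MultilinearMap.ofSubsingleton 𝕜 (R ⊗[𝕜] g) (R ⊗[𝕜] g) (0 : Fin 1) LinearMap.id)) (fun _ => q)
      (fun a x hx => ?_) l hl'
    have hs : Subsingleton (Equiv.Perm (Fin (0 + 1))) :=
      inferInstanceAs (Subsingleton (Equiv.Perm (Fin 1)))
    rw [explicitTerm_tmul _ a x hx, Fintype.sum_subsingleton _ 1, koszulSign_one, lieTerm,
      Fintype.sum_subsingleton _ 1, koszulSign_one, wordCoeff_fin_one]
    simp [iteratedPath, nestedBracket, nest]
  · intro n q l hl
    refine (explicitTerm_eq_magnusTerm hJ q l hl).trans ?_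
    rw [magnusTerm_succ]
    refine Finset.sum_congr rfl fun c _ => congrArg _ (Finset.sum_congr rfl fun σ _ => ?_)
    rw [magnusSummand]
    congr 2
    refine Eq.trans ?_ (nest_eq_act (bracketExtLin L R) _ _).symm
    congr 1
    funext j
    exact (explicitTerm_eq_magnusTerm hJ _ _ fun i => hl _).symm

theorem TensorRecursion.eq_explicitTerm (hJ : IsRotaBaxter J)
    {M : ∀ n, (Fin n → R ⊗[𝕜] g) → R ⊗[𝕜] g}
    (hM : TensorRecursion L J M) {n : ℕ} (q : Fin (n + 1) → ℤ) (l : Fin (n + 1) → R ⊗[𝕜] g)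
    (hl : ∀ i, l i ∈ L.degExt R (q i)) : M (n + 1) l = explicitTerm L J (n + 1) l := by
  rw [hM.eq_magnusTerm q l hl, explicitTerm_eq_magnusTerm hJ q l hl]

end Explicit

/-! ### Compositions with one block and the inverse of the exponential. -/

section CompositionTerms

/-- This isolates the transport along the equalities `c.length = 1` and block size `= n`. -/
theorem taylor_single_aux {U V W : Type*} (G : ∀ n, (Fin n → V) → W) (F : ∀ n, (Fin n → U) → V)
    {n : ℕ} (v : Fin n → U) (c : Composition n) (hc : c.length = 1) :
    G c.length (fun j => F (c.blocksFun j) (v ∘ c.embedding j)) = G 1 fun _ => F n v := by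
  have h1 : ∀ (m : ℕ) (_ : m = n) (e : Fin m → Fin n) (_ : ∀ i, (e i : ℕ) = i),
      F m (v ∘ e) = F n v := by
    rintro m rfl e he
    have : e = id := funext fun i => Fin.ext (he i)
    rw [this]
    rfl
  have hb : ∀ j, c.blocksFun j = n := by
    intro j
    have h := c.sum_blocksFun
    have hs : Subsingleton (Fin c.length) := by rw [hc]; infer_instance
    rwa [Fintype.sum_subsingleton _ j] at h
  have hz : ∀ j : Fin c.length, (j : ℕ) = 0 := fun j => by have := j.2; omega
  have h2 : (fun j => F (c.blocksFun j) (v ∘ c.embedding j)) = fun _ => F n v := by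
    funext j
    refine h1 _ (hb j) _ fun i => ?_
    rw [Composition.coe_embedding, hz j, Composition.sizeUpTo_zero, zero_add]
  rw [h2]
  have h3 : ∀ k, k = 1 → G k (fun _ => F n v) = G 1 fun _ => F n v := by
    rintro k rfl
    rfl
  exact h3 _ hc

theorem length_composition_one (c : Composition 1) : c.length = 1 := by
  have := c.length_pos_of_pos one_pos
  have := c.length_le
  omega

theorem card_composition_one : Fintype.card (Composition 1) = 1 := composition_card 1

theorem sum_composition_one {M : Type*} [AddCommMonoid M] (F : Composition 1 → M) :
    ∑ c, F c = F (Composition.ones 1) := by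
  have : Subsingleton (Composition 1) := Fintype.card_le_one_iff_subsingleton.1 card_composition_one.le
  exact Fintype.sum_subsingleton _ _

theorem compTaylor_one {U V W : Type*} [AddCommMonoid W] (G : ∀ n, (Fin n → V) → W)
    (F : ∀ n, (Fin n → U) → V) (v : Fin 1 → U) : compTaylor G F 1 v = G 1 fun _ => F 1 v := by
  rw [compTaylor, sum_composition_one]
  exact taylor_single_aux G F v _ (length_composition_one _)

theorem composition_zero_length (c : Composition 0) : c.length = 0 := Nat.le_zero.1 c.length_le

open PowerSeries in
-- The left side is the coefficient of degree `n` of `(exp - 1)(log) = X`.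
theorem sum_composition_inv_factorial_logCoeff (𝕜 : Type*) [Field 𝕜] [CharZero 𝕜] {n : ℕ}
    (hn : 0 < n) : ∑ c : Composition n, ((c.length.factorial : 𝕜)⁻¹) *
      ∏ j, ((logCoeff (c.blocksFun j) : ℚ) : 𝕜) = if n = 1 then 1 else 0 := by
  have h3 : ∀ k, ((logCoeff k : ℚ) : 𝕜) = coeff k (log 𝕜) := by
    intro k
    rw [coeff_log, logCoeff]
    split_ifs with h
    · simp [h]
    · simp
  have h0 : ((logCoeff 0 : ℚ) : 𝕜) = 0 := by simp [logCoeff]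
  have h := sum_composition_act (LinearMap.mul 𝕜 𝕜) (fun k => ((logCoeff k : ℚ) : 𝕜)) h0 1 n n le_rfl
    (fun m => coeff m (exp 𝕜 - 1))
  simp only [nestCoeff_mul] at h
  have h4 : (mk fun k => ((logCoeff k : ℚ) : 𝕜)) = log 𝕜 := by
    ext k
    rw [coeff_mk, h3]
  simp only [h4, smul_eq_mul] at h
  rw [sum_coeff_mul_coeff_pow (by rw [← h3, h0]) le_rfl, exp_sub_one_subst_log, coeff_X] at h
  rw [← h]
  refine Finset.sum_congr rfl fun c _ => ?_
  congr 1
  · have := c.length_pos_of_pos hn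
    rw [map_sub, coeff_exp, coeff_one, if_neg this.ne', sub_zero]
    simp
  · rw [← List.prod_ofFn]
    rfl

end CompositionTerms

/-! ### The coefficients of `exp`, `log` and `φ`. -/

section PathIntegral

variable {𝕜 R : Type*} [Field 𝕜] [CommRing R] [Algebra 𝕜 R]

/-- The integrals of the function algebra `S` are iterated integrals, for the integration `J`. -/
structure IsPathIntegral (S : FunctionAlgebra 𝕜 R) (J : R →ₗ[𝕜] R) (e₀ e₁ : R →ₐ[𝕜] 𝕜) : Prop where
  ev0 : ∀ f, S.ev0 f = e₀ f
  ev1 : ∀ f, S.ev1 f = e₁ f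
  coord0 : e₀ S.coord = 0
  coord1 : e₁ S.coord = 1
  integral : ∀ n a, S.iteratedIntegral n a = e₁ (iteratedPath J a)
  rotaBaxter : IsRotaBaxter J
  integral_one : e₁ (J 1) = 1

theorem iteratedPath_of_eq_zero (J : R →ₗ[𝕜] R) {n : ℕ} {a : Fin n → R} (i : Fin n) (h : a i = 0) :
    iteratedPath J a = 0 := by
  rw [← iteratedPathMulti_apply]
  exact MultilinearMap.map_coord_zero _ i h

variable {J : R →ₗ[𝕜] R}

/-- If all labels are different, every permutation is a shuffle, and all of them give the same
iterated integral. -/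
theorem IsRotaBaxter.factorial_smul_iteratedPath_one (hJ : IsRotaBaxter J) (n : ℕ) :
    (n.factorial : 𝕜) • iteratedPath J (fun _ : Fin n => (1 : R)) = J 1 ^ n := by
  classical
  have h := hJ.prod_listPath (id : Fin n → Fin n) fun _ => (1 : R)
  have h1 : ∀ j : Fin n, fibreList (id : Fin n → Fin n) j = [j] := fun j =>
    eq_fibreList (List.pairwise_singleton _ _) fun i => by simp
  have h2 : ∀ ρ : Equiv.Perm (Fin n), FibreMono (id : Fin n → Fin n) ρ := fun ρ p p' hp hlt =>
    absurd (ρ.injective hp) hlt.ne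
  have h3 : ∀ j : Fin n, listPath J ((@fibreList _ _ (fun a b => Classical.propDecidable (a = b))
      (id : Fin n → Fin n) j).map fun _ => (1 : R)) = J 1 := by
    intro j
    have : @fibreList _ _ (fun a b => Classical.propDecidable (a = b)) (id : Fin n → Fin n) j = [j] := by
      rw [← h1]
      congr!
    rw [this]
    simp [listPath]
  rw [Finset.prod_congr rfl fun j _ => h3 j, Finset.prod_const, Finset.card_univ, Fintype.card_fin,
    Finset.sum_congr rfl fun ρ _ => if_pos (h2 ρ)] at h
  rw [h, Nat.cast_smul_eq_nsmul]
  simp [Function.comp_def, Fintype.card_perm]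

variable {S : FunctionAlgebra 𝕜 R} {e₀ e₁ : R →ₐ[𝕜] 𝕜}

theorem IsPathIntegral.gugenheim_snd (hS : IsPathIntegral S J e₀ e₁) {n : ℕ} (hn : 0 < n) (v : Fin n → Forms R) :
    (gugenheim S n v).2 = e₁ (iteratedPath J fun i => (v i).2) := by
  match n, v with
  | 1, v => exact hS.integral _ _
  | n + 2, v => exact hS.integral _ _

theorem gugenheim_fst {n : ℕ} (hn : n ≠ 1) (v : Fin n → Forms R) : (gugenheim S n v).1 = 0 := by
  match n, v with
  | 0, v => rfl
  | n + 2, v => rfl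

variable [CharZero 𝕜]

theorem IsPathIntegral.eval_iteratedPath_const (hS : IsPathIntegral S J e₀ e₁) {n : ℕ} (a : Fin n → 𝕜) :
    e₁ (iteratedPath J fun i => algebraMap 𝕜 R (a i)) = (n.factorial : 𝕜)⁻¹ * ∏ i, a i := by
  have h1 : iteratedPath J (fun i => algebraMap 𝕜 R (a i)) =
      (∏ i, a i) • iteratedPath J (fun _ : Fin n => (1 : R)) := by
    simp only [← iteratedPathMulti_apply, Algebra.algebraMap_eq_smul_one]
    exact (iteratedPathMulti J n).map_smul_univ a fun _ => 1
  have h2 := congrArg e₁ (hS.rotaBaxter.factorial_smul_iteratedPath_one n)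
  rw [map_smul, map_pow, hS.integral_one, one_pow, smul_eq_mul] at h2
  have h3 : (n.factorial : 𝕜) ≠ 0 := by exact_mod_cast Nat.factorial_ne_zero n
  rw [h1, map_smul, smul_eq_mul, eq_inv_of_mul_eq_one_right h2, mul_comm]

theorem muMorphism_snd {n : ℕ} (v : Fin n → Whitney 𝕜) :
    (muMorphism S n v).2 = algebraMap 𝕜 R (if n = 1 then ∏ i, (v i).2 else 0) := by
  match n, v with
  | 0, v => simp [muMorphism]
  | 1, v => simp [muMorphism]
  | n + 2, v => simp [muMorphism]

/-- For `n ≥ 2` the Bernoulli polynomial takes the value `B_n` at both `0` and `1`. -/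
theorem IsPathIntegral.muMorphism_fst (hS : IsPathIntegral S J e₀ e₁) {n : ℕ} (v : Fin (n + 2) → Whitney 𝕜) :
    e₀ (muMorphism S (n + 2) v).1 = 0 ∧ e₁ (muMorphism S (n + 2) v).1 = 0 := by
  have h1 : ∀ (e : R →ₐ[𝕜] 𝕜) (r : ℚ), e S.coord = algebraMap ℚ 𝕜 r →
      (Polynomial.bernoulli (n + 2)).eval r = bernoulli (n + 2) →
      e (muMorphism S (n + 2) v).1 = 0 := by
    intro e r he hr
    have h2 : e (Polynomial.aeval S.coord ((Polynomial.bernoulli (n + 2)).map (algebraMap ℚ 𝕜)) -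
        algebraMap 𝕜 R (algebraMap ℚ 𝕜 (bernoulli (n + 2)))) = 0 := by
      rw [map_sub, AlgHom.commutes, ← Polynomial.aeval_algHom_apply, he, Polynomial.coe_aeval_eq_eval,
        Polynomial.eval_map_algebraMap, Polynomial.aeval_algebraMap_apply, Polynomial.coe_aeval_eq_eval, hr]
      exact sub_self _
    simp only [muMorphism, map_sum, map_smul, h2, smul_zero, Finset.sum_const_zero]
  constructor
  · exact h1 e₀ 0 (by rw [hS.coord0, map_zero]) (Polynomial.bernoulli_eval_zero _)
  · refine h1 e₁ 1 (by rw [hS.coord1, map_one]) ?_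
    rw [Polynomial.bernoulli_eval_one, bernoulli_eq_bernoulli'_of_ne_one (by omega)]

/-- For one block `λ_1` takes the values of `μ_n` at the ends, which vanish; otherwise the
coefficient of `λ` has no function part. -/
theorem IsPathIntegral.expMorphism_fst (hS : IsPathIntegral S J e₀ e₁) {n : ℕ} (hn : n ≠ 1) (v : Fin n → Whitney 𝕜) :
    (expMorphism S n v).1 = 0 := by
  rw [expMorphism, compTaylor, Prod.fst_sum]
  refine Finset.sum_eq_zero fun c _ => ?_
  by_cases hc : c.length = 1
  · rw [taylor_single_aux (gugenheim S) (muMorphism S) v c hc]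
    match n, v with
    | 0, v => rw [composition_zero_length] at hc; omega
    | n + 2, v =>
      refine Prod.ext ?_ ?_
      · exact (hS.ev1 _).trans (hS.muMorphism_fst v).2
      · exact (hS.ev0 _).trans (hS.muMorphism_fst v).1
  · exact gugenheim_fst hc _

/-- `λ` sees only one-form parts, and a higher `μ` has none. So all blocks have size one, and the
volume `1 / n!` of the simplex remains. -/
theorem IsPathIntegral.expMorphism_snd (hS : IsPathIntegral S J e₀ e₁) {n : ℕ} (hn : 0 < n) (v : Fin n → Whitney 𝕜) :
    (expMorphism S n v).2 = (n.factorial : 𝕜)⁻¹ * ∏ i, (v i).2 := by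
  rw [expMorphism, compTaylor, Prod.snd_sum]
  have h1 : ∀ c : Composition n, (gugenheim S c.length fun j =>
      muMorphism S (c.blocksFun j) (v ∘ c.embedding j)).2 = (c.length.factorial : 𝕜)⁻¹ *
        ∏ j, if c.blocksFun j = 1 then ∏ i, (v (c.embedding j i)).2 else 0 := by
    intro c
    rw [hS.gugenheim_snd (c.length_pos_of_pos hn)]
    simp only [muMorphism_snd]
    exact hS.eval_iteratedPath_const _
  simp only [h1]
  rw [Finset.sum_eq_single (Composition.ones n)]
  · have h2 : ∀ j, (Composition.ones n).blocksFun j = 1 := fun j => Composition.ones_blocksFun n j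
    simp only [h2, if_true]
    rw [(Composition.ones n).prod_prod_apply_embedding (fun i => (v i).2), Composition.ones_length]
  · intro c _ hc
    obtain ⟨j, hj⟩ : ∃ j, c.blocksFun j ≠ 1 := by
      by_contra! h
      refine hc (Composition.eq_ones_iff.2 fun i hi => ?_)
      rw [← c.ofFn_blocksFun, List.mem_ofFn'] at hi
      obtain ⟨j, rfl⟩ := hi
      exact h j
    rw [Finset.prod_eq_zero (Finset.mem_univ j) (if_neg hj), mul_zero]
  · simp

theorem IsPathIntegral.logMorphism_fst (hS : IsPathIntegral S J e₀ e₁) {n : ℕ} (hn : n ≠ 1) (v : Fin n → Whitney 𝕜) :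
    (logMorphism S n v).1 = 0 := by
  match n, v with
  | 0, v => rw [logMorphism, invTaylor]; rfl
  | n + 2, v =>
    rw [logMorphism, invTaylor, Prod.fst_neg, Prod.fst_sum, Finset.sum_eq_zero, neg_zero]
    intro c _
    split_ifs with h
    · refine hS.expMorphism_fst (fun hc => ?_) _
      have hl : 0 < c.length := by omega
      have := h ⟨0, hl⟩
      have h3 := c.sum_blocksFun
      have hs : Subsingleton (Fin c.length) := by rw [hc]; infer_instance
      rw [Fintype.sum_subsingleton _ ⟨0, hl⟩] at h3
      omega
    · rfl

/-- On the `dt` component `exp` is `e^z - 1`, so the recursion for the inverse is solved by the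
coefficients of `log(1 + z)`. The composition with one block, which the recursion omits, carries the
coefficient `logCoeff n` to be found. -/
theorem IsPathIntegral.logMorphism_snd (hS : IsPathIntegral S J e₀ e₁) {n : ℕ} (v : Fin n → Whitney 𝕜) :
    (logMorphism S n v).2 = ((logCoeff n : ℚ) : 𝕜) * ∏ i, (v i).2 := by
  induction n using Nat.strong_induction_on with
  | _ n ih =>
    match n, v, ih with
    -- Division by zero makes `logCoeff 0` zero.
    | 0, v, _ => rw [logMorphism, invTaylor]; simp [logCoeff]
    | 1, v, _ => rw [logMorphism, invTaylor]; simp [logCoeff]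
    | n + 2, v, ih =>
      have hpos : 0 < n + 2 := by omega
      rw [logMorphism, invTaylor, Prod.snd_neg, Prod.snd_sum]
      have key := sum_composition_inv_factorial_logCoeff 𝕜 hpos
      rw [if_neg (by omega), ← Finset.add_sum_erase _ _ (Finset.mem_univ (Composition.single _ hpos))]
        at key
      have h1 : ∀ c ∈ Finset.univ.erase (Composition.single (n + 2) hpos),
          (if h : ∀ j, c.blocksFun j < n + 2 then expMorphism S c.length fun j =>
            invTaylor (expMorphism S) (c.blocksFun j) (v ∘ c.embedding j) else 0).2 =
          ((c.length.factorial : 𝕜)⁻¹ * ∏ j, ((logCoeff (c.blocksFun j) : ℚ) : 𝕜)) *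
            ∏ i, (v i).2 := by
        intro c hc
        have h := (Composition.ne_single_iff hpos).1 (Finset.ne_of_mem_erase hc)
        rw [dif_pos h, hS.expMorphism_snd (c.length_pos_of_pos hpos)]
        have h2 : ∀ j, (invTaylor (expMorphism S) (c.blocksFun j) (v ∘ c.embedding j)).2 =
            ((logCoeff (c.blocksFun j) : ℚ) : 𝕜) * ∏ i, (v (c.embedding j i)).2 :=
          fun j => ih _ (h j) _
        simp only [h2, Finset.prod_mul_distrib]
        rw [c.prod_prod_apply_embedding (fun i => (v i).2), mul_assoc]
      have h3 : (if h : ∀ j, (Composition.single (n + 2) hpos).blocksFun j < n + 2 then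
          expMorphism S (Composition.single (n + 2) hpos).length fun j =>
            invTaylor (expMorphism S) ((Composition.single (n + 2) hpos).blocksFun j)
              (v ∘ (Composition.single (n + 2) hpos).embedding j) else 0).2 = 0 := by
        rw [dif_neg]
        · rfl
        · intro hlt
          exact (Composition.ne_single_iff hpos).2 hlt rfl
      rw [← Finset.add_sum_erase _ _ (Finset.mem_univ (Composition.single _ hpos)), h3, zero_add,
        Finset.sum_congr rfl h1, ← Finset.sum_mul, ← neg_mul]
      congr 1
      have hs : (((Composition.single (n + 2) hpos).length.factorial : 𝕜)⁻¹) *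
          ∏ j, ((logCoeff ((Composition.single (n + 2) hpos).blocksFun j) : ℚ) : 𝕜) =
          ((logCoeff (n + 2) : ℚ) : 𝕜) := by
        have hl := Composition.single_length hpos
        have hu : Subsingleton (Fin (Composition.single (n + 2) hpos).length) := by
          rw [hl]; infer_instance
        rw [Fintype.prod_subsingleton _ ⟨0, by omega⟩, Composition.single_blocksFun, hl]
        simp
      rw [hs] at key
      linear_combination (-1 : 𝕜) * key

/-- The coefficients of `φ`. -/
theorem IsPathIntegral.phi_snd (hS : IsPathIntegral S J e₀ e₁) {n : ℕ} (v : Fin n → Forms R) :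
    (phi S n v).2 = e₁ (logIntegral J fun i => (v i).2) := by
  rw [phi, compTaylor, Prod.snd_sum, logIntegral, map_sum]
  refine Finset.sum_congr rfl fun c _ => ?_
  rw [hS.logMorphism_snd, map_mul, AlgHom.commutes, map_prod]
  congr 1
  refine Finset.prod_congr rfl fun j _ => ?_
  exact hS.gugenheim_snd (c.one_le_blocksFun j) _

theorem IsPathIntegral.phi_fst (hS : IsPathIntegral S J e₀ e₁) {n : ℕ} (hn : n ≠ 1) (v : Fin n → Forms R) : (phi S n v).1 = 0 := by
  rw [phi, compTaylor, Prod.fst_sum]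
  refine Finset.sum_eq_zero fun c _ => ?_
  by_cases hc : c.length = 1
  · rw [taylor_single_aux (logMorphism S) (gugenheim S) v c hc, logMorphism, invTaylor]
    exact gugenheim_fst hn v
  · exact hS.logMorphism_fst hc _

theorem IsPathIntegral.phi_one (hS : IsPathIntegral S J e₀ e₁) (v : Fin 1 → Forms R) :
    (phi S 1 v).1 = (e₁ (v 0).1, e₀ (v 0).1) := by
  rw [phi, compTaylor_one, logMorphism, invTaylor, gugenheim, hS.ev0, hS.ev1]

end PathIntegral

/-! ### Extension of scalars by the dg Lie algebra. -/

section ExtensionOfScalars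

variable {𝕜 R g : Type*} [Field 𝕜] [CommRing R] [Algebra 𝕜 R] [AddCommGroup g] [Module 𝕜 g]

theorem multilinear_ext_of_span {E W : Type*} [AddCommGroup E] [Module 𝕜 E] [AddCommGroup W]
    [Module 𝕜 W] {T : Set E} (hT : Submodule.span 𝕜 T = ⊤) : ∀ {n : ℕ}
    (f f' : MultilinearMap 𝕜 (fun _ : Fin n => E) W)
    (_ : ∀ v : Fin n → E, (∀ i, v i ∈ T) → f v = f' v), f = f'
  | 0, f, f', h => MultilinearMap.ext fun v => h v fun i => i.elim0
  | n + 1, f, f', h => by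
    have h1 : f.curryLeft = f'.curryLeft := by
      refine LinearMap.ext_on hT fun u hu => multilinear_ext_of_span hT _ _ fun v hv => ?_
      exact h _ (Fin.cases hu hv)
    exact MultilinearMap.ext fun v => by
      have := congrArg (fun F => F (v 0) (Fin.tail v)) h1
      simpa [MultilinearMap.curryLeft_apply] using this

variable {J : R →ₗ[𝕜] R}

section Scaling

variable {s : 𝕜} {κ : R →ₐ[𝕜] R}

/-- The hypothesis is the substitution rule for integrals, with `s` as the derivative of `t ↦ st`.
-/
theorem iteratedPath_scale (hκ : ∀ a, J (s • κ a) = κ (J a)) : ∀ {n : ℕ} (a : Fin n → R),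
    iteratedPath J (fun i => s • κ (a i)) = κ (iteratedPath J a)
  | 0, _ => (map_one κ).symm
  | n + 1, a => by
    rw [iteratedPath, iteratedPath, iteratedPath_scale hκ fun i => a i.castSucc, ← hκ, map_mul κ,
      mul_smul_comm]

theorem logIntegral_scale (hκ : ∀ a, J (s • κ a) = κ (J a)) {n : ℕ} (a : Fin n → R) :
    logIntegral J (fun i => s • κ (a i)) = κ (logIntegral J a) := by
  rw [logIntegral, logIntegral, map_sum]
  refine Finset.sum_congr rfl fun c _ => ?_
  rw [map_mul, AlgHom.commutes, map_prod]
  congr 1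
  refine Finset.prod_congr rfl fun j _ => ?_
  exact iteratedPath_scale hκ _

end Scaling

theorem logIntegral_of_eq_zero (J : R →ₗ[𝕜] R) {n : ℕ} {a : Fin n → R} (i : Fin n) (h : a i = 0) :
    logIntegral J a = 0 := by
  refine Finset.sum_eq_zero fun c _ => ?_
  rw [Finset.prod_eq_zero (Finset.mem_univ (c.index i)), mul_zero]
  refine iteratedPath_of_eq_zero J (c.invEmbedding i) ?_
  rw [Function.comp_apply, c.embedding_comp_inv, h]

section Extension

variable [CharZero 𝕜]

/-- The extension of scalars by `g` of the linear part of `φ_s`, on zero-forms. -/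
def endpointTerm (c : R →ₗ[𝕜] 𝕜 × 𝕜) :
    ∀ n, MultilinearMap 𝕜 (fun _ : Fin n => Forms R ⊗[𝕜] g) (Whitney 𝕜 ⊗[𝕜] g)
  | 1 => MultilinearMap.ofSubsingleton 𝕜 _ _ (0 : Fin 1)
      (LinearMap.rTensor g (LinearMap.inl 𝕜 (𝕜 × 𝕜) 𝕜 ∘ₗ c ∘ₗ LinearMap.fst 𝕜 R R))
  | _ => 0

variable (L : DGLieAlgebra 𝕜 g) (J) in
/-- The extension of scalars by `g` of the Taylor coefficients of `φ_s`; the endpoint values at the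
ends of the path are given by `c` and the evaluation of the integrals by `e`. -/
def extendedPhi (c : R →ₗ[𝕜] 𝕜 × 𝕜) (e : R →ₗ[𝕜] 𝕜) (n : ℕ) :
    MultilinearMap 𝕜 (fun _ : Fin n => Forms R ⊗[𝕜] g) (Whitney 𝕜 ⊗[𝕜] g) :=
  endpointTerm c n + (LinearMap.rTensor g (LinearMap.inr 𝕜 (𝕜 × 𝕜) 𝕜 ∘ₗ e)).compMultilinearMap
    ((explicitTerm L J n).compLinearMap fun _ => LinearMap.rTensor g (LinearMap.snd 𝕜 R R))

variable {L : DGLieAlgebra 𝕜 g}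

theorem endpointTerm_of_ne_one (c : R →ₗ[𝕜] 𝕜 × 𝕜) {n : ℕ} (hn : n ≠ 1) :
    endpointTerm (g := g) c n = 0 := by
  match n with
  | 0 => rfl
  | n + 2 => rfl

theorem endpointTerm_oneForm (c : R →ₗ[𝕜] 𝕜 × 𝕜) {n : ℕ} (l : Fin n → R ⊗[𝕜] g) :
    endpointTerm c n (fun i => oneForm (l i)) = 0 := by
  by_cases hn : n = 1
  · subst hn
    simp only [endpointTerm, MultilinearMap.ofSubsingleton_apply_apply, oneForm]
    rw [← LinearMap.comp_apply, ← LinearMap.rTensor_comp]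
    have : (LinearMap.inl 𝕜 (𝕜 × 𝕜) 𝕜 ∘ₗ c ∘ₗ LinearMap.fst 𝕜 R R) ∘ₗ LinearMap.inr 𝕜 R R = 0 := by
      ext <;> simp
    rw [this, LinearMap.rTensor_zero, LinearMap.zero_apply]
  · rw [endpointTerm_of_ne_one c hn, _root_.zero_apply]

theorem rTensor_inr_comp (e : R →ₗ[𝕜] 𝕜) (u : R ⊗[𝕜] g) :
    LinearMap.rTensor g (LinearMap.inr 𝕜 (𝕜 × 𝕜) 𝕜 ∘ₗ e) u =
      whitneyDt 𝕜 ⊗ₜ[𝕜] ((TensorProduct.lid 𝕜 g).toLinearMap ∘ₗ LinearMap.rTensor g e) u := by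
  induction u with
  | zero => simp
  | add u v hu hv => rw [map_add, map_add, hu, hv, TensorProduct.tmul_add]
  | tmul f x =>
    rw [LinearMap.comp_apply, LinearMap.rTensor_tmul, LinearMap.rTensor_tmul]
    simp only [LinearEquiv.coe_coe, TensorProduct.lid_tmul, ← TensorProduct.smul_tmul]
    congr 1
    simp [whitneyDt, Prod.ext_iff]

theorem extendedPhi_oneForm (c : R →ₗ[𝕜] 𝕜 × 𝕜) (e : R →ₗ[𝕜] 𝕜) {n : ℕ} (l : Fin n → R ⊗[𝕜] g) :
    extendedPhi J L c e n (fun i => oneForm (l i)) =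
      whitneyDt 𝕜 ⊗ₜ[𝕜] ((TensorProduct.lid 𝕜 g).toLinearMap ∘ₗ LinearMap.rTensor g e)
        (explicitTerm L J n l) := by
  have h : ∀ i, LinearMap.rTensor g (LinearMap.snd 𝕜 R R) (oneForm (l i)) = l i := by
    intro i
    rw [oneForm, ← LinearMap.comp_apply, ← LinearMap.rTensor_comp, LinearMap.snd_comp_inr,
      LinearMap.rTensor_id, LinearMap.id_apply]
  rw [extendedPhi, _root_.add_apply, endpointTerm_oneForm, zero_add,
    LinearMap.compMultilinearMap_apply, MultilinearMap.compLinearMap_apply, rTensor_inr_comp]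
  simp only [h]

theorem eq_zero_of_mem_suspendedDeg {p : ℤ} {v : Forms R} (hv : v ∈ suspendedDeg 𝕜 R p)
    (h : v.2 ≠ 0) : p = 0 := by
  by_contra hp
  rw [suspendedDeg] at hv
  split_ifs at hv with h1
  · exact h hv
  · exact h (by rw [(Submodule.mem_bot 𝕜).1 hv]; rfl)

variable (L R) in
theorem span_homogeneous_tmul : Submodule.span 𝕜
    {u : Forms R ⊗[𝕜] g | ∃ (p q : ℤ) (v : Forms R) (x : g), v ∈ suspendedDeg 𝕜 R p ∧ x ∈ L.deg q ∧
      v ⊗ₜ x = u} = ⊤ := by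
  rw [eq_top_iff]
  rintro u -
  induction u with
  | zero => exact zero_mem _
  | add u v hu hv => exact add_mem hu hv
  | tmul v x =>
    induction x using L.homogeneous_induction with
    | zero => rw [TensorProduct.tmul_zero]; exact zero_mem _
    | add x y hx hy => rw [TensorProduct.tmul_add]; exact add_mem hx hy
    | homogeneous q x hx =>
      have h : v = (v.1, 0) + (0, v.2) := by simp
      rw [h, TensorProduct.add_tmul]
      refine add_mem (Submodule.subset_span ⟨-1, q, _, x, ?_, hx, rfl⟩)
        (Submodule.subset_span ⟨0, q, _, x, ?_, hx, rfl⟩)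
      · simp [suspendedDeg]
      · simp [suspendedDeg]

/-- Homogeneous pure tensors span the source, and `W ⊗ g` embeds in `W ⊗ U(g)`. -/
theorem IsLieExtension.unique {W : Type*} [AddCommGroup W] [Module 𝕜 W]
    {F : ∀ n, (Fin n → Forms R) → W}
    {Φ Φ' : ∀ n, MultilinearMap 𝕜 (fun _ : Fin n => Forms R ⊗[𝕜] g) (W ⊗[𝕜] g)}
    (h : IsLieExtension L (suspendedDeg 𝕜 R) F Φ) (h' : IsLieExtension L (suspendedDeg 𝕜 R) F Φ') :
    Φ' = Φ := by
  funext n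
  refine multilinear_ext_of_span (span_homogeneous_tmul R L) _ _ fun u hu => ?_
  choose p q v x hv hx hu using hu
  rw [← funext hu]
  exact lTensor_toEnv_injective W ((h' n p q v x hv hx).trans (h n p q v x hv hx).symm)

theorem exchangeSign_zero_left {n : ℕ} (q : Fin n → ℤ) : exchangeSign 0 q = 1 := by
  simp [exchangeSign]

theorem exchangeSign_fin_one (p q : Fin 1 → ℤ) : exchangeSign p q = 1 := by
  refine Finset.prod_eq_one fun e he => ?_
  have := (Finset.mem_filter.1 he).2
  rw [Subsingleton.elim e.1 e.2] at this
  exact absurd this (lt_irrefl _)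

theorem lTensor_extendedPhi (hJ : IsRotaBaxter J) (c : R →ₗ[𝕜] 𝕜 × 𝕜) (e : R →ₗ[𝕜] 𝕜) {n : ℕ}
    (q : Fin n → ℤ) (v : Fin n → Forms R) (x : Fin n → g) (hx : ∀ i, x i ∈ L.deg (q i)) :
    LinearMap.lTensor (Whitney 𝕜) L.toEnv (extendedPhi J L c e n fun i => v i ⊗ₜ x i) =
      LinearMap.lTensor (Whitney 𝕜) L.toEnv (endpointTerm c n fun i => v i ⊗ₜ x i) +
      ∑ τ : Equiv.Perm (Fin n), koszulSign q τ •
        (((0, e (logIntegral J fun i => (v (τ i)).2)) : Whitney 𝕜) ⊗ₜ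
          (List.ofFn fun i => L.toEnv (x (τ i))).prod) := by
  rw [extendedPhi, _root_.add_apply, map_add, LinearMap.compMultilinearMap_apply,
    MultilinearMap.compLinearMap_apply]
  congr 1
  simp only [LinearMap.rTensor_tmul, LinearMap.snd_apply]
  rw [← LinearMap.comp_apply, LinearMap.lTensor_comp_rTensor, ← LinearMap.rTensor_comp_lTensor,
    LinearMap.comp_apply, lTensor_toEnv_explicitTerm hJ q (fun i => (v i).2) x hx, map_sum]
  refine Finset.sum_congr rfl fun τ _ => ?_
  rw [Units.smul_def, Units.smul_def, map_zsmul, LinearMap.rTensor_tmul]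
  rfl

variable {S : FunctionAlgebra 𝕜 R} {e₀ e₁ : R →ₐ[𝕜] 𝕜}

/-- Zero-forms enter only the linear coefficient, where all signs are trivial. For `n ≠ 1`, either
some argument has no one-form part and both sides vanish, or all suspended degrees are zero; then
there is no exchange sign and the Koszul sign is that of `q`. -/
theorem IsPathIntegral.isLieExtension (hS : IsPathIntegral S J e₀ e₁) {s : 𝕜} {κ : R →ₐ[𝕜] R}
    (hκ : ∀ a, J (s • κ a) = κ (J a)) :
    IsLieExtension L (suspendedDeg 𝕜 R) (phiScaled S s κ)
      (extendedPhi J L ((e₁.comp κ).toLinearMap.prod (e₀.comp κ).toLinearMap)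
        (e₁.comp κ).toLinearMap) := by
  intro n p q v x hv hx
  have h2 : ∀ w : Fin n → Forms R, (phiScaled S s κ n w).2 =
      e₁ (κ (logIntegral J fun i => (w i).2)) := by
    intro w
    rw [phiScaled, hS.phi_snd, logIntegral_scale hκ]
  rw [lTensor_extendedPhi hS.rotaBaxter _ _ q v x hx, symExtendTaylor]
  by_cases hn : n = 1
  · subst hn
    have hs : Subsingleton (Equiv.Perm (Fin 1)) := inferInstance
    rw [Fintype.sum_subsingleton _ 1, Fintype.sum_subsingleton _ 1, koszulSign_one, koszulSign_one,
      one_smul, one_smul, extendTaylor, exchangeSign_fin_one, one_smul]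
    have h3 : phiScaled S s κ 1 v = (((e₁.comp κ).toLinearMap.prod (e₀.comp κ).toLinearMap) (v 0).1, 0)
        + (0, e₁ (κ (logIntegral J fun i => (v i).2))) := by
      refine Prod.ext ?_ ?_
      · rw [phiScaled, hS.phi_one]
        simp
      · rw [h2]
        simp
    have h4 : (v ∘ (1 : Equiv.Perm (Fin 1))) = v := rfl
    rw [h4, h3, TensorProduct.add_tmul]
    simp only [endpointTerm, MultilinearMap.ofSubsingleton_apply_apply]
    rw [LinearMap.rTensor_tmul, LinearMap.lTensor_tmul]
    simp
  · rw [endpointTerm_of_ne_one _ hn, _root_.zero_apply, map_zero, zero_add]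
    have h3 : ∀ w : Fin n → Forms R, phiScaled S s κ n w =
        (0, e₁ (κ (logIntegral J fun i => (w i).2))) :=
      fun w => Prod.ext (hS.phi_fst hn _) (h2 w)
    by_cases h : ∃ i, (v i).2 = 0
    · obtain ⟨i, hi⟩ := h
      have h4 : ∀ τ : Equiv.Perm (Fin n), logIntegral J (fun i => (v (τ i)).2) = 0 := fun τ =>
        logIntegral_of_eq_zero J (τ.symm i) (by rw [Equiv.apply_symm_apply, hi])
      rw [Finset.sum_eq_zero, Finset.sum_eq_zero]
      · intro τ _
        rw [extendTaylor, h3]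
        simp only [Function.comp_apply, h4, map_zero]
        rw [← Prod.zero_eq_mk, TensorProduct.zero_tmul, smul_zero, smul_zero]
      · intro τ _
        rw [h4, map_zero, ← Prod.zero_eq_mk, TensorProduct.zero_tmul, smul_zero]
    · push Not at h
      have hp : p = 0 := funext fun i => eq_zero_of_mem_suspendedDeg (hv i) (h i)
      refine Finset.sum_congr rfl fun τ _ => ?_
      rw [hp, zero_add, extendTaylor, h3]
      have : (0 : Fin n → ℤ) ∘ τ = 0 := rfl
      rw [this, exchangeSign_zero_left, one_smul]
      rfl

end Extension

end ExtensionOfScalars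

/-! ### Evaluation and the explicit formula over the simplex. -/

section EvaluationFormulas

variable {𝕜 R g : Type*} [Field 𝕜] [CommRing R] [Algebra 𝕜 R] [AddCommGroup g] [Module 𝕜 g]

/-- `nestedBracket` as a multilinear map. -/
def nestedBracketMulti {E : Type*} [AddCommGroup E] [Module 𝕜 E] (b : E →ₗ[𝕜] E →ₗ[𝕜] E) (n : ℕ) :
    MultilinearMap 𝕜 (fun _ : Fin (n + 1) => E) E :=
  ((MultilinearMap.mkPiAlgebraFin 𝕜 n (Module.End 𝕜 E)).compLinearMap fun _ => b).uncurryRight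

theorem nestedBracketMulti_apply {E : Type*} [AddCommGroup E] [Module 𝕜 E] (b : E →ₗ[𝕜] E →ₗ[𝕜] E)
    {n : ℕ} (x : Fin (n + 1) → E) :
    nestedBracketMulti b n x = nestedBracket (fun x y => b x y) x := by
  rw [nestedBracket, nest_eq_act, act_eq_prod]
  rfl

theorem act_map {V W V' W' : Type*} [AddCommGroup V] [Module 𝕜 V] [AddCommGroup W] [Module 𝕜 W]
    [AddCommGroup V'] [Module 𝕜 V'] [AddCommGroup W'] [Module 𝕜 W'] (b : V →ₗ[𝕜] W →ₗ[𝕜] W)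
    (b' : V' →ₗ[𝕜] W' →ₗ[𝕜] W') (f : V → V') (f' : W → W') (h : ∀ x y, f' (b x y) = b' (f x) (f' y)) :
    ∀ {n : ℕ} (u : Fin n → V) (w : W), f' (act b u w) = act b' (fun i => f (u i)) (f' w)
  | 0, u, w => by rw [act_zero, act_zero]
  | n + 1, u, w => by rw [act_succ, act_succ, h, act_map b b' f f' h]

theorem nestedBracket_succ {E : Type*} (b : E → E → E) {n : ℕ} (x : Fin (n + 2) → E) :
    nestedBracket b x = b (x 0) (nestedBracket b fun i => x i.succ) := by
  simp [nestedBracket, nest, List.ofFn_succ]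

theorem nestedBracket_bracketExt_tmul (L : DGLieAlgebra 𝕜 g) {n : ℕ} (a : Fin (n + 1) → R)
    (x : Fin (n + 1) → g) : nestedBracket (L.bracketExt R) (fun i => a i ⊗ₜ x i) =
      (∏ i, a i) ⊗ₜ nestedBracket (fun x y => L.bracket x y) x := by
  induction n with
  | zero => simp [nestedBracket, nest]
  | succ n ih =>
    have h := ih (fun i => a i.succ) fun i => x i.succ
    rw [nestedBracket_succ, nestedBracket_succ, h, Fin.prod_univ_succ (n := n + 1) a]
    exact bracketExtLin_tmul L R _ _ _ _

section

variable (g) in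
/-- The value of a function with coefficients in `g`, for the evaluation `e`. -/
def evalExt (e : R →ₗ[𝕜] 𝕜) : R ⊗[𝕜] g →ₗ[𝕜] g :=
  (TensorProduct.lid 𝕜 g).toLinearMap ∘ₗ LinearMap.rTensor g e

theorem evalExt_tmul (e : R →ₗ[𝕜] 𝕜) (f : R) (x : g) : evalExt g e (f ⊗ₜ x) = e f • x := by
  simp [evalExt]

theorem evalExt_bracketExt (L : DGLieAlgebra 𝕜 g) (e : R →ₐ[𝕜] 𝕜) (u v : R ⊗[𝕜] g) :
    evalExt g e.toLinearMap (L.bracketExt R u v) =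
      L.bracket (evalExt g e.toLinearMap u) (evalExt g e.toLinearMap v) := by
  have h : (bracketExtLin L R).compr₂ (evalExt g e.toLinearMap) =
      L.bracket.compl₁₂ (evalExt g e.toLinearMap) (evalExt g e.toLinearMap) := by
    ext a x b y
    simp [bracketExtLin_tmul, evalExt_tmul, smul_smul, mul_comm]
  exact LinearMap.congr_fun₂ h u v

theorem evalExt_nest (L : DGLieAlgebra 𝕜 g) (e : R →ₐ[𝕜] 𝕜) {n : ℕ} (u : Fin n → R ⊗[𝕜] g)
    (w : R ⊗[𝕜] g) : evalExt g e.toLinearMap (nest (L.bracketExt R) u w) =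
      nest (fun x y => L.bracket x y) (fun i => evalExt g e.toLinearMap (u i))
        (evalExt g e.toLinearMap w) :=
  act_map (bracketExtLin L R) L.bracket _ _ (evalExt_bracketExt L e) u w

theorem evalExt_nestedBracket (L : DGLieAlgebra 𝕜 g) (e : R →ₐ[𝕜] 𝕜) {n : ℕ}
    (u : Fin (n + 1) → R ⊗[𝕜] g) : evalExt g e.toLinearMap (nestedBracket (L.bracketExt R) u) =
      nestedBracket (fun x y => L.bracket x y) fun i => evalExt g e.toLinearMap (u i) :=
  evalExt_nest L e _ _

end

variable [CharZero 𝕜] {L : DGLieAlgebra 𝕜 g} {J : R →ₗ[𝕜] R}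

/-- In the applications `T` consists of functions of `n + 1` time variables, `ι i` substitutes the
`i`-th of them and `I` integrates over the simplex. Reindexing the product by `σ` replaces `σ⁻¹` on
the letters by `σ` on the variables. -/
theorem rTensor_explicitTerm {T W : Type*} [CommRing T] [Algebra 𝕜 T] [AddCommGroup W] [Module 𝕜 W]
    {n : ℕ} (ι : Fin (n + 1) → R →ₗ[𝕜] T) (I : T →ₗ[𝕜] W) (e : R →ₗ[𝕜] W)
    (hI : ∀ a : Fin (n + 1) → R, e (iteratedPath J a) = I (∏ i, ι i (a i)))
    (q : Fin (n + 1) → ℤ) (l : Fin (n + 1) → R ⊗[𝕜] g) (hl : ∀ i, l i ∈ L.degExt R (q i)) :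
    LinearMap.rTensor g e (explicitTerm L J (n + 1) l) = LinearMap.rTensor g I
      (∑ σ : Equiv.Perm (Fin (n + 1)), ∑ τ : Equiv.Perm (Fin (n + 1)),
        koszulSign q τ • (eulerianCoeff σ : 𝕜) • nestedBracket (L.bracketExt T)
          (fun i => LinearMap.rTensor g (ι (σ i)) (l (τ i)))) := by
  let F : MultilinearMap 𝕜 (fun _ : Fin (n + 1) => R ⊗[𝕜] g) (T ⊗[𝕜] g) :=
    ∑ σ : Equiv.Perm (Fin (n + 1)), ∑ τ : Equiv.Perm (Fin (n + 1)),
      koszulSign q τ • (eulerianCoeff σ : 𝕜) • ((nestedBracketMulti (bracketExtLin L T) n).compLinearMap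
        fun i => LinearMap.rTensor g (ι (σ i))).domDomCongr τ
  have hF : ∀ l, F l = ∑ σ : Equiv.Perm (Fin (n + 1)), ∑ τ : Equiv.Perm (Fin (n + 1)),
      koszulSign q τ • (eulerianCoeff σ : 𝕜) • nestedBracket (L.bracketExt T)
        (fun i => LinearMap.rTensor g (ι (σ i)) (l (τ i))) := by
    intro l
    simp only [F, _root_.sum_apply]
    refine Finset.sum_congr rfl fun σ _ => Finset.sum_congr rfl fun τ _ => ?_
    change koszulSign q τ • (eulerianCoeff σ : 𝕜) • nestedBracketMulti (bracketExtLin L T) n _ = _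
    rw [nestedBracketMulti_apply]
    rfl
  rw [← hF]
  refine multilinear_eq_of_degExt ((LinearMap.rTensor g e).compMultilinearMap
    (explicitTerm L J (n + 1))) ((LinearMap.rTensor g I).compMultilinearMap F) q
    (fun a x hx => ?_) l hl
  rw [LinearMap.compMultilinearMap_apply, LinearMap.compMultilinearMap_apply, hF,
    explicitTerm_tmul_eq q a x hx, map_sum, map_sum]
  refine Finset.sum_congr rfl fun σ _ => ?_
  rw [map_sum, map_sum]
  refine Finset.sum_congr rfl fun τ _ => ?_
  simp only [Units.smul_def, map_zsmul, map_smul, LinearMap.rTensor_tmul]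
  rw [nestedBracket_bracketExt_tmul L (fun i => ι (σ i) (a (τ i))) (fun i => x (τ i)),
    LinearMap.rTensor_tmul, hI]
  have : ∏ i, ι i ((a ∘ τ ∘ σ.symm) i) = ∏ i, ι (σ i) (a (τ i)) := by
    rw [← Equiv.prod_comp σ]
    simp
  rw [this]
  rfl

theorem rTensor_explicitTerm_const {T W : Type*} [CommRing T] [Algebra 𝕜 T] [AddCommGroup W]
    [Module 𝕜 W] {n : ℕ} (ι : Fin (n + 1) → R →ₗ[𝕜] T) (I : T →ₗ[𝕜] W) (e : R →ₗ[𝕜] W)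
    (hI : ∀ a : Fin (n + 1) → R, e (iteratedPath J a) = I (∏ i, ι i (a i)))
    (l : R ⊗[𝕜] g) (hl : l ∈ L.degExt R 0) :
    LinearMap.rTensor g e (((n + 1).factorial : 𝕜)⁻¹ • explicitTerm L J (n + 1) fun _ => l) =
      LinearMap.rTensor g I (∑ σ : Equiv.Perm (Fin (n + 1)), (eulerianCoeff σ : 𝕜) •
        nestedBracket (L.bracketExt T) (fun i => LinearMap.rTensor g (ι (σ i)) l)) := by
  have h : ((n + 1).factorial : 𝕜) ≠ 0 := by exact_mod_cast Nat.factorial_ne_zero _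
  rw [map_smul, rTensor_explicitTerm ι I e hI (fun _ => 0) _ fun _ => hl, inv_smul_eq_iff₀ h,
    ← map_smul, Finset.smul_sum]
  congr 1
  refine Finset.sum_congr rfl fun σ _ => ?_
  simp only [koszulSign_zero, one_smul, Finset.sum_const, Finset.card_univ, Fintype.card_perm,
    Fintype.card_fin, Nat.cast_smul_eq_nsmul]

/-- The recursion of Magnus. -/
theorem explicitTerm_const_recursion (hJ : IsRotaBaxter J) (l : R ⊗[𝕜] g) (hl : l ∈ L.degExt R 0)
    (n : ℕ) : (((n + 2).factorial : 𝕜)⁻¹ • explicitTerm L J (n + 2) fun _ => l) =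
      ∑ c : Composition (n + 1),
        (((-1) ^ c.length * bernoulli c.length / (c.length.factorial : ℚ) : ℚ) : 𝕜) •
          LinearMap.rTensor g J (nest (L.bracketExt R) (fun j => ((c.blocksFun j).factorial : 𝕜)⁻¹ •
            explicitTerm L J (c.blocksFun j) fun _ => l) l) := by
  have h : ((n + 2).factorial : 𝕜) ≠ 0 := by exact_mod_cast Nat.factorial_ne_zero _
  have h0 : (explicitTerm L J (n + 2) fun _ => l) = _ :=
    (tensorRecursion_explicitTerm hJ).2 n (fun _ => 0) (fun _ => l) fun _ => hl
  rw [h0, inv_smul_eq_iff₀ h, Finset.smul_sum]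
  refine Finset.sum_congr rfl fun c _ => ?_
  simp only [koszulSign_zero, one_smul, Finset.sum_const, Finset.card_univ, Fintype.card_perm,
    Fintype.card_fin]
  -- The factors `1 / i_j!` of `recursionCoeff` pass into the normalized terms, and the `(n + 2)!`
  -- equal permutations cancel the overall factorial.
  have h1 := act_smul_left (bracketExtLin L R) (fun j => ((c.blocksFun j).factorial : 𝕜)⁻¹)
    (fun j => explicitTerm L J (c.blocksFun j) fun _ => l) l
  refine Eq.trans ?_ (congrArg (fun z => ((n + 2).factorial : 𝕜) •
    (((-1) ^ c.length * bernoulli c.length / (c.length.factorial : ℚ) : ℚ) : 𝕜) •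
      LinearMap.rTensor g J z) h1.symm)
  rw [map_smul, ← Nat.cast_smul_eq_nsmul 𝕜, smul_comm]
  congr 1
  rw [smul_smul, recursionCoeff]
  congr 1
  push_cast
  rw [Finset.prod_inv_distrib]
  ring

end EvaluationFormulas

/-! ### Polynomial functions. -/

section PolynomialModel

open Polynomial

variable (𝕜 : Type*) [Field 𝕜]

theorem polyPrimitive_monomial (m : ℕ) (c : 𝕜) :
    polyPrimitive 𝕜 (monomial m c) = monomial (m + 1) (c * ((m : 𝕜) + 1)⁻¹) := by
  have h : monomial m c = c • Polynomial.basisMonomials 𝕜 m := by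
    rw [Polynomial.coe_basisMonomials, smul_monomial, smul_eq_mul, mul_one]
  rw [h, map_smul, polyPrimitive, Module.Basis.constr_basis, smul_monomial, smul_eq_mul]

theorem eval_zero_polyPrimitive (f : 𝕜[X]) : (polyPrimitive 𝕜 f).eval 0 = 0 := by
  induction f using Polynomial.induction_on' with
  | add p q hp hq => rw [map_add, eval_add, hp, hq, add_zero]
  | monomial m c => simp [polyPrimitive_monomial]

variable [CharZero 𝕜]

theorem derivative_polyPrimitive (f : 𝕜[X]) : derivative (polyPrimitive 𝕜 f) = f := by
  induction f using Polynomial.induction_on' with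
  | add p q hp hq => rw [map_add, derivative_add, hp, hq]
  | monomial m c =>
    have h : (m : 𝕜) + 1 ≠ 0 := by exact_mod_cast Nat.succ_ne_zero m
    rw [polyPrimitive_monomial, derivative_monomial]
    push_cast
    rw [mul_assoc, inv_mul_cancel₀ h, mul_one]

variable {𝕜} in
theorem eq_of_derivative_eq {f h : 𝕜[X]} (hd : derivative f = derivative h)
    (h0 : f.eval 0 = h.eval 0) : f = h := by
  rw [← sub_eq_zero] at hd h0 ⊢
  rw [← derivative_sub] at hd
  rw [← eval_sub] at h0
  have h1 := eq_C_of_derivative_eq_zero hd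
  rw [h1, eval_C] at h0
  rw [h1, h0, C_0]

/-- Both sides have the same derivative and vanish at zero. -/
theorem isRotaBaxter_polyPrimitive : IsRotaBaxter (polyPrimitive 𝕜) := by
  intro f h
  refine eq_of_derivative_eq ?_ ?_
  · simp only [derivative_mul, derivative_add, derivative_polyPrimitive]
  · simp only [eval_mul, eval_add, eval_zero_polyPrimitive, mul_zero, add_zero]

/-- The substitution `f(t) ↦ f(st)`. -/
def polyScale (s : 𝕜) : 𝕜[X] →ₐ[𝕜] 𝕜[X] := aeval (C s * X)

variable {𝕜}

theorem polyPrimitive_scale (s : 𝕜) (f : 𝕜[X]) :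
    polyPrimitive 𝕜 (s • polyScale 𝕜 s f) = polyScale 𝕜 s (polyPrimitive 𝕜 f) := by
  have h : ∀ f, polyScale 𝕜 s f = f.comp (C s * X) := fun _ => rfl
  refine eq_of_derivative_eq ?_ ?_
  · rw [derivative_polyPrimitive, h, h, derivative_comp, derivative_polyPrimitive, smul_eq_C_mul]
    simp
  · rw [eval_zero_polyPrimitive, h, eval_comp]
    simp [eval_zero_polyPrimitive]

theorem polySimplexIntegral_monomial {n : ℕ} (m : Fin n →₀ ℕ) :
    polySimplexIntegral 𝕜 n (MvPolynomial.monomial m 1) = monomial (∑ i, (m i + 1))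
      (∏ j : Fin n, ((∑ i ∈ Finset.Iic j, ((m i : 𝕜) + 1))⁻¹)) := by
  have h : MvPolynomial.monomial m 1 = MvPolynomial.basisMonomials (Fin n) 𝕜 m := by
    rw [MvPolynomial.coe_basisMonomials]
  rw [h, polySimplexIntegral, Module.Basis.constr_basis]

/-- Each integration raises the exponent by one and divides by the new exponent, a partial sum of
the `m i + 1`. -/
theorem iteratedPath_polyPrimitive_monomial : ∀ {n : ℕ} (m : Fin n → ℕ),
    iteratedPath (polyPrimitive 𝕜) (fun i => monomial (m i) (1 : 𝕜)) = monomial (∑ i, (m i + 1))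
      (∏ j : Fin n, ((∑ i ∈ Finset.Iic j, ((m i : 𝕜) + 1))⁻¹))
  | 0, _ => by simp [iteratedPath]
  | n + 1, m => by
    rw [iteratedPath, iteratedPath_polyPrimitive_monomial fun i => m i.castSucc, monomial_mul_monomial,
      polyPrimitive_monomial, mul_one, Fin.prod_univ_castSucc, Fin.sum_univ_castSucc]
    have h1 : Finset.Iic (Fin.last n) = Finset.univ := by
      ext i; simp [Fin.le_last]
    have h2 : ∀ j : Fin n, ∑ i ∈ Finset.Iic j.castSucc, ((m i : 𝕜) + 1) =
        ∑ i ∈ Finset.Iic j, ((m i.castSucc : 𝕜) + 1) := by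
      intro j
      have : Finset.Iic j.castSucc = (Finset.Iic j).map Fin.castSuccEmb := by
        ext i
        simp only [Finset.mem_Iic, Finset.mem_map, Fin.coe_castSuccEmb]
        constructor
        · intro hi
          refine ⟨⟨i, by have := j.2; exact lt_of_le_of_lt hi this⟩, hi, rfl⟩
        · rintro ⟨i, hi, rfl⟩
          exact hi
      rw [this, Finset.sum_map]
      rfl
    simp only [h2, h1]
    congr 2
    rw [Fin.sum_univ_castSucc]
    push_cast
    ring

theorem polySimplexIntegral_prod {n : ℕ} (a : Fin n → 𝕜[X]) :
    polySimplexIntegral 𝕜 n (∏ i, aeval (MvPolynomial.X i) (a i)) =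
      iteratedPath (polyPrimitive 𝕜) a := by
  have h : (polySimplexIntegral 𝕜 n).compMultilinearMap ((MultilinearMap.mkPiAlgebra 𝕜 (Fin n)
      (MvPolynomial (Fin n) 𝕜)).compLinearMap fun i =>
        (aeval (MvPolynomial.X i) : 𝕜[X] →ₐ[𝕜] MvPolynomial (Fin n) 𝕜).toLinearMap) =
      iteratedPathMulti (polyPrimitive 𝕜) n := by
    refine Module.Basis.ext_multilinear (fun _ => Polynomial.basisMonomials 𝕜) fun m => ?_
    rw [iteratedPathMulti_apply, Polynomial.coe_basisMonomials, iteratedPath_polyPrimitive_monomial]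
    simp only [LinearMap.compMultilinearMap_apply, MultilinearMap.compLinearMap_apply,
      MultilinearMap.mkPiAlgebra_apply, AlgHom.toLinearMap_apply, aeval_monomial, map_one, one_mul]
    have h1 : ∏ i, (MvPolynomial.X i : MvPolynomial (Fin n) 𝕜) ^ m i =
        MvPolynomial.monomial (Finsupp.equivFunOnFinite.symm m) 1 := by
      rw [MvPolynomial.monomial_eq, map_one, one_mul, Finsupp.prod_fintype _ _ fun i => pow_zero _]
      rfl
    rw [h1, polySimplexIntegral_monomial]
    rfl
  rw [← iteratedPathMulti_apply, ← h]
  rfl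

theorem isPathIntegral_poly : IsPathIntegral (polyFunctions 𝕜) (polyPrimitive 𝕜)
    (aeval (0 : 𝕜)) (aeval (1 : 𝕜)) where
  ev0 _ := rfl
  ev1 _ := rfl
  coord0 := aeval_X _
  coord1 := aeval_X _
  integral n a := congrArg (eval 1) (polySimplexIntegral_prod a)
  rotaBaxter := isRotaBaxter_polyPrimitive 𝕜
  integral_one := by
    rw [← monomial_zero_one, polyPrimitive_monomial]
    simp

theorem aeval_one_comp_polyScale (s : 𝕜) : (aeval (1 : 𝕜)).comp (polyScale 𝕜 s) = aeval s := by
  refine Polynomial.algHom_ext ?_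
  simp [polyScale]

end PolynomialModel

/-! ### The polynomial case. -/

section PolynomialTheorem

/-- The theorem for polynomial forms. -/
theorem exists_polynomial_extension {𝕜 : Type*} [Field 𝕜] [CharZero 𝕜] {g : Type*} [AddCommGroup g]
    [Module 𝕜 g] (L : DGLieAlgebra 𝕜 g) :
    ∃ (Φ : 𝕜 → ∀ n, MultilinearMap 𝕜
          (fun _ : Fin n => Forms (Polynomial 𝕜) ⊗[𝕜] g) (Whitney 𝕜 ⊗[𝕜] g))
        (M : ∀ n, MultilinearMap 𝕜
          (fun _ : Fin n => Polynomial 𝕜 ⊗[𝕜] g) (Polynomial 𝕜 ⊗[𝕜] g)),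
      (∀ s Φ', IsLieExtension L (suspendedDeg 𝕜 (Polynomial 𝕜))
          (polyPhi 𝕜 s) Φ' ↔ Φ' = Φ s) ∧
      (∀ n (l : Fin n → Polynomial 𝕜 ⊗[𝕜] g) (s : 𝕜),
        Φ s n (fun i => oneForm (l i)) =
          whitneyDt 𝕜 ⊗ₜ[𝕜] polyEval s (M n l)) ∧
      (∀ n (q : Fin (n + 1) → ℤ) (l : Fin (n + 1) → Polynomial 𝕜 ⊗[𝕜] g),
        (∀ i, l i ∈ L.degExt (Polynomial 𝕜) (q i)) →
        M (n + 1) l = LinearMap.rTensor g (polySimplexIntegral 𝕜 (n + 1))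
          (∑ σ : Equiv.Perm (Fin (n + 1)), ∑ τ : Equiv.Perm (Fin (n + 1)),
            koszulSign q τ • (eulerianCoeff σ : 𝕜) •
              nestedBracket (L.bracketExt (MvPolynomial (Fin (n + 1)) 𝕜))
                (fun i => polyAt (σ i) (l (τ i))))) ∧
      PolyRecursion L (fun n => M n) ∧
      (∀ M', PolyRecursion L M' →
        ∀ n (q : Fin (n + 1) → ℤ) (l : Fin (n + 1) → Polynomial 𝕜 ⊗[𝕜] g),
          (∀ i, l i ∈ L.degExt (Polynomial 𝕜) (q i)) → M' (n + 1) l = M (n + 1) l) ∧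
      (∀ l ∈ L.degExt (Polynomial 𝕜) 0, ∀ P : ℕ → Polynomial 𝕜 ⊗[𝕜] g,
        (∀ n, P n = ((n.factorial : 𝕜)⁻¹) • M n (fun _ => l)) →
        (∀ n, P (n + 1) = LinearMap.rTensor g (polySimplexIntegral 𝕜 (n + 1))
          (∑ σ : Equiv.Perm (Fin (n + 1)), (eulerianCoeff σ : 𝕜) •
            nestedBracket (L.bracketExt (MvPolynomial (Fin (n + 1)) 𝕜))
              (fun i => polyAt (σ i) l))) ∧
        P 1 = LinearMap.rTensor g (polyPrimitive 𝕜) l ∧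
        (∀ n, P (n + 2) = ∑ c : Composition (n + 1),
          (((-1) ^ c.length * bernoulli c.length / (c.length.factorial : ℚ) : ℚ) : 𝕜) •
            LinearMap.rTensor g (polyPrimitive 𝕜)
              (nest (L.bracketExt (Polynomial 𝕜)) (fun j => P (c.blocksFun j)) l))) := by
  have hJ := isRotaBaxter_polyPrimitive 𝕜
  have hI : ∀ n (a : Fin n → Polynomial 𝕜), (LinearMap.id : Polynomial 𝕜 →ₗ[𝕜] Polynomial 𝕜)
      (iteratedPath (polyPrimitive 𝕜) a) =
      polySimplexIntegral 𝕜 n (∏ i, (Polynomial.aeval (MvPolynomial.X i) :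
        Polynomial 𝕜 →ₐ[𝕜] MvPolynomial (Fin n) 𝕜).toLinearMap (a i)) :=
    fun n a => (polySimplexIntegral_prod a).symm
  have hid : ∀ u : Polynomial 𝕜 ⊗[𝕜] g, LinearMap.rTensor g LinearMap.id u = u := fun u => by
    rw [LinearMap.rTensor_id, LinearMap.id_apply]
  have hE := fun s : 𝕜 => isPathIntegral_poly.isLieExtension (L := L) (polyPrimitive_scale s)
  refine ⟨_, explicitTerm L (polyPrimitive 𝕜), fun s Φ' => ⟨fun h => (hE s).unique h, ?_⟩, ?_, ?_,
    tensorRecursion_explicitTerm hJ, ?_, ?_⟩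
  · rintro rfl
    exact hE s
  · intro n l s
    rw [extendedPhi_oneForm, aeval_one_comp_polyScale]
    rfl
  · intro n q l hl
    rw [← hid (explicitTerm L _ _ l)]
    exact rTensor_explicitTerm _ _ _ (hI _) q l hl
  · intro M' hM' n q l hl
    exact TensorRecursion.eq_explicitTerm hJ hM' q l hl
  · intro l hl P hP
    refine ⟨fun n => ?_, ?_, fun n => ?_⟩
    · rw [hP, ← hid (_ • _)]
      exact rTensor_explicitTerm_const _ _ _ (hI _) l hl
    · rw [hP, Nat.factorial_one, Nat.cast_one, inv_one, one_smul]
      exact (tensorRecursion_explicitTerm hJ).1 0 _ hl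
    · simp only [hP]
      exact explicitTerm_const_recursion hJ l hl n

end PolynomialTheorem

/-- The coordinates with respect to a basis of `g` are functions in `R`, which the evaluations
separate. -/
theorem eq_of_evalExt_eq {𝕜 R g X : Type*} [Field 𝕜] [CommRing R] [Algebra 𝕜 R] [AddCommGroup g]
    [Module 𝕜 g] (ε : X → R →ₗ[𝕜] 𝕜) (hε : ∀ f f' : R, (∀ s, ε s f = ε s f') → f = f')
    {u v : R ⊗[𝕜] g} (huv : ∀ s, evalExt g (ε s) u = evalExt g (ε s) v) : u = v := by
  classical
  let b := Module.Basis.ofVectorSpace 𝕜 g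
  have key : ∀ (u : R ⊗[𝕜] g) i s,
      ε s (TensorProduct.equivFinsuppOfBasisRight b u i) = b.repr (evalExt g (ε s) u) i := by
    intro u i s
    induction u with
    | zero => simp
    | add u v hu hv => simp only [map_add, Finsupp.add_apply, ← hu, ← hv]
    | tmul f x =>
      rw [TensorProduct.equivFinsuppOfBasisRight_apply_tmul_apply, evalExt_tmul, map_smul, map_smul,
        Finsupp.smul_apply, smul_eq_mul, smul_eq_mul, mul_comm]
  refine (TensorProduct.equivFinsuppOfBasisRight b).injective (Finsupp.ext fun i => hε _ _ fun s => ?_)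
  rw [key, key, huv]

/-! ### Smooth functions. -/

section SmoothModel

theorem smooth_continuous (f : smoothFunctions) : Continuous fun u : ℝ => f.1 (toUnit u) := by
  have h : ContDiffOn ℝ ∞ (Set.IccExtend zero_le_one f.1) (Set.Icc (0 : ℝ) 1) := f.2
  have h1 := continuousOn_iff_continuous_domRestrict.1 h.continuousOn
  have h2 : (Set.Icc (0 : ℝ) 1).domRestrict (Set.IccExtend zero_le_one f.1) = f.1 := by
    funext t
    exact Set.IccExtend_val zero_le_one f.1 t
  rw [h2] at h1
  exact h1.comp continuous_projIcc

theorem coe_toUnit {u : ℝ} (hu : u ∈ Set.Icc (0 : ℝ) 1) : (toUnit u : ℝ) = u :=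
  congrArg Subtype.val (Set.projIcc_of_mem zero_le_one hu)

theorem toUnit_coe (s : Set.Icc (0 : ℝ) 1) : toUnit (s : ℝ) = s := Set.projIcc_val zero_le_one s

theorem hasDerivAt_smooth_integral (f : smoothFunctions) (t : ℝ) :
    HasDerivAt (fun t => ∫ u in (0 : ℝ)..t, f.1 (toUnit u)) (f.1 (toUnit t)) t :=
  ((smooth_continuous f).integral_hasStrictDerivAt 0 t).hasDerivAt

/-- The primitive `∫_0^s f(u) du` of a smooth function. -/
def smoothPrimitive : smoothFunctions →ₗ[ℝ] smoothFunctions where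
  toFun f := ⟨fun s => ∫ u in (0 : ℝ)..s, f.1 (toUnit u), by
    have hf : ContDiffOn ℝ ∞ (Set.IccExtend zero_le_one f.1) (Set.Icc (0 : ℝ) 1) := f.2
    have h : ContDiffOn ℝ ∞ (fun t => ∫ u in (0 : ℝ)..t, f.1 (toUnit u)) (Set.Icc (0 : ℝ) 1) := by
      have hu : UniqueDiffOn ℝ (Set.Icc (0 : ℝ) 1) := uniqueDiffOn_Icc zero_lt_one
      refine (contDiffOn_infty_iff_derivWithin hu).2 ⟨fun t _ =>
        (hasDerivAt_smooth_integral f t).differentiableAt.differentiableWithinAt, ?_⟩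
      refine hf.congr fun t ht => ?_
      exact (hasDerivAt_smooth_integral f t).hasDerivWithinAt.derivWithin (hu t ht)
    refine h.congr fun t ht => ?_
    simp only [Set.IccExtend, Function.comp]
    rw [coe_toUnit ht]⟩
  map_add' f f' := Subtype.ext <| funext fun s => intervalIntegral.integral_add
    ((smooth_continuous f).intervalIntegrable _ _) ((smooth_continuous f').intervalIntegrable _ _)
  map_smul' c f := Subtype.ext <| funext fun s => intervalIntegral.integral_const_mul _ _

theorem smoothPrimitive_apply (f : smoothFunctions) (s : Set.Icc (0 : ℝ) 1) :
    (smoothPrimitive f).1 s = ∫ u in (0 : ℝ)..s, f.1 (toUnit u) := rfl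

theorem mem_unit_of_mem_uIcc (s : Set.Icc (0 : ℝ) 1) {u : ℝ} (hu : u ∈ Set.uIcc (0 : ℝ) s) :
    u ∈ Set.Icc (0 : ℝ) 1 := by
  rw [Set.uIcc_of_le s.2.1] at hu
  exact ⟨hu.1, hu.2.trans s.2.2⟩

/-- Integration by parts on `[0, s]`, where `toUnit` does not clamp. -/
theorem isRotaBaxter_smoothPrimitive : IsRotaBaxter smoothPrimitive := by
  intro f f'
  refine Subtype.ext (funext fun s => ?_)
  have h := intervalIntegral.integral_deriv_mul_eq_sub (a := 0) (b := (s : ℝ))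
    (fun t _ => hasDerivAt_smooth_integral f t) (fun t _ => hasDerivAt_smooth_integral f' t)
    ((smooth_continuous f).intervalIntegrable _ _) ((smooth_continuous f').intervalIntegrable _ _)
  rw [intervalIntegral.integral_same, zero_mul, sub_zero] at h
  refine h.symm.trans ?_
  rw [← map_add, smoothPrimitive_apply]
  refine intervalIntegral.integral_congr fun u hu => ?_
  change _ = f.1 (toUnit u) * (∫ v in (0 : ℝ)..(toUnit u : ℝ), f'.1 (toUnit v)) +
    (∫ v in (0 : ℝ)..(toUnit u : ℝ), f.1 (toUnit v)) * f'.1 (toUnit u)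
  rw [coe_toUnit (mem_unit_of_mem_uIcc s hu)]

/-- `smoothScale` as a homomorphism of algebras. -/
def smoothScaleHom (s : Set.Icc (0 : ℝ) 1) : smoothFunctions →ₐ[ℝ] smoothFunctions where
  toFun := smoothScale s
  map_one' := rfl
  map_mul' _ _ := rfl
  map_zero' := rfl
  map_add' _ _ := rfl
  commutes' _ := rfl

theorem smoothPrimitive_scale (s : Set.Icc (0 : ℝ) 1) (f : smoothFunctions) :
    smoothPrimitive ((s : ℝ) • smoothScaleHom s f) = smoothScaleHom s (smoothPrimitive f) := by
  refine Subtype.ext (funext fun t => ?_)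
  have h := intervalIntegral.smul_integral_comp_mul_left (a := 0) (b := (t : ℝ))
    (fun u => f.1 (toUnit u)) (s : ℝ)
  rw [mul_zero] at h
  refine Eq.trans ?_ h
  rw [map_smul]
  refine congrArg (fun z : ℝ => (s : ℝ) • z) (intervalIntegral.integral_congr fun u hu => ?_)
  change f.1 (s * toUnit u) = f.1 (toUnit (s * u))
  have h1 := coe_toUnit (mem_unit_of_mem_uIcc t hu)
  have h2 : toUnit ((s : ℝ) * u) = s * toUnit u := by
    rw [← toUnit_coe (s * toUnit u)]
    congr 1
    rw [Set.Icc.coe_mul, h1]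
  rw [h2]

/-- Evaluation of smooth functions at a point. -/
def smoothEvalHom (s : Set.Icc (0 : ℝ) 1) : smoothFunctions →ₐ[ℝ] ℝ :=
  (Pi.evalAlgHom ℝ _ s).comp smoothFunctions.val

theorem smoothEval_eq {h : Type*} [NormedAddCommGroup h] [NormedSpace ℝ h] (s : Set.Icc (0 : ℝ) 1) :
    (smoothEval s : smoothFunctions ⊗[ℝ] h →ₗ[ℝ] h) = evalExt h (smoothEvalHom s).toLinearMap := rfl

theorem smoothEval_ext {h : Type*} [NormedAddCommGroup h] [NormedSpace ℝ h]
    {u v : smoothFunctions ⊗[ℝ] h} (huv : ∀ s, smoothEval s u = smoothEval s v) : u = v := by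
  refine eq_of_evalExt_eq (fun s => (smoothEvalHom s).toLinearMap) (fun f f' hf => ?_) huv
  exact Subtype.ext (funext hf)

end SmoothModel

/-! ### Integrals over the simplex. -/

section SimplexIntegral

theorem isCompact_simplex (n : ℕ) (s : ℝ) : IsCompact (simplex n s) := by
  have h : IsClosed {t : Fin n → ℝ | Monotone t} := by
    simp only [Monotone, Set.ofPred_forall]
    exact isClosed_iInter fun i => isClosed_iInter fun j => isClosed_iInter fun _ =>
      isClosed_le (continuous_apply i) (continuous_apply j)
  have h2 : simplex n s = {t : Fin n → ℝ | Monotone t} ∩ Set.pi Set.univ fun _ => Set.Icc 0 s := by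
    ext t
    simp only [simplex, Set.mem_inter_iff, Set.mem_ofPred_eq, Set.mem_pi, Set.mem_univ, Set.mem_Icc,
      forall_true_left]
  rw [h2]
  exact (isCompact_univ_pi fun _ => isCompact_Icc).inter_left h

theorem mem_simplex_succ {n : ℕ} {s : ℝ} (t : Fin (n + 1) → ℝ) : t ∈ simplex (n + 1) s ↔
    t (Fin.last n) ∈ Set.Icc 0 s ∧ (fun i => t (Fin.castSucc i)) ∈ simplex n (t (Fin.last n)) := by
  constructor
  · rintro ⟨hm, h⟩
    exact ⟨h _, fun i j hij => hm (Fin.castSucc_le_castSucc_iff.2 hij), fun i =>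
      ⟨(h _).1, hm (Fin.le_last _)⟩⟩
  · rintro ⟨h0, hm, h⟩
    refine ⟨fun i j hij => ?_, fun i => ?_⟩
    · induction j using Fin.lastCases with
      | last =>
        induction i using Fin.lastCases with
        | last => exact le_rfl
        | cast i => exact (h i).2
      | cast j =>
        induction i using Fin.lastCases with
        | last => exact absurd hij (not_le.2 (Fin.castSucc_lt_last j))
        | cast i => exact hm (Fin.castSucc_le_castSucc_iff.1 hij)
    · induction i using Fin.lastCases with
      | last => exact h0
      | cast i => exact ⟨(h i).1, (h i).2.trans h0.2⟩

/-- Fubini, with the last and largest variable outermost; integrability comes from compactness of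
the simplex and continuity. -/
theorem integral_simplex_succ {n : ℕ} {s : ℝ} (hs : 0 ≤ s) (F : Fin (n + 1) → ℝ → ℝ)
    (hF : ∀ i, Continuous (F i)) : ∫ t in simplex (n + 1) s, ∏ i, F i (t i) =
      ∫ u in (0 : ℝ)..s, (∫ t in simplex n u, ∏ i : Fin n, F i.castSucc (t i)) * F (Fin.last n) u := by
  let e := MeasurableEquiv.piFinSuccAbove (fun _ : Fin (n + 1) => ℝ) (Fin.last n)
  have he : MeasurePreserving e.symm volume volume :=
    (volume_preserving_piFinSuccAbove (fun _ : Fin (n + 1) => ℝ) (Fin.last n)).symm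
  have h1 := he.setIntegral_preimage_emb e.symm.measurableEmbedding (fun t => ∏ i, F i (t i))
    (simplex (n + 1) s)
  have hl : ∀ z : ℝ × (Fin n → ℝ), e.symm z (Fin.last n) = z.1 := fun z =>
    Fin.insertNth_apply_same (α := fun _ => ℝ) (Fin.last n) z.1 z.2
  have hc : ∀ (z : ℝ × (Fin n → ℝ)) i, e.symm z (Fin.castSucc i) = z.2 i := fun z i => by
    have := Fin.insertNth_apply_succAbove (α := fun _ => ℝ) (Fin.last n) z.1 z.2 i
    rwa [Fin.succAbove_last] at this
  have hmem : ∀ z : ℝ × (Fin n → ℝ), z ∈ e.symm ⁻¹' simplex (n + 1) s ↔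
      z.1 ∈ Set.Icc 0 s ∧ z.2 ∈ simplex n z.1 := by
    intro z
    rw [Set.mem_preimage, mem_simplex_succ, hl]
    simp only [hc]
  have hcont : Continuous e.symm := by
    refine continuous_pi fun i => ?_
    induction i using Fin.lastCases with
    | last => simp only [hl]; exact continuous_fst
    | cast i => simp only [hc]; fun_prop
  have hclosed : IsClosed (e.symm ⁻¹' simplex (n + 1) s) :=
    (isCompact_simplex _ _).isClosed.preimage hcont
  have hcompact : IsCompact (e.symm ⁻¹' simplex (n + 1) s) := by
    refine ((isCompact_Icc (a := (0 : ℝ)) (b := s)).prod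
      (isCompact_univ_pi fun _ : Fin n => isCompact_Icc (a := (0 : ℝ)) (b := s))).of_isClosed_subset
        hclosed fun z hz => ?_
    rw [hmem] at hz
    exact ⟨hz.1, fun i _ => ⟨(hz.2.2 i).1, (hz.2.2 i).2.trans hz.1.2⟩⟩
  have hcF : Continuous fun z => ∏ i, F i (e.symm z i) :=
    continuous_finsetProd _ fun i _ => (hF i).comp ((continuous_apply i).comp hcont)
  have hint : Integrable ((e.symm ⁻¹' simplex (n + 1) s).indicator fun z => ∏ i, F i (e.symm z i))
      (volume.prod volume) :=
    (integrable_indicator_iff hclosed.measurableSet).2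
      (hcF.continuousOn.integrableOn_compact hcompact)
  rw [← h1, ← integral_indicator hclosed.measurableSet, Measure.volume_eq_prod,
    integral_prod _ hint, intervalIntegral.integral_of_le hs, ← integral_Icc_eq_integral_Ioc,
    ← integral_indicator measurableSet_Icc]
  congr 1
  funext u
  by_cases hu : u ∈ Set.Icc 0 s
  · rw [Set.indicator_of_mem hu, ← integral_mul_const,
      ← integral_indicator (isCompact_simplex n u).isClosed.measurableSet]
    congr 1
    funext t
    by_cases ht : t ∈ simplex n u
    · rw [Set.indicator_of_mem ht, Set.indicator_of_mem ((hmem _).2 ⟨hu, ht⟩), Fin.prod_univ_castSucc]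
      simp only [hl, hc]
    · rw [Set.indicator_of_notMem ht, Set.indicator_of_notMem fun h => ht ((hmem _).1 h).2]
  · rw [Set.indicator_of_notMem hu, integral_eq_zero_of_ae]
    refine Filter.Eventually.of_forall fun t => ?_
    exact Set.indicator_of_notMem (fun h => hu ((hmem _).1 h).1) _

theorem integral_simplex : ∀ {n : ℕ} (a : Fin n → smoothFunctions) (s : Set.Icc (0 : ℝ) 1),
    ∫ t in simplex n s, ∏ i, (a i).1 (toUnit (t i)) = (iteratedPath smoothPrimitive a).1 s
  | 0, a, s => by
    -- For `n = 0` the domain is one point of mass one.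
    have h : simplex 0 s = Set.univ := by
      ext t
      simp [simplex, Subsingleton.monotone]
    rw [h]
    simp [iteratedPath, Measure.volume_pi_eq_dirac 0]
  | n + 1, a, s => by
    rw [integral_simplex_succ s.2.1 (fun i u => (a i).1 (toUnit u)) fun i => smooth_continuous (a i),
      iteratedPath, smoothPrimitive_apply]
    refine intervalIntegral.integral_congr fun u hu => ?_
    have h := integral_simplex (fun i => a i.castSucc) (toUnit u)
    rw [coe_toUnit (mem_unit_of_mem_uIcc s hu)] at h
    simp only [h]
    rfl

theorem isPathIntegral_smooth : IsPathIntegral smoothModel smoothPrimitive (smoothEvalHom 0)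
    (smoothEvalHom 1) where
  ev0 _ := rfl
  ev1 _ := rfl
  coord0 := rfl
  coord1 := rfl
  integral n a := integral_simplex a 1
  rotaBaxter := isRotaBaxter_smoothPrimitive
  integral_one := by
    change ∫ u in (0 : ℝ)..1, (1 : ℝ) = 1
    simp

end SimplexIntegral

theorem integral_evalExt {R X h : Type*} [CommRing R] [Algebra ℝ R] [NormedAddCommGroup h]
    [NormedSpace ℝ h] [CompleteSpace h] [MeasurableSpace X] (ν : Measure X) (ε : X → R →ₗ[ℝ] ℝ)
    (I : R →ₗ[ℝ] ℝ) (hε : ∀ f, Integrable (fun t => ε t f) ν) (hI : ∀ f, ∫ t, ε t f ∂ν = I f)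
    (u : R ⊗[ℝ] h) : Integrable (fun t => evalExt h (ε t) u) ν ∧
      ∫ t, evalExt h (ε t) u ∂ν = evalExt h I u := by
  induction u with
  | zero => simp
  | add u v hu hv =>
    simp only [map_add]
    exact ⟨hu.1.add hv.1, by rw [integral_add hu.1 hv.1, hu.2, hv.2]⟩
  | tmul f x =>
    simp only [evalExt_tmul]
    exact ⟨(hε f).smul_const x, by rw [integral_smul_const, hI]⟩

theorem evalExt_rTensor {𝕜 R T g : Type*} [Field 𝕜] [CommRing R] [Algebra 𝕜 R] [CommRing T]
    [Algebra 𝕜 T] [AddCommGroup g] [Module 𝕜 g] (e : T →ₗ[𝕜] 𝕜) (ι : R →ₗ[𝕜] T) (u : R ⊗[𝕜] g) :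
    evalExt g e (LinearMap.rTensor g ι u) = evalExt g (e ∘ₗ ι) u := by
  rw [evalExt, evalExt, LinearMap.rTensor_comp]
  rfl

/-! ### The smooth case. -/

section SmoothTheorem

variable {h : Type*} [NormedAddCommGroup h] [NormedSpace ℝ h] [FiniteDimensional ℝ h]

theorem smoothEval_rTensor_smoothPrimitive (s : Set.Icc (0 : ℝ) 1) (w : smoothFunctions ⊗[ℝ] h) :
    smoothEval s (LinearMap.rTensor h smoothPrimitive w) =
      ∫ u in (0 : ℝ)..s, smoothEval (toUnit u) w := by
  have := FiniteDimensional.complete ℝ h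
  rw [smoothEval_eq, evalExt_rTensor, intervalIntegral.integral_of_le s.2.1]
  refine (integral_evalExt (volume.restrict (Set.Ioc (0 : ℝ) s))
    (fun u => (smoothEvalHom (toUnit u)).toLinearMap) _ (fun f => ?_) (fun f => ?_) w).2.symm
  · exact ((smooth_continuous f).intervalIntegrable 0 s).1
  · exact (intervalIntegral.integral_of_le s.2.1).symm

/-- Values determine an element of `C^∞([0,1]) ⊗ h`, and evaluation is compatible with brackets and
with integration in the coefficients. -/
theorem smoothRecursion_iff (K : DGLieAlgebra ℝ h)
    (M : ∀ n, (Fin n → smoothFunctions ⊗[ℝ] h) → smoothFunctions ⊗[ℝ] h) :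
    SmoothRecursion K M ↔ TensorRecursion K smoothPrimitive M := by
  have h1 : ∀ (s : Set.Icc (0 : ℝ) 1) {k : ℕ} (v : Fin k → smoothFunctions ⊗[ℝ] h) w,
      ∫ u in (0 : ℝ)..s, nest (fun x y => K.bracket x y) (fun j => smoothEval (toUnit u) (v j))
        (smoothEval (toUnit u) w) =
      smoothEval s (LinearMap.rTensor h smoothPrimitive (nest (K.bracketExt smoothFunctions) v w)) := by
    intro s k v w
    rw [smoothEval_rTensor_smoothPrimitive]
    simp only [smoothEval_eq, evalExt_nest]
  refine and_congr ?_ ?_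
  · refine forall_congr' fun q => forall_congr' fun l => imp_congr_right fun _ => ?_
    simp only [← smoothEval_rTensor_smoothPrimitive]
    exact ⟨smoothEval_ext, fun h s => by rw [h]⟩
  · refine forall_congr' fun n => forall_congr' fun q => forall_congr' fun l =>
      imp_congr_right fun _ => ?_
    simp only [h1]
    have h2 : ∀ (s : Set.Icc (0 : ℝ) 1) (W : Composition (n + 1) → Equiv.Perm (Fin (n + 2)) →
        smoothFunctions ⊗[ℝ] h), ∑ c : Composition (n + 1), (recursionCoeff c : ℝ) •
          ∑ σ : Equiv.Perm (Fin (n + 2)), koszulSign q σ • smoothEval s (W c σ) =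
        smoothEval s (∑ c : Composition (n + 1), (recursionCoeff c : ℝ) •
          ∑ σ : Equiv.Perm (Fin (n + 2)), koszulSign q σ • W c σ) := by
      intro s W
      simp only [map_sum, map_smul, Units.smul_def, map_zsmul]
    simp only [h2]
    exact ⟨smoothEval_ext, fun h s => by rw [h]⟩

/-- The substitution `f(t) ↦ f(t_j)`. -/
def smoothAt {n : ℕ} (j : Fin n) : smoothFunctions →ₗ[ℝ] C(Fin n → ℝ, ℝ) where
  toFun f := ⟨fun t => f.1 (toUnit (t j)), (smooth_continuous f).comp (continuous_apply j)⟩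
  map_add' _ _ := rfl
  map_smul' _ _ := rfl

theorem integrableOn_simplex {n : ℕ} (s : ℝ) (F : C(Fin n → ℝ, ℝ)) :
    IntegrableOn F (simplex n s) :=
  F.continuous.continuousOn.integrableOn_compact (isCompact_simplex n s)

/-- The integral over the simplex `0 ≤ t_1 ≤ ⋯ ≤ t_n ≤ s`. -/
def simplexIntegral (n : ℕ) (s : ℝ) : C(Fin n → ℝ, ℝ) →ₗ[ℝ] ℝ where
  toFun F := ∫ t in simplex n s, F t
  map_add' F F' := integral_add (integrableOn_simplex s F) (integrableOn_simplex s F')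
  map_smul' c _ := integral_const_mul c _

theorem simplexIntegral_prod {n : ℕ} (s : Set.Icc (0 : ℝ) 1) (a : Fin n → smoothFunctions) :
    smoothEvalHom s (iteratedPath smoothPrimitive a) =
      simplexIntegral n s (∏ i, smoothAt i (a i)) := by
  refine (integral_simplex a s).symm.trans ?_
  simp only [simplexIntegral, LinearMap.coe_mk, AddHom.coe_mk, ContinuousMap.coe_prod,
    Finset.prod_apply]
  rfl

/-- Evaluation of continuous functions at a point. -/
def pointEvalHom {X : Type*} [TopologicalSpace X] (t : X) : C(X, ℝ) →ₐ[ℝ] ℝ :=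
  (Pi.evalAlgHom ℝ (fun _ : X => ℝ) t).comp (ContinuousMap.coeFnAlgHom ℝ)

theorem evalExt_simplexIntegral (n : ℕ) (s : ℝ) (w : C(Fin n → ℝ, ℝ) ⊗[ℝ] h) :
    evalExt h (simplexIntegral n s) w =
      ∫ t in simplex n s, evalExt h (pointEvalHom t).toLinearMap w :=
  have := FiniteDimensional.complete ℝ h
  (integral_evalExt (volume.restrict (simplex n s)) (fun t => (pointEvalHom t).toLinearMap) _
    (integrableOn_simplex s) (fun _ => rfl) w).2.symm

theorem evalExt_smoothAt {n : ℕ} (t : Fin n → ℝ) (j : Fin n) (w : smoothFunctions ⊗[ℝ] h) :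
    evalExt h (pointEvalHom t).toLinearMap (LinearMap.rTensor h (smoothAt j) w) =
      smoothEval (toUnit (t j)) w :=
  evalExt_rTensor _ _ _

/-- The theorem for smooth forms. -/
theorem exists_smooth_extension (K : DGLieAlgebra ℝ h) :
    ∃ (Φ : Set.Icc (0 : ℝ) 1 → ∀ n, MultilinearMap ℝ
          (fun _ : Fin n => Forms smoothFunctions ⊗[ℝ] h) (Whitney ℝ ⊗[ℝ] h))
        (M : ∀ n, MultilinearMap ℝ
          (fun _ : Fin n => smoothFunctions ⊗[ℝ] h) (smoothFunctions ⊗[ℝ] h)),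
      (∀ s Φ', IsLieExtension K (suspendedDeg ℝ smoothFunctions)
          (smoothPhi s) Φ' ↔ Φ' = Φ s) ∧
      (∀ n (l : Fin n → smoothFunctions ⊗[ℝ] h) (s : Set.Icc (0 : ℝ) 1),
        Φ s n (fun i => oneForm (l i)) =
          whitneyDt ℝ ⊗ₜ[ℝ] smoothEval s (M n l)) ∧
      (∀ n (q : Fin (n + 1) → ℤ) (l : Fin (n + 1) → smoothFunctions ⊗[ℝ] h),
        (∀ i, l i ∈ K.degExt smoothFunctions (q i)) → ∀ s : Set.Icc (0 : ℝ) 1,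
        smoothEval s (M (n + 1) l) = ∫ t in simplex (n + 1) s,
          ∑ σ : Equiv.Perm (Fin (n + 1)), ∑ τ : Equiv.Perm (Fin (n + 1)),
            koszulSign q τ • (eulerianCoeff σ : ℝ) •
              nestedBracket (fun x y => K.bracket x y)
                (fun i => smoothEval (toUnit (t (σ i))) (l (τ i)))) ∧
      SmoothRecursion K (fun n => M n) ∧
      (∀ M', SmoothRecursion K M' →
        ∀ n (q : Fin (n + 1) → ℤ) (l : Fin (n + 1) → smoothFunctions ⊗[ℝ] h),
          (∀ i, l i ∈ K.degExt smoothFunctions (q i)) → M' (n + 1) l = M (n + 1) l) ∧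
      (∀ l ∈ K.degExt smoothFunctions 0, ∀ P : ℕ → Set.Icc (0 : ℝ) 1 → h,
        (∀ n s, P n s = ((n.factorial : ℝ)⁻¹) • smoothEval s (M n (fun _ => l))) →
        (∀ n (s : Set.Icc (0 : ℝ) 1), P (n + 1) s = ∫ t in simplex (n + 1) s,
          ∑ σ : Equiv.Perm (Fin (n + 1)), (eulerianCoeff σ : ℝ) •
            nestedBracket (fun x y => K.bracket x y)
              (fun i => smoothEval (toUnit (t (σ i))) l)) ∧
        (∀ s : Set.Icc (0 : ℝ) 1,
          P 1 s = ∫ u in (0 : ℝ)..s, smoothEval (toUnit u) l) ∧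
        (∀ n (s : Set.Icc (0 : ℝ) 1), P (n + 2) s = ∑ c : Composition (n + 1),
          (((-1) ^ c.length * bernoulli c.length / (c.length.factorial : ℚ) : ℚ) : ℝ) •
            ∫ u in (0 : ℝ)..s,
              nest (fun x y => K.bracket x y)
                (fun j => P (c.blocksFun j) (toUnit u))
                (smoothEval (toUnit u) l))) := by
  have hJ := isRotaBaxter_smoothPrimitive
  have hE := fun s : Set.Icc (0 : ℝ) 1 =>
    isPathIntegral_smooth.isLieExtension (L := K) (smoothPrimitive_scale s)
  have hc : ∀ s : Set.Icc (0 : ℝ) 1,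
      (smoothEvalHom 1).comp (smoothScaleHom s) = smoothEvalHom s := by
    intro s
    refine AlgHom.ext fun f => ?_
    exact congrArg f.1 (mul_one s)
  refine ⟨_, explicitTerm K smoothPrimitive, fun s Φ' => ⟨fun h => (hE s).unique h, ?_⟩, ?_, ?_,
    (smoothRecursion_iff K _).2 (tensorRecursion_explicitTerm hJ), ?_, ?_⟩
  · rintro rfl
    exact hE s
  · intro n l s
    rw [extendedPhi_oneForm, hc]
    rfl
  · intro n q l hl s
    -- Continuous functions on all of `ℝ^(n+1)` serve as the algebra of several variables: clamping
    -- extends the arguments there, and continuity suffices for integrability on the simplex.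
    have h1 := congrArg (TensorProduct.lid ℝ h) (rTensor_explicitTerm smoothAt (simplexIntegral (n + 1) s)
      (smoothEvalHom s).toLinearMap (simplexIntegral_prod s) q l hl)
    refine h1.trans ((evalExt_simplexIntegral _ _ _).trans ?_)
    simp only [map_sum, map_smul, Units.smul_def, map_zsmul, evalExt_nestedBracket, evalExt_smoothAt]
  · intro M' hM' n q l hl
    exact TensorRecursion.eq_explicitTerm hJ ((smoothRecursion_iff K _).1 hM') q l hl
  · intro l hl P hP
    have hP' : ∀ n s, P n s = smoothEval s (((n.factorial : ℝ)⁻¹) •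
        explicitTerm K smoothPrimitive n fun _ => l) := fun n s => by rw [hP, map_smul]
    refine ⟨fun n s => ?_, fun s => ?_, fun n s => ?_⟩
    · have h1 := congrArg (TensorProduct.lid ℝ h) (rTensor_explicitTerm_const smoothAt
        (simplexIntegral (n + 1) s) (smoothEvalHom s).toLinearMap (simplexIntegral_prod s) l hl)
      rw [hP']
      refine h1.trans ((evalExt_simplexIntegral _ _ _).trans ?_)
      simp only [map_sum, map_smul, evalExt_nestedBracket, evalExt_smoothAt]
    · rw [hP, Nat.factorial_one, Nat.cast_one, inv_one, one_smul]
      exact ((smoothRecursion_iff K _).2 (tensorRecursion_explicitTerm hJ)).1 0 _ hl s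
    · rw [hP', explicitTerm_const_recursion hJ l hl n]
      simp only [map_sum, map_smul]
      refine Finset.sum_congr rfl fun c _ => congrArg _ ?_
      rw [smoothEval_rTensor_smoothPrimitive]
      simp only [hP', smoothEval_eq, evalExt_nest]

end SmoothTheorem

end Magnus

end

theorem mainTheorem11
    {𝕜 : Type*} [Field 𝕜] [CharZero 𝕜] {g : Type*} [AddCommGroup g] [Module 𝕜 g]
    (L : Magnus.DGLieAlgebra 𝕜 g)
    {h : Type*} [NormedAddCommGroup h] [NormedSpace ℝ h] [FiniteDimensional ℝ h]
    (K : Magnus.DGLieAlgebra ℝ h) :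
    -- polynomial forms over a field of characteristic zero
    (∃ (Φ : 𝕜 → ∀ n, MultilinearMap 𝕜
          (fun _ : Fin n => Magnus.Forms (Polynomial 𝕜) ⊗[𝕜] g) (Magnus.Whitney 𝕜 ⊗[𝕜] g))
        (M : ∀ n, MultilinearMap 𝕜
          (fun _ : Fin n => Polynomial 𝕜 ⊗[𝕜] g) (Polynomial 𝕜 ⊗[𝕜] g)),
      -- `Φ s` is the extension of scalars of `φ_s` by `g`
      (∀ s Φ', Magnus.IsLieExtension L (Magnus.suspendedDeg 𝕜 (Polynomial 𝕜))
          (Magnus.polyPhi 𝕜 s) Φ' ↔ Φ' = Φ s) ∧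
      -- `M` is defined by restricting `Φ s` to one-forms
      (∀ n (l : Fin n → Polynomial 𝕜 ⊗[𝕜] g) (s : 𝕜),
        Φ s n (fun i => Magnus.oneForm (l i)) =
          Magnus.whitneyDt 𝕜 ⊗ₜ[𝕜] Magnus.polyEval s (M n l)) ∧
      -- the explicit formula
      (∀ n (q : Fin (n + 1) → ℤ) (l : Fin (n + 1) → Polynomial 𝕜 ⊗[𝕜] g),
        (∀ i, l i ∈ L.degExt (Polynomial 𝕜) (q i)) →
        M (n + 1) l = LinearMap.rTensor g (Magnus.polySimplexIntegral 𝕜 (n + 1))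
          (∑ σ : Equiv.Perm (Fin (n + 1)), ∑ τ : Equiv.Perm (Fin (n + 1)),
            Magnus.koszulSign q τ • (Magnus.eulerianCoeff σ : 𝕜) •
              Magnus.nestedBracket (L.bracketExt (MvPolynomial (Fin (n + 1)) 𝕜))
                (fun i => Magnus.polyAt (σ i) (l (τ i))))) ∧
      -- the recursive formula, which determines `M`
      Magnus.PolyRecursion L (fun n => M n) ∧
      (∀ M', Magnus.PolyRecursion L M' →
        ∀ n (q : Fin (n + 1) → ℤ) (l : Fin (n + 1) → Polynomial 𝕜 ⊗[𝕜] g),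
          (∀ i, l i ∈ L.degExt (Polynomial 𝕜) (q i)) → M' (n + 1) l = M (n + 1) l) ∧
      -- the terms `M_n(l ⊙ ⋯ ⊙ l) / n!` of the pushforward of `l(t) dt`, for `l` of degree zero:
      -- the formula of Mielnik and Plebanski and the recursion of Magnus
      (∀ l ∈ L.degExt (Polynomial 𝕜) 0, ∀ P : ℕ → Polynomial 𝕜 ⊗[𝕜] g,
        (∀ n, P n = ((n.factorial : 𝕜)⁻¹) • M n (fun _ => l)) →
        (∀ n, P (n + 1) = LinearMap.rTensor g (Magnus.polySimplexIntegral 𝕜 (n + 1))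
          (∑ σ : Equiv.Perm (Fin (n + 1)), (Magnus.eulerianCoeff σ : 𝕜) •
            Magnus.nestedBracket (L.bracketExt (MvPolynomial (Fin (n + 1)) 𝕜))
              (fun i => Magnus.polyAt (σ i) l))) ∧
        P 1 = LinearMap.rTensor g (Magnus.polyPrimitive 𝕜) l ∧
        (∀ n, P (n + 2) = ∑ c : Composition (n + 1),
          (((-1) ^ c.length * bernoulli c.length / (c.length.factorial : ℚ) : ℚ) : 𝕜) •
            LinearMap.rTensor g (Magnus.polyPrimitive 𝕜)
              (Magnus.nest (L.bracketExt (Polynomial 𝕜)) (fun j => P (c.blocksFun j)) l)))) ∧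
    -- smooth real forms, with values in a dg Lie algebra of finite dimension
    (∃ (Φ : Set.Icc (0 : ℝ) 1 → ∀ n, MultilinearMap ℝ
          (fun _ : Fin n => Magnus.Forms Magnus.smoothFunctions ⊗[ℝ] h) (Magnus.Whitney ℝ ⊗[ℝ] h))
        (M : ∀ n, MultilinearMap ℝ
          (fun _ : Fin n => Magnus.smoothFunctions ⊗[ℝ] h) (Magnus.smoothFunctions ⊗[ℝ] h)),
      (∀ s Φ', Magnus.IsLieExtension K (Magnus.suspendedDeg ℝ Magnus.smoothFunctions)
          (Magnus.smoothPhi s) Φ' ↔ Φ' = Φ s) ∧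
      (∀ n (l : Fin n → Magnus.smoothFunctions ⊗[ℝ] h) (s : Set.Icc (0 : ℝ) 1),
        Φ s n (fun i => Magnus.oneForm (l i)) =
          Magnus.whitneyDt ℝ ⊗ₜ[ℝ] Magnus.smoothEval s (M n l)) ∧
      (∀ n (q : Fin (n + 1) → ℤ) (l : Fin (n + 1) → Magnus.smoothFunctions ⊗[ℝ] h),
        (∀ i, l i ∈ K.degExt Magnus.smoothFunctions (q i)) → ∀ s : Set.Icc (0 : ℝ) 1,
        Magnus.smoothEval s (M (n + 1) l) = ∫ t in Magnus.simplex (n + 1) s,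
          ∑ σ : Equiv.Perm (Fin (n + 1)), ∑ τ : Equiv.Perm (Fin (n + 1)),
            Magnus.koszulSign q τ • (Magnus.eulerianCoeff σ : ℝ) •
              Magnus.nestedBracket (fun x y => K.bracket x y)
                (fun i => Magnus.smoothEval (Magnus.toUnit (t (σ i))) (l (τ i)))) ∧
      Magnus.SmoothRecursion K (fun n => M n) ∧
      (∀ M', Magnus.SmoothRecursion K M' →
        ∀ n (q : Fin (n + 1) → ℤ) (l : Fin (n + 1) → Magnus.smoothFunctions ⊗[ℝ] h),
          (∀ i, l i ∈ K.degExt Magnus.smoothFunctions (q i)) → M' (n + 1) l = M (n + 1) l) ∧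
      (∀ l ∈ K.degExt Magnus.smoothFunctions 0, ∀ P : ℕ → Set.Icc (0 : ℝ) 1 → h,
        (∀ n s, P n s = ((n.factorial : ℝ)⁻¹) • Magnus.smoothEval s (M n (fun _ => l))) →
        (∀ n (s : Set.Icc (0 : ℝ) 1), P (n + 1) s = ∫ t in Magnus.simplex (n + 1) s,
          ∑ σ : Equiv.Perm (Fin (n + 1)), (Magnus.eulerianCoeff σ : ℝ) •
            Magnus.nestedBracket (fun x y => K.bracket x y)
              (fun i => Magnus.smoothEval (Magnus.toUnit (t (σ i))) l)) ∧
        (∀ s : Set.Icc (0 : ℝ) 1,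
          P 1 s = ∫ u in (0 : ℝ)..s, Magnus.smoothEval (Magnus.toUnit u) l) ∧
        (∀ n (s : Set.Icc (0 : ℝ) 1), P (n + 2) s = ∑ c : Composition (n + 1),
          (((-1) ^ c.length * bernoulli c.length / (c.length.factorial : ℚ) : ℚ) : ℝ) •
            ∫ u in (0 : ℝ)..s,
              Magnus.nest (fun x y => K.bracket x y)
                (fun j => P (c.blocksFun j) (Magnus.toUnit u))
                (Magnus.smoothEval (Magnus.toUnit u) l)))) := by
  exact ⟨Magnus.exists_polynomial_extension L, Magnus.exists_smooth_extension K⟩
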